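/- **Setting.** Let $1\le r$, let $\mathcal L:\mathbb R^{n\times q}\to\mathbb R$ be twice continuously differentiable, and let $X^*=U^*(V^*)^{\top}$ with $U^*\in\mathbb R^{n\times r}$, $V^*\in\mathbb R^{q\times r}$ have rank $r$. Assume $\nabla\mathcal L(X^*)=0$ (noiseless case) and that the factors are balanced, $n^{-1}U^{*\top}U^*=q^{-1}V^{*\top}V^*$. Put $\kappa=\sigma_1(X^*)/\sigma_r(X^*)$, $\sigma_{\min}=\sigma_r(X^*)/\sqrt{nq}$, $\tau_*=\{(n^{-1}\|U^*\|_{\rm F}^2+q^{-1}\|V^*\|_{\rm F}^2)/2\}^{1/2}$ and $\omega_*=\max(\|U^*\|_{2\to\infty},\|V^*\|_{2\to\infty})$. Here $\|\cdot\|$, $\|\cdot\|_{\rm F}$ and $\|\cdot\|_{2\to\infty}$ are the operator norm, the Frobenius norm, and the largest Euclidean norm of a row. An *optimal alignment* of $(U,V)\in\mathbb R^{n\times r}\times\mathbb R^{q\times r}$ is a minimizer $G^*$ over $G\in GL(r)$ of $n^{-1}\|UG-U^*\|_{\rm F}^2+q^{-1}\|VG^{-\top}-V^*\|_{\rm F}^2$.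 When one exists, let $dist_2(U,V)$ be the square root of the minimum, and $dist_\infty(U,V)=\max(\|UG^*-U^*\|_{2\to\infty},\|V(G^*)^{-\top}-V^*\|_{2\to\infty})$; a bound on $dist_\infty$ is understood to hold for every optimal alignment. For $\epsilon>0$ let $\mathcal D^{(2)}(\epsilon)$ be the set of pairs that have an optimal alignment and satisfy $dist_2(U,V)\le\epsilon\tau_*$, and $\mathcal D^{(\infty)}(\epsilon)$ the set of those which also satisfy $dist_\infty(U,V)\le\epsilon\omega_*$. Write $\mathcal G(U,V)=\nabla\mathcal L(UV^\top)$ and $\mathcal P_{(U,V)}(R,L)=UR^\top+LV^\top$. For a set $\mathcal D$ of pairs and $\beta\ge\alpha>0$ consider the conditions: * (A1) for all $(U,V)\in\mathcal D$ and all $(L,R)\in\mathbb R^{n\times r}\times\mathbb R^{q\times r}$, with $P=\mathcal P_{(U,V)}(R,L)$: $\ \alpha\|P\|_{\rm F}^2\le\nabla^2\mathcal L(UV^\top)[P,P]\le\beta\|P\|_{\rm F}^2$; * (A2) $\|\mathcal G(U_1,V_1)-\mathcal G(U_2,V_2)\|\le L_2\|U_1V_1^\top-U_2V_2^\top\|_{\rm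 F}$ for all $(U_1,V_1),(U_2,V_2)\in\mathcal D$; * (A3) for all $(U,V)\in\mathcal D$, $h\in\mathbb R^r$, $L,R$, $i\in[n]$, $j\in[q]$, $|\nabla^2\mathcal L(UV^\top)[\mathcal P_{(U,V)}(0,e_ih^\top),\mathcal P_{(U,V)}(R,L_{-i})]|\le\beta\|Vh\|\,\|U_{i,\cdot}R^\top\|$ and $|\nabla^2\mathcal L(UV^\top)[\mathcal P_{(U,V)}(e_jh^\top,0),\mathcal P_{(U,V)}(R_{-j},L)]|\le\beta\|Uh\|\,\|L(V_{j,\cdot})^\top\|$, where $L_{-i}$ is $L$ with $i$th row replaced by $0$, and $R_{-j}$ is $R$ with $j$th row replaced by $0$; * (A4) for all $(U_1,V_1),(U_2,V_2)\in\mathcal D$, $\|\mathcal G(U_1,V_1)-\mathcal G(U_2,V_2)\|_{2\to\infty}\le L_\infty\|U_1V_1^\top-U_2V_2^\top\|_{2\to\infty}$ and $\|\{\mathcal G(U_1,V_1)-\mathcal G(U_2,V_2)\}^\top\|_{2\to\infty}\le L_\infty\|V_1U_1^\top-V_2U_2^\top\|_{2\to\infty}$. Let $(U^t,V^t)_{t\ge0}$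 be given by unregularized gradient descent, $$U^{t+1}=U^t-q^{-1}\eta\,\nabla_U\mathcal L(U^t(V^t)^\top),\qquad V^{t+1}=V^t-n^{-1}\eta\,\nabla_V\mathcal L(U^t(V^t)^\top),$$ with $\eta=\{10(\alpha+\beta)\kappa\sigma_{\min}\}^{-1}$, and let $\rho=1-\eta\alpha\sigma_{\min}/4$. **Theorem.** Fix $L_2$ and a lower bound $b>0$ for $\beta$. *($\ell_2$-error contraction.)* There is a constant $c_0>0$, depending only on $L_2$ and $b$, such that the following holds for all $n,q,r,\mathcal L,U^*,V^*$ as above, all $\epsilon>0$ and all $\beta\ge\alpha>0$ with $\beta\ge b$. Suppose (A1) and (A2) hold on $\mathcal D=\mathcal D^{(2)}(\epsilon)$, and for some orthogonal matrix $R^0$ and some $\phi_{nq}$ $$\big(n^{-1}\|U^0R^0-U^*\|_{\rm F}^2+q^{-1}\|V^0R^0-V^*\|_{\rm F}^2\big)^{1/2}\le\tfrac12\phi_{nq}\tau_*,\qquad \phi_{nq}\le\min\Big(\frac\epsilon2,\ c_0\frac{\alpha(\alpha+\kappa)}{\beta\kappa^2\sqrt{r\kappa}}\Big).\tag{1}$$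 Then for every $t\ge0$ an optimal alignment of $(U^t,V^t)$ exists and $$dist_2(U^t,V^t)\le\rho^t\phi_{nq}\tau_*.\tag{2}$$ *($\ell_\infty$-error contraction.)* For every $L_\infty$ there is a constant $c_0>0$, depending only on $L_2$, $L_\infty$ and $b$, such that the following holds for all $n,q,r,\mathcal L,U^*,V^*,\epsilon,\alpha,\beta$ as before. Suppose (A1)–(A4) hold on $\mathcal D=\mathcal D^{(\infty)}(\epsilon)$, (1) holds, and for some $\psi_{nq}>0$ $$\max\big(\|U^0R^0-U^*\|_{2\to\infty},\|V^0R^0-V^*\|_{2\to\infty}\big)\le\tfrac12\psi_{nq}\omega_*,\qquad\psi_{nq}\le\frac\epsilon2,\qquad \frac\beta\alpha\kappa^{3/2}\sqrt r\,\frac{\phi_{nq}}{\psi_{nq}}\le c_0.$$ Then for every $t\ge0$ an optimal alignment of $(U^t,V^t)$ exists, (2) holds, and $dist_\infty(U^t,V^t)\le\rho^t\psi_{nq}\omega_*$. -/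

import Mathlib

open scoped Matrix Matrix.Norms.Frobenius

noncomputable section

namespace LowRank

/-! The norm `‖M‖` of a matrix is its Frobenius norm throughout. -/

/-- The operator norm of a matrix with respect to the Euclidean norms. -/
def opNorm {m k : ℕ} (M : Matrix (Fin m) (Fin k) ℝ) : ℝ :=
  ‖LinearMap.toContinuousLinearMap (Matrix.toEuclideanLin M)‖

/-- The Euclidean norm of a coordinate vector. -/
def vecNorm {m : ℕ} (x : Fin m → ℝ) : ℝ := ‖WithLp.toLp 2 x‖

/-- The two-to-infinity norm: the largest Euclidean norm of a row. -/
def rowNorm {m k : ℕ} (M : Matrix (Fin m) (Fin k) ℝ) : ℝ := ⨆ i, vecNorm (M i)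

/-- The `k`-th largest singular value, `k = 1, 2, …`
(Mathlib's sequence of singular values starts at index `0`). -/
def sigma {m l : ℕ} (k : ℕ) (M : Matrix (Fin m) (Fin l) ℝ) : ℝ :=
  (Matrix.toEuclideanLin M).singularValues (k - 1)

/-- The derivative of `f` at `x` in the direction `v`. -/
def dirDeriv {E : Type*} [NormedAddCommGroup E] [NormedSpace ℝ E] (f : E → ℝ) (x v : E) : ℝ :=
  fderiv ℝ f x v

/-- The second derivative of `f` at `x`, as a bilinear form. -/
def hess {E : Type*} [NormedAddCommGroup E] [NormedSpace ℝ E] (f : E → ℝ) (x v w : E) : ℝ :=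
  fderiv ℝ (fderiv ℝ f) x v w

/-- The gradient of a function of a matrix, as the matrix of its partial derivatives. -/
def matGrad {m k : ℕ} (f : Matrix (Fin m) (Fin k) ℝ → ℝ) (X : Matrix (Fin m) (Fin k) ℝ) :
    Matrix (Fin m) (Fin k) ℝ :=
  Matrix.of fun i j => dirDeriv f X (Matrix.single i j 1)

variable {n q r : ℕ}

/-! ### Alignment over `GL(r)` and the two distances -/

/-- `U G - U*`. -/
def errU (U Us : Matrix (Fin n) (Fin r) ℝ) (G : GL (Fin r) ℝ) : Matrix (Fin n) (Fin r) ℝ :=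
  U * (G : Matrix (Fin r) (Fin r) ℝ) - Us

/-- `V G⁻ᵀ - V*`. -/
def errV (V Vs : Matrix (Fin q) (Fin r) ℝ) (G : GL (Fin r) ℝ) : Matrix (Fin q) (Fin r) ℝ :=
  V * ((G⁻¹ : GL (Fin r) ℝ) : Matrix (Fin r) (Fin r) ℝ)ᵀ - Vs

/-- The weighted Frobenius norm of a pair of blocks. -/
def pairNorm2 (A : Matrix (Fin n) (Fin r) ℝ) (B : Matrix (Fin q) (Fin r) ℝ) : ℝ :=
  √((n : ℝ)⁻¹ * ‖A‖ ^ 2 + (q : ℝ)⁻¹ * ‖B‖ ^ 2)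

/-- The two-to-infinity norm of a pair of blocks. -/
def pairNormInf (A : Matrix (Fin n) (Fin r) ℝ) (B : Matrix (Fin q) (Fin r) ℝ) : ℝ :=
  max (rowNorm A) (rowNorm B)

/-- `G` attains the minimum over `GL(r)` of `n⁻¹ ‖U G - U*‖² + q⁻¹ ‖V G⁻ᵀ - V*‖²`. -/
def IsOptAlign (U : Matrix (Fin n) (Fin r) ℝ) (V : Matrix (Fin q) (Fin r) ℝ)
    (Us : Matrix (Fin n) (Fin r) ℝ) (Vs : Matrix (Fin q) (Fin r) ℝ) (G : GL (Fin r) ℝ) : Prop :=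
  ∀ G' : GL (Fin r) ℝ,
    (n : ℝ)⁻¹ * ‖errU U Us G‖ ^ 2 + (q : ℝ)⁻¹ * ‖errV V Vs G‖ ^ 2 ≤
      (n : ℝ)⁻¹ * ‖errU U Us G'‖ ^ 2 + (q : ℝ)⁻¹ * ‖errV V Vs G'‖ ^ 2

/-- `dist₂{(U, V), (U*, V*)} ≤ d`: an optimal alignment exists, and the weighted Frobenius error
after optimal alignment is at most `d` (its value is the same for every optimal alignment). -/
def Dist2LE (U : Matrix (Fin n) (Fin r) ℝ) (V : Matrix (Fin q) (Fin r) ℝ)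
    (Us : Matrix (Fin n) (Fin r) ℝ) (Vs : Matrix (Fin q) (Fin r) ℝ) (d : ℝ) : Prop :=
  (∃ G, IsOptAlign U V Us Vs G) ∧
    ∀ G, IsOptAlign U V Us Vs G → pairNorm2 (errU U Us G) (errV V Vs G) ≤ d

/-- `dist∞{(U, V), (U*, V*)} ≤ d`: an optimal alignment exists, and the two-to-infinity error
after optimal alignment is at most `d` (whichever optimal alignment is chosen). -/
def DistInfLE (U : Matrix (Fin n) (Fin r) ℝ) (V : Matrix (Fin q) (Fin r) ℝ)
    (Us : Matrix (Fin n) (Fin r) ℝ) (Vs : Matrix (Fin q) (Fin r) ℝ) (d : ℝ) : Prop :=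
  (∃ G, IsOptAlign U V Us Vs G) ∧
    ∀ G, IsOptAlign U V Us Vs G → pairNormInf (errU U Us G) (errV V Vs G) ≤ d

/-! ### Scales and local regions -/

/-- The scale `τ*`. -/
def tauStar (Us : Matrix (Fin n) (Fin r) ℝ) (Vs : Matrix (Fin q) (Fin r) ℝ) : ℝ :=
  √(((n : ℝ)⁻¹ * ‖Us‖ ^ 2 + (q : ℝ)⁻¹ * ‖Vs‖ ^ 2) / 2)

/-- The scale `ω*`. -/
def omegaStar (Us : Matrix (Fin n) (Fin r) ℝ) (Vs : Matrix (Fin q) (Fin r) ℝ) : ℝ :=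
  max (rowNorm Us) (rowNorm Vs)

/-- The local region defined by `dist₂ ≤ ε τ*`. -/
def region2 (Us : Matrix (Fin n) (Fin r) ℝ) (Vs : Matrix (Fin q) (Fin r) ℝ) (ε : ℝ) :
    Set (Matrix (Fin n) (Fin r) ℝ × Matrix (Fin q) (Fin r) ℝ) :=
  {p | Dist2LE p.1 p.2 Us Vs (ε * tauStar Us Vs)}

/-- The local region defined by `dist₂ ≤ ε τ*` and `dist∞ ≤ ε ω*`. -/
def regionInf (Us : Matrix (Fin n) (Fin r) ℝ) (Vs : Matrix (Fin q) (Fin r) ℝ) (ε : ℝ) :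
    Set (Matrix (Fin n) (Fin r) ℝ × Matrix (Fin q) (Fin r) ℝ) :=
  {p | Dist2LE p.1 p.2 Us Vs (ε * tauStar Us Vs) ∧ DistInfLE p.1 p.2 Us Vs (ε * omegaStar Us Vs)}

/-- The condition number `κ = σ₁(X*) / σ_r(X*)`, where `X* = U* V*ᵀ`. -/
def kappa (Us : Matrix (Fin n) (Fin r) ℝ) (Vs : Matrix (Fin q) (Fin r) ℝ) : ℝ :=
  sigma 1 (Us * Vsᵀ) / sigma r (Us * Vsᵀ)

/-- `σ_min = σ_r(X*) / √(n q)`, where `X* = U* V*ᵀ`. -/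
def sigmaMin (Us : Matrix (Fin n) (Fin r) ℝ) (Vs : Matrix (Fin q) (Fin r) ℝ) : ℝ :=
  sigma r (Us * Vsᵀ) / √((n : ℝ) * (q : ℝ))

/-- The step size `η = 1 / (10 (α + β) κ σ_min)`. -/
def stepSize (α β : ℝ) (Us : Matrix (Fin n) (Fin r) ℝ) (Vs : Matrix (Fin q) (Fin r) ℝ) : ℝ :=
  (10 * (α + β) * kappa Us Vs * sigmaMin Us Vs)⁻¹

/-- The contraction factor `ρ = 1 - η α σ_min / 4`. -/
def rate (α β : ℝ) (Us : Matrix (Fin n) (Fin r) ℝ) (Vs : Matrix (Fin q) (Fin r) ℝ) : ℝ :=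
  1 - stepSize α β Us Vs * α * sigmaMin Us Vs / 4

/-! ### Regularity conditions on the loss, over a set `D` of pairs of factors -/

/-- `𝒫_{(U,V)}(R, L) = U Rᵀ + L Vᵀ`. -/
def tangent (U : Matrix (Fin n) (Fin r) ℝ) (V R : Matrix (Fin q) (Fin r) ℝ)
    (L : Matrix (Fin n) (Fin r) ℝ) : Matrix (Fin n) (Fin q) ℝ :=
  U * Rᵀ + L * Vᵀ

/-- The score `𝒢(U, V)`: the gradient of the loss at `U Vᵀ`. -/
def score (f : Matrix (Fin n) (Fin q) ℝ → ℝ) (U : Matrix (Fin n) (Fin r) ℝ)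
    (V : Matrix (Fin q) (Fin r) ℝ) : Matrix (Fin n) (Fin q) ℝ :=
  matGrad f (U * Vᵀ)

/-- Restricted isometry on tangent directions. -/
def LocalRIP (f : Matrix (Fin n) (Fin q) ℝ → ℝ)
    (D : Set (Matrix (Fin n) (Fin r) ℝ × Matrix (Fin q) (Fin r) ℝ)) (α β : ℝ) : Prop :=
  ∀ U V, (U, V) ∈ D → ∀ (L : Matrix (Fin n) (Fin r) ℝ) (R : Matrix (Fin q) (Fin r) ℝ),
    α * ‖U * Rᵀ + L * Vᵀ‖ ^ 2 ≤ hess f (U * Vᵀ) (tangent U V R L) (tangent U V R L) ∧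
      hess f (U * Vᵀ) (tangent U V R L) (tangent U V R L) ≤ β * ‖U * Rᵀ + L * Vᵀ‖ ^ 2

/-- Lipschitz continuity of the score from the Frobenius norm to the operator norm. -/
def ScoreLipOp (f : Matrix (Fin n) (Fin q) ℝ → ℝ)
    (D : Set (Matrix (Fin n) (Fin r) ℝ × Matrix (Fin q) (Fin r) ℝ)) (L₂ : ℝ) : Prop :=
  ∀ U₁ V₁ U₂ V₂, (U₁, V₁) ∈ D → (U₂, V₂) ∈ D →
    opNorm (score f U₁ V₁ - score f U₂ V₂) ≤ L₂ * ‖U₁ * V₁ᵀ - U₂ * V₂ᵀ‖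

/-- Row-wise control of the Hessian: a direction supported on a single row, against a direction
whose block of the same type vanishes on that row. -/
def RowCrossCurvature (f : Matrix (Fin n) (Fin q) ℝ → ℝ)
    (D : Set (Matrix (Fin n) (Fin r) ℝ × Matrix (Fin q) (Fin r) ℝ)) (β : ℝ) : Prop :=
  ∀ U V, (U, V) ∈ D → ∀ (h : Fin r → ℝ) (L : Matrix (Fin n) (Fin r) ℝ)
    (R : Matrix (Fin q) (Fin r) ℝ),
    (∀ i : Fin n,
      |hess f (U * Vᵀ) (tangent U V 0 (Matrix.vecMulVec (Pi.single i 1) h))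
          (tangent U V R (L.updateRow i 0))| ≤
        β * vecNorm (V *ᵥ h) * vecNorm (U i ᵥ* Rᵀ)) ∧
    (∀ j : Fin q,
      |hess f (U * Vᵀ) (tangent U V (Matrix.vecMulVec (Pi.single j 1) h) 0)
          (tangent U V (R.updateRow j 0) L)| ≤
        β * vecNorm (U *ᵥ h) * vecNorm (L *ᵥ V j))

/-- Lipschitz continuity of the score and of its transpose in the two-to-infinity norm. -/
def ScoreLipRow (f : Matrix (Fin n) (Fin q) ℝ → ℝ)
    (D : Set (Matrix (Fin n) (Fin r) ℝ × Matrix (Fin q) (Fin r) ℝ)) (Linf : ℝ) : Prop :=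
  ∀ U₁ V₁ U₂ V₂, (U₁, V₁) ∈ D → (U₂, V₂) ∈ D →
    rowNorm (score f U₁ V₁ - score f U₂ V₂) ≤ Linf * rowNorm (U₁ * V₁ᵀ - U₂ * V₂ᵀ) ∧
      rowNorm (score f U₁ V₁ - score f U₂ V₂)ᵀ ≤ Linf * rowNorm (V₁ * U₁ᵀ - V₂ * U₂ᵀ)

/-! ### The model and the algorithm -/

/-- The noiseless model: a twice continuously differentiable loss, a true matrix `U* V*ᵀ` of
rank `r ≥ 1` at which the gradient of the loss vanishes, and balanced true factors. -/
structure NoiselessBalanced (f : Matrix (Fin n) (Fin q) ℝ → ℝ) (Us : Matrix (Fin n) (Fin r) ℝ)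
    (Vs : Matrix (Fin q) (Fin r) ℝ) : Prop where
  smooth : ContDiff ℝ 2 f
  one_le : 1 ≤ r
  rank_eq : (Us * Vsᵀ).rank = r
  stationary : matGrad f (Us * Vsᵀ) = 0
  balanced : (n : ℝ)⁻¹ • (Usᵀ * Us) = (q : ℝ)⁻¹ • (Vsᵀ * Vs)

/-- Unregularized gradient descent on `(U, V) ↦ f (U Vᵀ)` with constant step size `η`. -/
def IsGradientDescent (f : Matrix (Fin n) (Fin q) ℝ → ℝ) (η : ℝ)
    (U : ℕ → Matrix (Fin n) (Fin r) ℝ) (V : ℕ → Matrix (Fin q) (Fin r) ℝ) : Prop :=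
  ∀ t : ℕ,
    U (t + 1) = U t - ((q : ℝ)⁻¹ * η) • matGrad (fun W => f (W * (V t)ᵀ)) (U t) ∧
      V (t + 1) = V t - ((n : ℝ)⁻¹ * η) • matGrad (fun W => f (U t * Wᵀ)) (V t)

/-- The initialization condition in the weighted Frobenius norm, after the rotation `R₀`. -/
def Init2 (c₀ α β ε φ : ℝ) (Us : Matrix (Fin n) (Fin r) ℝ) (Vs : Matrix (Fin q) (Fin r) ℝ)
    (U₀ : Matrix (Fin n) (Fin r) ℝ) (V₀ : Matrix (Fin q) (Fin r) ℝ)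
    (R₀ : Matrix (Fin r) (Fin r) ℝ) : Prop :=
  pairNorm2 (U₀ * R₀ - Us) (V₀ * R₀ - Vs) ≤ 1 / 2 * φ * tauStar Us Vs ∧
    φ ≤ min (ε / 2) (c₀ * (α * (α + kappa Us Vs) /
      (β * kappa Us Vs ^ 2 * √((r : ℝ) * kappa Us Vs))))

/-- The initialization condition in the two-to-infinity norm, after the rotation `R₀`. -/
def InitInf (c₀ α β ε φ ψ : ℝ) (Us : Matrix (Fin n) (Fin r) ℝ) (Vs : Matrix (Fin q) (Fin r) ℝ)
    (U₀ : Matrix (Fin n) (Fin r) ℝ) (V₀ : Matrix (Fin q) (Fin r) ℝ)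
    (R₀ : Matrix (Fin r) (Fin r) ℝ) : Prop :=
  pairNormInf (U₀ * R₀ - Us) (V₀ * R₀ - Vs) ≤ 1 / 2 * ψ * omegaStar Us Vs ∧
    ψ ≤ ε / 2 ∧
    β / α * kappa Us Vs ^ (3 / 2 : ℝ) * √(r : ℝ) * (φ / ψ) ≤ c₀

end LowRank

end

namespace LowRank

/-! ### Euclidean norms of vectors and rows -/

section Basics

variable {m k l p : ℕ}

/-! Divide each factor by the square root of its number of rows. Balance gives the two normalized
true factors one common Gram matrix, whose eigenvalues are the nonzero singular values of the true
matrix over `√(nq)`. Their singular values thus lie between `a = √σ_min` and `c = √(κ σ_min)`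
(`gram_bounds`), and a descent step reads `A ↦ A - η g B`, `B ↦ B - η gᵀ A` with `g` the score over
`√(nq)`.

Frobenius part. The loss is blind to `(U, V) ↦ (UG, VG⁻ᵀ)`, so errors are measured at an optimal
`G`. Stationarity in `G` (`IsOptAlign.first_order`) makes the errors `ΔA`, `ΔB` essentially
transversal to the orbit: the tangent matrix `A ΔBᵀ + ΔA Bᵀ` has squared norm at least `0.8 a² d²`,
where `d² = ‖ΔA‖² + ‖ΔB‖²` (`tangent_lower_bound`). The score vanishes at the truth, so a mean value
theorem along the segment of factors turns its pairing with the error into a Hessian term. The test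
direction moves affinely with the path so as to be tangent at the intermediate point, where
`LocalRIP` applies; the price is a remainder controlled by `ScoreLipOp`. The outcome is
`frobenius_step`, a decrease of `d²` by the factor `1 - ηαa²/2` with a multiple of the squared
gradient to spare.

In aligned coordinates the step is distorted by `GᵀG`, which is close to the identity if the current
factors are nearly balanced (`gram_close`). No regularizer enforces this. The first-order change of
`AᵀA - BᵀB` cancels, so imbalance grows by at most `η²` times the squared gradient, which the spare
term above pays for. Hence imbalance plus `1.1 d²` never increases (`pairNorm2_step`), and
re-optimizing `G` only lowers it.

Row part. With `G` fixed, each row of `U - U*G⁻¹` or `V - V*Gᵀ` undergoes a gradient step for a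
well-conditioned quadratic form on `ℝʳ`. The other rows and the opposite factor enter through terms
bounded by `RowCrossCurvature` and `ScoreLipRow`, all proportional to the Frobenius error
(`rowNorm_step`). Replacing `G` by the next optimal alignment costs a multiple of `d/a` per row
(`rowNorm_res_shift`). Since `d` decays at the rate `ρ` and starts small relative to `ψ`, the row
error decays at the same rate (`row_contraction_bound`).

The constants can depend on `L₂` and `b` alone because the assumptions force `α ≤ L₂`
(`alpha_le_of_scoreLip`), which makes `α + κ` at most `(1 + L₂)κ`. -/

theorem vecNorm_sq (x : Fin m → ℝ) : vecNorm x ^ 2 = x ⬝ᵥ x := by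
  unfold vecNorm
  rw [EuclideanSpace.norm_sq_eq]
  simp [dotProduct, sq]

theorem vecNorm_nonneg (x : Fin m → ℝ) : 0 ≤ vecNorm x := norm_nonneg _

theorem vecNorm_zero : vecNorm (0 : Fin m → ℝ) = 0 := by simp [vecNorm]

theorem vecNorm_eq_zero {x : Fin m → ℝ} (h : vecNorm x = 0) : x = 0 := by
  simpa [vecNorm] using h

theorem vecNorm_pos {x : Fin m → ℝ} (h : x ≠ 0) : 0 < vecNorm x :=
  lt_of_le_of_ne (vecNorm_nonneg x) fun h' => h (vecNorm_eq_zero h'.symm)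

theorem vecNorm_add_le (x y : Fin m → ℝ) : vecNorm (x + y) ≤ vecNorm x + vecNorm y := by
  simpa [vecNorm] using norm_add_le (WithLp.toLp 2 x) (WithLp.toLp 2 y)

theorem vecNorm_sub_le (x y : Fin m → ℝ) : vecNorm (x - y) ≤ vecNorm x + vecNorm y := by
  simpa [vecNorm] using norm_sub_le (WithLp.toLp 2 x) (WithLp.toLp 2 y)

theorem vecNorm_smul (c : ℝ) (x : Fin m → ℝ) : vecNorm (c • x) = |c| * vecNorm x := by
  simp [vecNorm, norm_smul]

theorem vecNorm_neg (x : Fin m → ℝ) : vecNorm (-x) = vecNorm x := by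
  simp [vecNorm]

theorem abs_dotProduct_le (x y : Fin m → ℝ) : |x ⬝ᵥ y| ≤ vecNorm x * vecNorm y := by
  have := abs_real_inner_le_norm (WithLp.toLp 2 x) (WithLp.toLp 2 y)
  rw [EuclideanSpace.inner_toLp_toLp] at this
  simpa [vecNorm, dotProduct_comm] using this

theorem norm_sq_eq_sum_rows (M : Matrix (Fin m) (Fin k) ℝ) :
    ‖M‖ ^ 2 = ∑ i, vecNorm (M i) ^ 2 := by
  have h : 0 ≤ ∑ i, ∑ j, ‖M i j‖ ^ (2 : ℝ) := by positivity
  rw [Matrix.frobenius_norm_def, ← Real.sqrt_eq_rpow, Real.sq_sqrt h]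
  refine Finset.sum_congr rfl fun i _ => ?_
  rw [vecNorm_sq]
  simp [dotProduct, sq]

theorem vecNorm_row_le_rowNorm (M : Matrix (Fin m) (Fin k) ℝ) (i : Fin m) :
    vecNorm (M i) ≤ rowNorm M :=
  le_ciSup (f := fun i => vecNorm (M i)) (Set.finite_range _).bddAbove i

theorem rowNorm_nonneg (M : Matrix (Fin m) (Fin k) ℝ) : 0 ≤ rowNorm M :=
  Real.iSup_nonneg fun i => vecNorm_nonneg (M i)

theorem rowNorm_le {M : Matrix (Fin m) (Fin k) ℝ} {c : ℝ} (hc : 0 ≤ c)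
    (h : ∀ i, vecNorm (M i) ≤ c) : rowNorm M ≤ c :=
  Real.iSup_le h hc

/-! ### The trace inner product -/

/-- The trace inner product of two matrices. -/
noncomputable def ip (A B : Matrix (Fin m) (Fin k) ℝ) : ℝ := (Aᵀ * B).trace

theorem ip_eq_sum (A B : Matrix (Fin m) (Fin k) ℝ) : ip A B = ∑ i, A i ⬝ᵥ B i := by
  simp only [ip, Matrix.trace, Matrix.diag, Matrix.mul_apply, Matrix.transpose_apply, dotProduct]
  exact Finset.sum_comm

theorem ip_self (A : Matrix (Fin m) (Fin k) ℝ) : ip A A = ‖A‖ ^ 2 := by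
  rw [ip_eq_sum, norm_sq_eq_sum_rows]
  simp [vecNorm_sq]

theorem ip_comm (A B : Matrix (Fin m) (Fin k) ℝ) : ip A B = ip B A := by
  simp [ip_eq_sum, dotProduct_comm]

theorem ip_add_right (A B C : Matrix (Fin m) (Fin k) ℝ) : ip A (B + C) = ip A B + ip A C := by
  simp [ip, Matrix.mul_add]

theorem ip_sub_right (A B C : Matrix (Fin m) (Fin k) ℝ) : ip A (B - C) = ip A B - ip A C := by
  simp [ip, Matrix.mul_sub]

theorem ip_smul_right (c : ℝ) (A B : Matrix (Fin m) (Fin k) ℝ) : ip A (c • B) = c * ip A B := by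
  simp [ip]

theorem ip_add_left (A B C : Matrix (Fin m) (Fin k) ℝ) : ip (A + B) C = ip A C + ip B C := by
  simp [ip, Matrix.add_mul]

theorem ip_sub_left (A B C : Matrix (Fin m) (Fin k) ℝ) : ip (A - B) C = ip A C - ip B C := by
  simp [ip, Matrix.sub_mul]

theorem ip_smul_left (c : ℝ) (A B : Matrix (Fin m) (Fin k) ℝ) : ip (c • A) B = c * ip A B := by
  simp [ip]

theorem ip_zero_left (A : Matrix (Fin m) (Fin k) ℝ) : ip 0 A = 0 := by simp [ip]

theorem ip_zero_right (A : Matrix (Fin m) (Fin k) ℝ) : ip A 0 = 0 := by simp [ip]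

theorem ip_transpose (A B : Matrix (Fin m) (Fin k) ℝ) : ip Aᵀ Bᵀ = ip A B := by
  rw [ip_comm A B]
  simp only [ip, Matrix.transpose_transpose]
  exact Matrix.trace_mul_comm A Bᵀ

theorem norm_add_sq_ip (A B : Matrix (Fin m) (Fin k) ℝ) :
    ‖A + B‖ ^ 2 = ‖A‖ ^ 2 + 2 * ip A B + ‖B‖ ^ 2 := by
  simp only [← ip_self, ip_add_left, ip_add_right, ip_comm B A]; ring

theorem norm_sub_sq_ip (A B : Matrix (Fin m) (Fin k) ℝ) :
    ‖A - B‖ ^ 2 = ‖A‖ ^ 2 - 2 * ip A B + ‖B‖ ^ 2 := by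
  simp only [← ip_self, ip_sub_left, ip_sub_right, ip_comm B A]; ring

theorem abs_ip_le (A B : Matrix (Fin m) (Fin k) ℝ) : |ip A B| ≤ ‖A‖ * ‖B‖ := by
  refine abs_le_of_sq_le_sq ?_ (by positivity)
  have h : ∀ t : ℝ, 0 ≤ ‖B‖ ^ 2 * (t * t) + (2 * ip A B) * t + ‖A‖ ^ 2 := fun t => by
    have h1 := norm_add_sq_ip A (t • B)
    rw [ip_smul_right, norm_smul, mul_pow, Real.norm_eq_abs, sq_abs] at h1
    nlinarith [sq_nonneg ‖A + t • B‖]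
  have := discrim_le_zero h
  rw [discrim] at this
  nlinarith

theorem ip_mul_right (M : Matrix (Fin m) (Fin k) ℝ) (L : Matrix (Fin m) (Fin l) ℝ)
    (B : Matrix (Fin l) (Fin k) ℝ) : ip M (L * B) = ip (M * Bᵀ) L := by
  simp only [ip, Matrix.transpose_mul, Matrix.transpose_transpose]
  rw [← Matrix.mul_assoc, Matrix.trace_mul_comm, Matrix.mul_assoc]

theorem ip_mul_left (M : Matrix (Fin m) (Fin k) ℝ) (A : Matrix (Fin m) (Fin l) ℝ)
    (R : Matrix (Fin l) (Fin k) ℝ) : ip M (A * R) = ip (Aᵀ * M) R := by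
  simp only [ip, Matrix.transpose_mul, Matrix.transpose_transpose, Matrix.mul_assoc]

/-! ### Two-sided bounds on the action of a matrix -/

/-- `c` bounds the operator norm of `B`. -/
def UB (B : Matrix (Fin m) (Fin k) ℝ) (c : ℝ) : Prop :=
  ∀ x : Fin k → ℝ, vecNorm (B *ᵥ x) ≤ c * vecNorm x

/-- `c` bounds the least singular value of `B` from below. -/
def LB (B : Matrix (Fin m) (Fin k) ℝ) (c : ℝ) : Prop :=
  ∀ x : Fin k → ℝ, c * vecNorm x ≤ vecNorm (B *ᵥ x)

theorem UB.mono {B : Matrix (Fin m) (Fin k) ℝ} {c d : ℝ} (h : UB B c) (hcd : c ≤ d) : UB B d :=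
  fun x => (h x).trans (mul_le_mul_of_nonneg_right hcd (vecNorm_nonneg x))

theorem LB.mono {B : Matrix (Fin m) (Fin k) ℝ} {c d : ℝ} (h : LB B c) (hcd : d ≤ c) : LB B d :=
  fun x => (mul_le_mul_of_nonneg_right hcd (vecNorm_nonneg x)).trans (h x)

theorem mul_transpose_row (L : Matrix (Fin m) (Fin k) ℝ) (B : Matrix (Fin l) (Fin k) ℝ)
    (i : Fin m) : (L * Bᵀ) i = B *ᵥ L i := by
  ext j
  simp [Matrix.mul_apply, Matrix.mulVec, dotProduct, mul_comm]

theorem UB.norm_mul_transpose_le {B : Matrix (Fin l) (Fin k) ℝ} {c : ℝ} (h : UB B c) (hc : 0 ≤ c)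
    (L : Matrix (Fin m) (Fin k) ℝ) : ‖L * Bᵀ‖ ≤ c * ‖L‖ := by
  refine abs_le_of_sq_le_sq' ?_ (by positivity) |>.2
  rw [mul_pow, norm_sq_eq_sum_rows, norm_sq_eq_sum_rows, Finset.mul_sum]
  refine Finset.sum_le_sum fun i _ => ?_
  rw [mul_transpose_row, ← mul_pow]
  exact pow_le_pow_left₀ (vecNorm_nonneg _) (h _) 2

theorem LB.le_norm_mul_transpose {B : Matrix (Fin l) (Fin k) ℝ} {c : ℝ} (h : LB B c) (hc : 0 ≤ c)
    (L : Matrix (Fin m) (Fin k) ℝ) : c * ‖L‖ ≤ ‖L * Bᵀ‖ := by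
  refine abs_le_of_sq_le_sq' ?_ (norm_nonneg _) |>.2
  rw [mul_pow, norm_sq_eq_sum_rows, norm_sq_eq_sum_rows, Finset.mul_sum]
  refine Finset.sum_le_sum fun i _ => ?_
  rw [mul_transpose_row, ← mul_pow]
  exact pow_le_pow_left₀ (mul_nonneg hc (vecNorm_nonneg _)) (h _) 2

theorem UB.norm_mul_le {A : Matrix (Fin l) (Fin k) ℝ} {c : ℝ} (h : UB A c) (hc : 0 ≤ c)
    (R : Matrix (Fin k) (Fin m) ℝ) : ‖A * R‖ ≤ c * ‖R‖ := by
  have := h.norm_mul_transpose_le hc Rᵀ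
  rwa [← Matrix.transpose_mul, Matrix.frobenius_norm_transpose,
    Matrix.frobenius_norm_transpose] at this

theorem LB.le_norm_mul {A : Matrix (Fin l) (Fin k) ℝ} {c : ℝ} (h : LB A c) (hc : 0 ≤ c)
    (R : Matrix (Fin k) (Fin m) ℝ) : c * ‖R‖ ≤ ‖A * R‖ := by
  have := h.le_norm_mul_transpose hc Rᵀ
  rwa [← Matrix.transpose_mul, Matrix.frobenius_norm_transpose,
    Matrix.frobenius_norm_transpose] at this

theorem UB_norm (B : Matrix (Fin m) (Fin k) ℝ) : UB B ‖B‖ := fun x => by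
  have h := Matrix.frobenius_norm_mul B (Matrix.replicateCol Unit x)
  rwa [← Matrix.replicateCol_mulVec, Matrix.frobenius_norm_replicateCol,
    Matrix.frobenius_norm_replicateCol] at h

theorem UB.add {A B : Matrix (Fin m) (Fin k) ℝ} {c d : ℝ} (hA : UB A c) (hB : UB B d) :
    UB (A + B) (c + d) := fun x => by
  rw [Matrix.add_mulVec, add_mul]
  exact (vecNorm_add_le _ _).trans (add_le_add (hA x) (hB x))

theorem LB.add {A B : Matrix (Fin m) (Fin k) ℝ} {c d : ℝ} (hA : LB A c) (hB : UB B d) :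
    LB (A + B) (c - d) := fun x => by
  have h := vecNorm_sub_le (A *ᵥ x + B *ᵥ x) (B *ᵥ x)
  rw [add_sub_cancel_right] at h
  rw [Matrix.add_mulVec, sub_mul]
  linarith [hA x, hB x]

theorem UB.mul {A : Matrix (Fin l) (Fin m) ℝ} {B : Matrix (Fin m) (Fin k) ℝ} {c d : ℝ}
    (hA : UB A c) (hB : UB B d) (hc : 0 ≤ c) : UB (A * B) (c * d) := fun x => by
  rw [← Matrix.mulVec_mulVec, mul_assoc]
  exact (hA _).trans (mul_le_mul_of_nonneg_left (hB x) hc)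

theorem LB.mul {A : Matrix (Fin l) (Fin m) ℝ} {B : Matrix (Fin m) (Fin k) ℝ} {c d : ℝ}
    (hA : LB A c) (hB : LB B d) (hc : 0 ≤ c) : LB (A * B) (c * d) := fun x => by
  rw [← Matrix.mulVec_mulVec, mul_assoc]
  exact (mul_le_mul_of_nonneg_left (hB x) hc).trans (hA _)

theorem UB.smul {A : Matrix (Fin m) (Fin k) ℝ} {c : ℝ} (hA : UB A c) (a : ℝ) :
    UB (a • A) (|a| * c) := fun x => by
  rw [Matrix.smul_mulVec, vecNorm_smul, mul_assoc]
  exact mul_le_mul_of_nonneg_left (hA x) (abs_nonneg a)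

theorem LB.smul {A : Matrix (Fin m) (Fin k) ℝ} {c : ℝ} (hA : LB A c) (a : ℝ) :
    LB (a • A) (|a| * c) := fun x => by
  rw [Matrix.smul_mulVec, vecNorm_smul, mul_assoc]
  exact mul_le_mul_of_nonneg_left (hA x) (abs_nonneg a)

theorem transpose_mulVec_dotProduct (A : Matrix (Fin m) (Fin k) ℝ) (y : Fin m → ℝ)
    (x : Fin k → ℝ) : (Aᵀ *ᵥ y) ⬝ᵥ x = y ⬝ᵥ (A *ᵥ x) := by
  rw [Matrix.dotProduct_mulVec, Matrix.mulVec_transpose]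

theorem UB.transpose {A : Matrix (Fin m) (Fin k) ℝ} {c : ℝ} (hA : UB A c) (hc : 0 ≤ c) :
    UB Aᵀ c := fun y => by
  set z := Aᵀ *ᵥ y with hz
  have h1 : vecNorm z ^ 2 = y ⬝ᵥ (A *ᵥ z) := by
    rw [vecNorm_sq, ← transpose_mulVec_dotProduct A y z]
  have h2 : y ⬝ᵥ (A *ᵥ z) ≤ vecNorm y * (c * vecNorm z) :=
    (le_abs_self _).trans ((abs_dotProduct_le _ _).trans
      (mul_le_mul_of_nonneg_left (hA z) (vecNorm_nonneg y)))
  rcases (vecNorm_nonneg z).eq_or_lt with h | h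
  · rw [← h]; exact mul_nonneg hc (vecNorm_nonneg y)
  · refine le_of_mul_le_mul_right ?_ h
    nlinarith

theorem LB.of_mul_eq_one {A B : Matrix (Fin m) (Fin m) ℝ} {c : ℝ} (hc : 0 < c) (h : B * A = 1)
    (hB : UB B c) : LB A c⁻¹ := fun x => by
  have h1 := hB (A *ᵥ x)
  rw [Matrix.mulVec_mulVec, h, Matrix.one_mulVec] at h1
  rwa [inv_mul_le_iff₀ hc]

theorem opNorm_nonneg (M : Matrix (Fin m) (Fin k) ℝ) : 0 ≤ opNorm M := norm_nonneg _

theorem UB_opNorm (M : Matrix (Fin m) (Fin k) ℝ) : UB M (opNorm M) := fun x => by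
  have := (LinearMap.toContinuousLinearMap (Matrix.toEuclideanLin M)).le_opNorm (WithLp.toLp 2 x)
  simpa [vecNorm, opNorm] using this

/-- Moving one factor across the pairing leaves `M` acting on the other, so only the operator norm
of `M` is paid. This is why a Lipschitz bound on the score in operator norm is enough for the
remainders. -/
theorem abs_ip_mul_transpose_le {M : Matrix (Fin m) (Fin k) ℝ} {c : ℝ} (hM : UB M c) (hc : 0 ≤ c)
    (X : Matrix (Fin m) (Fin l) ℝ) (Y : Matrix (Fin k) (Fin l) ℝ) :
    |ip M (X * Yᵀ)| ≤ c * ‖X‖ * ‖Y‖ := by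
  rw [ip_mul_right, Matrix.transpose_transpose]
  refine (abs_ip_le _ _).trans ?_
  have := hM.norm_mul_le hc Y
  nlinarith [norm_nonneg X]

end Basics

/-! ### Spectral facts -/

section Spectral

variable {n q r : ℕ}

theorem exists_eigenbasis {S : Matrix (Fin r) (Fin r) ℝ} (hS : Sᵀ = S) :
    ∃ (v : Fin r → Fin r → ℝ) (μ : Fin r → ℝ), (∀ i, S *ᵥ v i = μ i • v i) ∧
      (∀ i, vecNorm (v i) = 1) ∧ ∀ x y, x ⬝ᵥ y = ∑ i, (v i ⬝ᵥ x) * (v i ⬝ᵥ y) := by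
  have hsym : (Matrix.toEuclideanLin S).IsSymmetric := by
    rw [Matrix.isSymmetric_toEuclideanLin_iff, Matrix.IsHermitian,
      Matrix.conjTranspose_eq_transpose_of_trivial, hS]
  have hn : Module.finrank ℝ (EuclideanSpace ℝ (Fin r)) = r := by simp
  let b := hsym.eigenvectorBasis hn
  refine ⟨fun i => (b i).ofLp, hsym.eigenvalues hn, fun i => ?_, fun i => ?_, fun x y => ?_⟩
  · have := congrArg WithLp.ofLp (hsym.apply_eigenvectorBasis hn i)
    exact this
  · exact b.norm_eq_one i
  · have := b.sum_inner_mul_inner (WithLp.toLp 2 x) (WithLp.toLp 2 y)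
    simp only [EuclideanSpace.inner_eq_star_dotProduct, star_trivial] at this
    rw [dotProduct_comm x y, ← this]
    exact Finset.sum_congr rfl fun i _ => by rw [dotProduct_comm y]

/-- Expansion in an orthonormal eigenbasis reduces an operator bound to eigenvalues. It will be
applied to `GᵀG`, where only eigenvectors can be compared conveniently with the factors. -/
theorem vecNorm_mulVec_sub_le {S : Matrix (Fin r) (Fin r) ℝ} (hS : Sᵀ = S) {c : ℝ} (hc : 0 ≤ c)
    (h : ∀ (v : Fin r → ℝ) (μ : ℝ), vecNorm v = 1 → S *ᵥ v = μ • v → |μ - 1| ≤ c) :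
    UB (S - 1) c := fun x => by
  obtain ⟨v, μ, hv, hv1, hP⟩ := exists_eigenbasis hS
  refine abs_le_of_sq_le_sq' ?_ (mul_nonneg hc (vecNorm_nonneg x)) |>.2
  rw [mul_pow, vecNorm_sq, vecNorm_sq, hP x x, hP, Finset.mul_sum]
  refine Finset.sum_le_sum fun i _ => ?_
  have h1 : v i ⬝ᵥ (S - 1) *ᵥ x = (μ i - 1) * (v i ⬝ᵥ x) := by
    rw [← transpose_mulVec_dotProduct, Matrix.transpose_sub, hS, Matrix.transpose_one,
      Matrix.sub_mulVec, hv, Matrix.one_mulVec, sub_dotProduct, smul_dotProduct, smul_eq_mul]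
    ring
  have h2 : (μ i - 1) ^ 2 ≤ c ^ 2 := sq_le_sq' (abs_le.1 (h _ _ (hv1 i) (hv i))).1
    (abs_le.1 (h _ _ (hv1 i) (hv i))).2
  rw [h1]
  nlinarith [sq_nonneg (v i ⬝ᵥ x)]

theorem quadratic_bounds {S : Matrix (Fin r) (Fin r) ℝ} (hS : Sᵀ = S) {a c : ℝ}
    (h : ∀ (v : Fin r → ℝ) (μ : ℝ), vecNorm v = 1 → S *ᵥ v = μ • v → a ≤ μ ∧ μ ≤ c)
    (x : Fin r → ℝ) : a * vecNorm x ^ 2 ≤ x ⬝ᵥ (S *ᵥ x) ∧ x ⬝ᵥ (S *ᵥ x) ≤ c * vecNorm x ^ 2 := by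
  obtain ⟨v, μ, hv, hv1, hP⟩ := exists_eigenbasis hS
  have h1 : ∀ i, v i ⬝ᵥ S *ᵥ x = μ i * (v i ⬝ᵥ x) := fun i => by
    rw [← transpose_mulVec_dotProduct, hS, hv, smul_dotProduct, smul_eq_mul]
  rw [vecNorm_sq, hP x x, hP x (S *ᵥ x), Finset.mul_sum, Finset.mul_sum]
  constructor <;> refine Finset.sum_le_sum fun i _ => ?_ <;> rw [h1]
  · nlinarith [sq_nonneg (v i ⬝ᵥ x), (h _ _ (hv1 i) (hv i)).1]
  · nlinarith [sq_nonneg (v i ⬝ᵥ x), (h _ _ (hv1 i) (hv i)).2]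

theorem finrank_range_toEuclideanLin (M : Matrix (Fin n) (Fin q) ℝ) :
    Module.finrank ℝ (LinearMap.range (Matrix.toEuclideanLin M)) = M.rank := by
  rw [M.rank_eq_finrank_range_toLin (EuclideanSpace.basisFun _ ℝ).toBasis
    (EuclideanSpace.basisFun _ ℝ).toBasis, Matrix.toEuclideanLin_eq_toLin_orthonormal]

theorem mulVec_ne_zero_of_rank {V : Matrix (Fin q) (Fin r) ℝ} (h : V.rank = r) {x : Fin r → ℝ}
    (hx : x ≠ 0) : V *ᵥ x ≠ 0 := by
  have h1 := LinearMap.finrank_range_add_finrank_ker V.mulVecLin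
  rw [← Matrix.rank, h, Module.finrank_fin_fun] at h1
  have h2 : LinearMap.ker V.mulVecLin = ⊥ := Submodule.finrank_eq_zero.1 (by omega)
  intro h0
  have : x ∈ LinearMap.ker V.mulVecLin := h0
  rw [h2] at this
  exact hx this

/-- Nonzero eigenvalues of `MᵀM` lie between the squares of the extreme singular values. -/
theorem sigma_le_of_eigenvector {M : Matrix (Fin n) (Fin q) ℝ} (hr : 1 ≤ r) (hM : M.rank = r)
    {y : Fin q → ℝ} (hy : y ≠ 0) {μ : ℝ} (hμ : 0 < μ) (h : (Mᵀ * M) *ᵥ y = (μ ^ 2) • y) :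
    sigma r M ≤ μ ∧ μ ≤ sigma 1 M := by
  set T := Matrix.toEuclideanLin M with hT
  have hn : Module.finrank ℝ (EuclideanSpace ℝ (Fin q)) = q := by simp
  have hev : Module.End.HasEigenvalue (LinearMap.adjoint T ∘ₗ T) (μ ^ 2) := by
    refine Module.End.hasEigenvalue_of_hasEigenvector (x := WithLp.toLp 2 y) ?_
    rw [Module.End.hasEigenvector_iff, Module.End.mem_eigenspace_iff]
    refine ⟨?_, fun h0 => hy (by simpa using h0)⟩
    rw [hT, ← Matrix.toEuclideanLin_conjTranspose_eq_adjoint]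
    rw [Matrix.conjTranspose_eq_transpose_of_trivial, LinearMap.comp_apply]
    have := congrArg (WithLp.toLp 2) h
    simpa [Matrix.mulVec_mulVec] using this
  obtain ⟨i, hi⟩ := T.isSymmetric_adjoint_comp_self.exists_eigenvalues_eq hn hev
  rw [← T.sq_singularValues_fin hn i] at hi
  have hi' : T.singularValues i = μ :=
    (pow_left_inj₀ (T.singularValues_nonneg _) hμ.le two_ne_zero).1 (by exact_mod_cast hi)
  -- Singular values are indexed from `0` and exactly the first `rank` of them are positive, so the
  -- index is at most `r - 1`, the position of `σ_r`.
  have hlt : (i : ℕ) < r := by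
    rw [← hM, ← finrank_range_toEuclideanLin, ← LinearMap.singularValues_pos_iff_lt_finrank_range,
      ← hT, hi']
    exact hμ
  rw [← hi']
  exact ⟨T.singularValues_antitone (show (i : ℕ) ≤ r - 1 by omega),
    T.singularValues_antitone (Nat.zero_le _)⟩

variable {f : Matrix (Fin n) (Fin q) ℝ → ℝ} {Us : Matrix (Fin n) (Fin r) ℝ}
  {Vs : Matrix (Fin q) (Fin r) ℝ}

/-! ### Conditioning of the balanced true factors. -/

namespace NoiselessBalanced

theorem rank_le (h : NoiselessBalanced f Us Vs) : r ≤ n ∧ r ≤ q := by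
  have h1 := (Us * Vsᵀ).rank_le_height
  have h2 := (Us * Vsᵀ).rank_le_width
  rw [h.rank_eq] at h1 h2
  exact ⟨h1, h2⟩

theorem n_pos (h : NoiselessBalanced f Us Vs) : (0 : ℝ) < n := by
  exact_mod_cast lt_of_lt_of_le h.one_le h.rank_le.1

theorem q_pos (h : NoiselessBalanced f Us Vs) : (0 : ℝ) < q := by
  exact_mod_cast lt_of_lt_of_le h.one_le h.rank_le.2

theorem rank_right (h : NoiselessBalanced f Us Vs) : Vs.rank = r := by
  have h1 := Matrix.rank_mul_le_right Us Vsᵀ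
  rw [Matrix.rank_transpose, h.rank_eq] at h1
  exact le_antisymm (Vs.rank_le_width) h1

theorem sigma_pos (h : NoiselessBalanced f Us Vs) : 0 < sigma r (Us * Vsᵀ) := by
  unfold sigma
  rw [LinearMap.singularValues_pos_iff_lt_finrank_range, finrank_range_toEuclideanLin, h.rank_eq]
  have := h.one_le
  omega

theorem sigma_le (_h : NoiselessBalanced f Us Vs) : sigma r (Us * Vsᵀ) ≤ sigma 1 (Us * Vsᵀ) :=
  LinearMap.singularValues_antitone _ (Nat.zero_le _)

theorem sigmaMin_pos (h : NoiselessBalanced f Us Vs) : 0 < sigmaMin Us Vs :=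
  div_pos h.sigma_pos (Real.sqrt_pos.2 (mul_pos h.n_pos h.q_pos))

theorem one_le_kappa (h : NoiselessBalanced f Us Vs) : 1 ≤ kappa Us Vs :=
  (one_le_div h.sigma_pos).2 h.sigma_le

/-- If `v` is an eigenvector of the common normalized Gram matrix with eigenvalue `μ`, then `V* v`
is an eigenvector of `X*ᵀX*` with eigenvalue `nq μ²`. Hence `√(nq) μ` is a singular value of `X*`,
positive because `V*` is injective. -/
theorem gram_bounds (h : NoiselessBalanced f Us Vs) (x : Fin r → ℝ) :
    sigmaMin Us Vs * vecNorm x ^ 2 ≤ x ⬝ᵥ (((q : ℝ)⁻¹ • (Vsᵀ * Vs)) *ᵥ x) ∧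
      x ⬝ᵥ (((q : ℝ)⁻¹ • (Vsᵀ * Vs)) *ᵥ x) ≤
        kappa Us Vs * sigmaMin Us Vs * vecNorm x ^ 2 := by
  have hn := h.n_pos
  have hq := h.q_pos
  refine quadratic_bounds (by simp) (fun v μ hv1 hv => ?_) x
  have hv0 : v ≠ 0 := by
    rintro rfl
    simp [vecNorm_zero] at hv1
  have hy : Vs *ᵥ v ≠ 0 := mulVec_ne_zero_of_rank h.rank_right hv0
  have hμ : 0 < μ := by
    have h1 : v ⬝ᵥ (((q : ℝ)⁻¹ • (Vsᵀ * Vs)) *ᵥ v) = (q : ℝ)⁻¹ * vecNorm (Vs *ᵥ v) ^ 2 := by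
      rw [Matrix.smul_mulVec, dotProduct_smul, ← Matrix.mulVec_mulVec, dotProduct_comm,
        transpose_mulVec_dotProduct, vecNorm_sq, smul_eq_mul]
    rw [hv, dotProduct_smul, ← vecNorm_sq, hv1] at h1
    have h2 : 0 < (q : ℝ)⁻¹ * vecNorm (Vs *ᵥ v) ^ 2 :=
      mul_pos (inv_pos.2 hq) (pow_pos (vecNorm_pos hy) 2)
    simp only [smul_eq_mul] at h1
    linarith
  have hV : (Vsᵀ * Vs) *ᵥ v = (q * μ) • v := by
    rw [Matrix.smul_mulVec, inv_smul_eq_iff₀ hq.ne'] at hv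
    rw [hv, smul_smul]
  have hU : (Usᵀ * Us) *ᵥ v = (n * μ) • v := by
    rw [← h.balanced, Matrix.smul_mulVec, inv_smul_eq_iff₀ hn.ne'] at hv
    rw [hv, smul_smul]
  have hs : 0 < √((n : ℝ) * q) := Real.sqrt_pos.2 (mul_pos hn hq)
  have key := sigma_le_of_eigenvector (μ := √((n : ℝ) * q) * μ) h.one_le h.rank_eq hy
    (mul_pos hs hμ) (by
      rw [mul_pow, Real.sq_sqrt (mul_pos hn hq).le]
      have : (Us * Vsᵀ)ᵀ * (Us * Vsᵀ) = Vs * (Usᵀ * Us) * Vsᵀ := by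
        simp [Matrix.mul_assoc]
      rw [this, Matrix.mulVec_mulVec, Matrix.mul_assoc, ← Matrix.mulVec_mulVec, hV,
        Matrix.mulVec_smul, ← Matrix.mulVec_mulVec, hU, Matrix.mulVec_smul, smul_smul]
      ring_nf)
  have hks : kappa Us Vs * sigmaMin Us Vs = sigma 1 (Us * Vsᵀ) / √((n : ℝ) * q) := by
    have := h.sigma_pos.ne'
    unfold kappa sigmaMin
    field_simp
  rw [hks, sigmaMin]
  exact ⟨(div_le_iff₀' hs).2 key.1, (le_div_iff₀' hs).2 key.2⟩

theorem vecNorm_smul_mulVec_sq (c : ℝ) (hc : 0 < c) (V : Matrix (Fin q) (Fin r) ℝ)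
    (x : Fin r → ℝ) :
    vecNorm (((√c)⁻¹ • V) *ᵥ x) ^ 2 = x ⬝ᵥ ((c⁻¹ • (Vᵀ * V)) *ᵥ x) := by
  rw [Matrix.smul_mulVec, vecNorm_smul, mul_pow, sq_abs, inv_pow, Real.sq_sqrt hc.le,
    Matrix.smul_mulVec, dotProduct_smul, ← Matrix.mulVec_mulVec, dotProduct_comm,
    transpose_mulVec_dotProduct, vecNorm_sq, smul_eq_mul]

theorem UB_LB_of_sq {A : Matrix (Fin n) (Fin r) ℝ} {a c : ℝ} (ha : 0 ≤ a) (hc : 0 ≤ c)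
    (h : ∀ x, a * vecNorm x ^ 2 ≤ vecNorm (A *ᵥ x) ^ 2 ∧
      vecNorm (A *ᵥ x) ^ 2 ≤ c * vecNorm x ^ 2) : LB A (√a) ∧ UB A (√c) := by
  refine ⟨fun x => abs_le_of_sq_le_sq' ?_ (vecNorm_nonneg _) |>.2,
    fun x => abs_le_of_sq_le_sq' ?_ (mul_nonneg (Real.sqrt_nonneg _) (vecNorm_nonneg _)) |>.2⟩
  · rw [mul_pow, Real.sq_sqrt ha]; exact (h x).1
  · rw [mul_pow, Real.sq_sqrt hc]; exact (h x).2

theorem bounds_right (h : NoiselessBalanced f Us Vs) :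
    LB ((√(q : ℝ))⁻¹ • Vs) (√(sigmaMin Us Vs)) ∧
      UB ((√(q : ℝ))⁻¹ • Vs) (√(kappa Us Vs * sigmaMin Us Vs)) := by
  have h1 := h.one_le_kappa
  refine UB_LB_of_sq h.sigmaMin_pos.le (mul_nonneg (by linarith) h.sigmaMin_pos.le) fun x => ?_
  rw [vecNorm_smul_mulVec_sq _ h.q_pos]
  exact h.gram_bounds x

theorem bounds_left (h : NoiselessBalanced f Us Vs) :
    LB ((√(n : ℝ))⁻¹ • Us) (√(sigmaMin Us Vs)) ∧
      UB ((√(n : ℝ))⁻¹ • Us) (√(kappa Us Vs * sigmaMin Us Vs)) := by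
  have h1 := h.one_le_kappa
  refine UB_LB_of_sq h.sigmaMin_pos.le (mul_nonneg (by linarith) h.sigmaMin_pos.le) fun x => ?_
  rw [vecNorm_smul_mulVec_sq _ h.n_pos, h.balanced]
  exact h.gram_bounds x

theorem balanced_normalized (h : NoiselessBalanced f Us Vs) :
    ((√(n : ℝ))⁻¹ • Us)ᵀ * ((√(n : ℝ))⁻¹ • Us) = ((√(q : ℝ))⁻¹ • Vs)ᵀ * ((√(q : ℝ))⁻¹ • Vs) := by
  have hn : (√(n : ℝ))⁻¹ * (√(n : ℝ))⁻¹ = (n : ℝ)⁻¹ := by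
    rw [← mul_inv, Real.mul_self_sqrt h.n_pos.le]
  have hq : (√(q : ℝ))⁻¹ * (√(q : ℝ))⁻¹ = (q : ℝ)⁻¹ := by
    rw [← mul_inv, Real.mul_self_sqrt h.q_pos.le]
  simp only [Matrix.transpose_smul, Matrix.smul_mul, Matrix.mul_smul, smul_smul, hn, hq]
  exact h.balanced

end NoiselessBalanced

/-- Apply the operator bound to the identity, whose squared Frobenius norm is `r`. This is the
source of the `√r` in the initialization conditions, through `τ*`. -/
theorem norm_le_of_UB {A : Matrix (Fin n) (Fin r) ℝ} {c : ℝ} (h : UB A c) (hc : 0 ≤ c) :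
    ‖A‖ ^ 2 ≤ c ^ 2 * r := by
  have h1 := h.norm_mul_le hc (1 : Matrix (Fin r) (Fin r) ℝ)
  have h2 : ‖(1 : Matrix (Fin r) (Fin r) ℝ)‖ ^ 2 = r := by
    rw [← ip_self]; simp [ip]
  rw [Matrix.mul_one] at h1
  rw [← h2, ← mul_pow]
  exact pow_le_pow_left₀ (norm_nonneg _) h1 2

theorem inv_mul_norm_sq (c : ℝ) (hc : 0 ≤ c) (A : Matrix (Fin n) (Fin r) ℝ) :
    c⁻¹ * ‖A‖ ^ 2 = ‖(√c)⁻¹ • A‖ ^ 2 := by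
  rw [norm_smul, mul_pow, norm_inv, Real.norm_eq_abs, inv_pow, sq_abs, Real.sq_sqrt hc]

theorem NoiselessBalanced.tauStar_sq_le (h : NoiselessBalanced f Us Vs) :
    tauStar Us Vs ^ 2 ≤ r * kappa Us Vs * sigmaMin Us Vs := by
  have h1 : 0 ≤ kappa Us Vs * sigmaMin Us Vs :=
    mul_nonneg (by linarith [h.one_le_kappa]) h.sigmaMin_pos.le
  have hU := norm_le_of_UB h.bounds_left.2 (Real.sqrt_nonneg _)
  have hV := norm_le_of_UB h.bounds_right.2 (Real.sqrt_nonneg _)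
  rw [Real.sq_sqrt h1] at hU hV
  rw [tauStar, inv_mul_norm_sq _ (Nat.cast_nonneg _), inv_mul_norm_sq _ (Nat.cast_nonneg _),
    Real.sq_sqrt (by positivity)]
  linarith

theorem NoiselessBalanced.tauStar_pos (h : NoiselessBalanced f Us Vs) : 0 < tauStar Us Vs := by
  have hU : 0 < ‖Us‖ := by
    rw [norm_pos_iff]
    rintro rfl
    have h1 := h.rank_eq
    simp at h1
    have := h.one_le
    omega
  have := h.n_pos
  rw [tauStar]
  positivity

theorem NoiselessBalanced.omegaStar_pos (h : NoiselessBalanced f Us Vs) :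
    0 < omegaStar Us Vs := by
  by_contra hneg
  have h0 : ∀ i, Us i = 0 := fun i => by
    refine vecNorm_eq_zero (le_antisymm ?_ (vecNorm_nonneg _))
    exact (vecNorm_row_le_rowNorm Us i).trans ((le_max_left _ _).trans (not_lt.1 hneg))
  have hU : Us = 0 := by
    ext i j
    exact congrFun (h0 i) j
  have h1 := h.rank_eq
  rw [hU] at h1
  simp at h1
  have := h.one_le
  omega

end Spectral

/-! ### Calculus along a path of factors -/

section Calculus

variable {n q r : ℕ} {f : Matrix (Fin n) (Fin q) ℝ → ℝ}

theorem ip_single (M : Matrix (Fin n) (Fin q) ℝ) (i : Fin n) (j : Fin q) :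
    ip M (Matrix.single i j 1) = M i j := by
  rw [ip_eq_sum, Finset.sum_eq_single i]
  · simp [dotProduct, Matrix.single_apply]
  · intro b _ hb
    simp [dotProduct, hb.symm]
  · simp

theorem dirDeriv_eq_ip (f : Matrix (Fin n) (Fin q) ℝ → ℝ) (X Q : Matrix (Fin n) (Fin q) ℝ) :
    dirDeriv f X Q = ip (matGrad f X) Q := by
  unfold dirDeriv
  conv_lhs => rw [Matrix.matrix_eq_sum_single Q]
  simp only [map_sum]
  rw [ip_eq_sum]
  refine Finset.sum_congr rfl fun i _ => ?_
  rw [dotProduct]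
  refine Finset.sum_congr rfl fun j _ => ?_
  have : Matrix.single i j (Q i j) = Q i j • Matrix.single i j (1 : ℝ) := by
    rw [Matrix.smul_single]; simp
  rw [this, map_smul, smul_eq_mul, mul_comm]
  rfl

theorem dirDeriv_comp {E F : Type*} [NormedAddCommGroup E] [NormedSpace ℝ E]
    [NormedAddCommGroup F] [NormedSpace ℝ F] {g : F → ℝ} (hg : Differentiable ℝ g) (T : E →L[ℝ] F)
    (x v : E) : dirDeriv (fun w => g (T w)) x v = dirDeriv g (T x) (T v) := by
  have h1 : HasFDerivAt (fun w => g (T w)) ((fderiv ℝ g (T x)).comp T) x :=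
    HasFDerivAt.comp (g := g) x (hg (T x)).hasFDerivAt T.hasFDerivAt
  rw [dirDeriv, h1.fderiv]
  rfl

theorem matGrad_comp_linear {m k : ℕ} (hf : Differentiable ℝ f)
    (T : Matrix (Fin m) (Fin k) ℝ →ₗ[ℝ] Matrix (Fin n) (Fin q) ℝ) (U : Matrix (Fin m) (Fin k) ℝ)
    (i : Fin m) (j : Fin k) :
    matGrad (fun W => f (T W)) U i j = ip (matGrad f (T U)) (T (Matrix.single i j 1)) := by
  rw [← dirDeriv_eq_ip]
  exact dirDeriv_comp hf (LinearMap.toContinuousLinearMap T) U _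

/-- Right multiplication by `Vᵀ`. -/
def mulTransposeRight (V : Matrix (Fin q) (Fin r) ℝ) :
    Matrix (Fin n) (Fin r) ℝ →ₗ[ℝ] Matrix (Fin n) (Fin q) ℝ where
  toFun W := W * Vᵀ
  map_add' _ _ := Matrix.add_mul _ _ _
  map_smul' _ _ := Matrix.smul_mul _ _ _

/-- The linear map `W ↦ U Wᵀ`. -/
def mulTransposeLeft (U : Matrix (Fin n) (Fin r) ℝ) :
    Matrix (Fin q) (Fin r) ℝ →ₗ[ℝ] Matrix (Fin n) (Fin q) ℝ where
  toFun W := U * Wᵀ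
  map_add' _ _ := by simp [Matrix.mul_add]
  map_smul' _ _ := by simp

theorem matGrad_mul_transpose_left (hf : Differentiable ℝ f) (U : Matrix (Fin n) (Fin r) ℝ)
    (V : Matrix (Fin q) (Fin r) ℝ) :
    matGrad (fun W => f (W * Vᵀ)) U = matGrad f (U * Vᵀ) * V := by
  ext i j
  have := matGrad_comp_linear hf (mulTransposeRight V) U i j
  refine this.trans ?_
  change ip (matGrad f (U * Vᵀ)) (Matrix.single i j (1 : ℝ) * Vᵀ) = _
  rw [ip_mul_right, Matrix.transpose_transpose, ip_single]

theorem matGrad_mul_transpose_right (hf : Differentiable ℝ f) (U : Matrix (Fin n) (Fin r) ℝ)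
    (V : Matrix (Fin q) (Fin r) ℝ) :
    matGrad (fun W => f (U * Wᵀ)) V = (matGrad f (U * Vᵀ))ᵀ * U := by
  ext i j
  have := matGrad_comp_linear hf (mulTransposeLeft U) V i j
  refine this.trans ?_
  change ip (matGrad f (U * Vᵀ)) (U * (Matrix.single i j (1 : ℝ))ᵀ) = _
  rw [← ip_transpose, Matrix.transpose_mul, Matrix.transpose_transpose, ip_mul_right, ip_single,
    Matrix.transpose_transpose]

/-- The second derivative, as a bilinear form. -/
noncomputable def hessForm {E : Type*} [NormedAddCommGroup E] [NormedSpace ℝ E] (g : E → ℝ)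
    (x : E) : LinearMap.BilinForm ℝ E :=
  LinearMap.mk₂ ℝ (hess g x) (by simp [hess]) (by simp [hess]) (by simp [hess]) (by simp [hess])

theorem hessForm_apply {E : Type*} [NormedAddCommGroup E] [NormedSpace ℝ E] (g : E → ℝ)
    (x v w : E) : hessForm g x v w = hess g x v w := rfl

theorem hessForm_symm {E : Type*} [NormedAddCommGroup E] [NormedSpace ℝ E] {g : E → ℝ}
    (hg : ContDiff ℝ 2 g) (x v w : E) : hessForm g x v w = hessForm g x w v :=
  (hg.contDiffAt.isSymmSndFDerivAt (by simp)) v w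

theorem hasDerivAt_path (U₀ dU : Matrix (Fin n) (Fin r) ℝ) (V₀ dV : Matrix (Fin q) (Fin r) ℝ)
    (s : ℝ) :
    HasDerivAt (fun s : ℝ => (U₀ + s • dU) * (V₀ + s • dV)ᵀ)
      ((U₀ + s • dU) * dVᵀ + dU * (V₀ + s • dV)ᵀ) s := by
  have h1 : (fun s : ℝ => (U₀ + s • dU) * (V₀ + s • dV)ᵀ) =
      fun s : ℝ => U₀ * V₀ᵀ + s • (U₀ * dVᵀ + dU * V₀ᵀ) + (s ^ 2) • (dU * dVᵀ) := by
    funext s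
    simp only [Matrix.transpose_add, Matrix.transpose_smul, Matrix.add_mul, Matrix.mul_add,
      Matrix.smul_mul, Matrix.mul_smul, smul_add, smul_smul, sq]
    abel
  rw [h1]
  have h2 := (((hasDerivAt_id s).smul_const (U₀ * dVᵀ + dU * V₀ᵀ)).const_add (U₀ * V₀ᵀ)).add
    ((hasDerivAt_pow 2 s).smul_const (dU * dVᵀ))
  refine h2.congr_deriv ?_
  simp only [Matrix.transpose_add, Matrix.transpose_smul, Matrix.add_mul, Matrix.mul_add,
    Matrix.smul_mul, Matrix.mul_smul, one_smul]
  norm_num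
  rw [two_mul, add_smul]
  abel

/-- The scalar mean value theorem for `s ↦ Dg(X s)(Q₀ + s Q₁)`, which vanishes at `0`. Letting the
direction vary with `s` allows it to be tangent to the factor manifold at each point of the path; a
fixed direction would be tangent at one end only. -/
theorem exists_dirDeriv_path_eq {E : Type*} [NormedAddCommGroup E] [NormedSpace ℝ E] {g : E → ℝ}
    (hg : ContDiff ℝ 2 g) {X X' : ℝ → E} (hX : ∀ s, HasDerivAt X (X' s) s)
    (h0 : ∀ v, dirDeriv g (X 0) v = 0) (Q₀ Q₁ : E) :
    ∃ s ∈ Set.Ioo (0 : ℝ) 1, dirDeriv g (X 1) (Q₀ + Q₁) =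
      hess g (X s) (X' s) (Q₀ + s • Q₁) + dirDeriv g (X s) Q₁ := by
  unfold dirDeriv hess
  unfold dirDeriv at h0
  have hd : Differentiable ℝ (fderiv ℝ g) :=
    (hg.fderiv_right (m := 1) (by norm_num)).differentiable (by norm_num)
  have hφ : ∀ s, HasDerivAt (fun s => fderiv ℝ g (X s) (Q₀ + s • Q₁))
      (fderiv ℝ (fderiv ℝ g) (X s) (X' s) (Q₀ + s • Q₁) + fderiv ℝ g (X s) Q₁) s := fun s => by
    have h1 : HasDerivAt (fun s => fderiv ℝ g (X s)) (fderiv ℝ (fderiv ℝ g) (X s) (X' s)) s :=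
      (hd (X s)).hasFDerivAt.comp_hasDerivAt s (hX s)
    have h2 : HasDerivAt (fun s : ℝ => Q₀ + s • Q₁) Q₁ s := by
      simpa using ((hasDerivAt_id s).smul_const Q₁).const_add Q₀
    exact h1.clm_apply h2
  obtain ⟨s, hs, h⟩ := exists_hasDerivAt_eq_slope _ _ (zero_lt_one' ℝ)
    (fun s _ => (hφ s).continuousAt.continuousWithinAt) (fun s _ => hφ s)
  refine ⟨s, hs, ?_⟩
  simp only [one_smul, h0, sub_zero, div_one] at h
  exact h.symm

/-- Mean value theorem for the score along the segment between two pairs of factors, tested against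
an affine family of directions. -/
theorem exists_ip_score_eq (hf : ContDiff ℝ 2 f) {U₀ dU : Matrix (Fin n) (Fin r) ℝ}
    {V₀ dV : Matrix (Fin q) (Fin r) ℝ} (h0 : matGrad f (U₀ * V₀ᵀ) = 0)
    (Q₀ Q₁ : Matrix (Fin n) (Fin q) ℝ) :
    ∃ s ∈ Set.Ioo (0 : ℝ) 1, ip (matGrad f ((U₀ + dU) * (V₀ + dV)ᵀ)) (Q₀ + Q₁) =
      hessForm f ((U₀ + s • dU) * (V₀ + s • dV)ᵀ)
          ((U₀ + s • dU) * dVᵀ + dU * (V₀ + s • dV)ᵀ) (Q₀ + s • Q₁) +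
        ip (matGrad f ((U₀ + s • dU) * (V₀ + s • dV)ᵀ)) Q₁ := by
  have h0' : ∀ Q, dirDeriv f ((U₀ + (0 : ℝ) • dU) * (V₀ + (0 : ℝ) • dV)ᵀ) Q = 0 := fun Q => by
    rw [zero_smul, zero_smul, add_zero, add_zero, dirDeriv_eq_ip, h0, ip_zero_left]
  obtain ⟨s, hs, h⟩ := exists_dirDeriv_path_eq hf (hasDerivAt_path U₀ dU V₀ dV) h0' Q₀ Q₁
  refine ⟨s, hs, ?_⟩
  rw [dirDeriv_eq_ip, dirDeriv_eq_ip, one_smul, one_smul] at h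
  exact h

end Calculus

/-! ### Optimal alignments -/

section Alignment

variable {n q r : ℕ}

/-- A factor divided by the square root of its number of rows. -/
noncomputable def nz (M : Matrix (Fin n) (Fin r) ℝ) : Matrix (Fin n) (Fin r) ℝ :=
  (√(n : ℝ))⁻¹ • M

theorem nz_add (X Y : Matrix (Fin n) (Fin r) ℝ) : nz (X + Y) = nz X + nz Y := smul_add _ _ _

theorem nz_sub (X Y : Matrix (Fin n) (Fin r) ℝ) : nz (X - Y) = nz X - nz Y := smul_sub _ _ _

theorem nz_mul {k : ℕ} (X : Matrix (Fin n) (Fin r) ℝ) (G : Matrix (Fin r) (Fin k) ℝ) :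
    nz (X * G) = nz X * G := (Matrix.smul_mul _ _ _).symm

theorem nz_smul (c : ℝ) (X : Matrix (Fin n) (Fin r) ℝ) : nz (c • X) = c • nz X :=
  smul_comm _ _ _

theorem norm_nz (X : Matrix (Fin n) (Fin r) ℝ) : ‖nz X‖ = (√(n : ℝ))⁻¹ * ‖X‖ := by
  rw [nz, norm_smul, norm_inv, Real.norm_of_nonneg (Real.sqrt_nonneg _)]

theorem pairNorm2_nonneg (X : Matrix (Fin n) (Fin r) ℝ) (Y : Matrix (Fin q) (Fin r) ℝ) :
    0 ≤ pairNorm2 X Y := Real.sqrt_nonneg _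

theorem pairNorm2_sq (X : Matrix (Fin n) (Fin r) ℝ) (Y : Matrix (Fin q) (Fin r) ℝ) :
    pairNorm2 X Y ^ 2 = ‖nz X‖ ^ 2 + ‖nz Y‖ ^ 2 := by
  rw [pairNorm2, Real.sq_sqrt (by positivity), nz, nz, inv_mul_norm_sq _ (Nat.cast_nonneg _),
    inv_mul_norm_sq _ (Nat.cast_nonneg _)]

theorem norm_nz_le_left (X : Matrix (Fin n) (Fin r) ℝ) (Y : Matrix (Fin q) (Fin r) ℝ) :
    ‖nz X‖ ≤ pairNorm2 X Y := by
  refine abs_le_of_sq_le_sq' ?_ (pairNorm2_nonneg X Y) |>.2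
  rw [pairNorm2_sq]
  linarith [sq_nonneg ‖nz Y‖]

theorem norm_nz_le_right (X : Matrix (Fin n) (Fin r) ℝ) (Y : Matrix (Fin q) (Fin r) ℝ) :
    ‖nz Y‖ ≤ pairNorm2 X Y := by
  refine abs_le_of_sq_le_sq' ?_ (pairNorm2_nonneg X Y) |>.2
  rw [pairNorm2_sq]
  linarith [sq_nonneg ‖nz X‖]

theorem pairNorm2_smul {s : ℝ} (hs : 0 ≤ s) (X : Matrix (Fin n) (Fin r) ℝ)
    (Y : Matrix (Fin q) (Fin r) ℝ) : pairNorm2 (s • X) (s • Y) = s * pairNorm2 X Y := by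
  refine (pow_left_inj₀ (pairNorm2_nonneg _ _) (mul_nonneg hs (pairNorm2_nonneg _ _))
    two_ne_zero).1 ?_
  rw [mul_pow, pairNorm2_sq, pairNorm2_sq, nz_smul, nz_smul, norm_smul, norm_smul, mul_pow,
    mul_pow, Real.norm_eq_abs, sq_abs]
  ring

theorem isOptAlign_iff {U : Matrix (Fin n) (Fin r) ℝ} {V : Matrix (Fin q) (Fin r) ℝ}
    {Us : Matrix (Fin n) (Fin r) ℝ} {Vs : Matrix (Fin q) (Fin r) ℝ} {G : GL (Fin r) ℝ} :
    IsOptAlign U V Us Vs G ↔ ∀ G' : GL (Fin r) ℝ,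
      pairNorm2 (errU U Us G) (errV V Vs G) ≤ pairNorm2 (errU U Us G') (errV V Vs G') := by
  refine forall_congr' fun G' => ?_
  rw [pairNorm2, pairNorm2, Real.sqrt_le_sqrt_iff (by positivity)]

variable {U : Matrix (Fin n) (Fin r) ℝ} {V : Matrix (Fin q) (Fin r) ℝ}
  {Us : Matrix (Fin n) (Fin r) ℝ} {Vs : Matrix (Fin q) (Fin r) ℝ}

/-- Injectivity of both factors makes the objective coercive in `G` and in `G⁻¹` separately, so no
minimizing sequence escapes to infinity or to a singular matrix. -/
theorem exists_isOptAlign_of_LB {a c : ℝ} (ha : 0 < a) (hc : 0 < c) (hU : LB (nz U) a)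
    (hV : LB (nz V) c) : ∃ G, IsOptAlign U V Us Vs G := by
  let J : Matrix (Fin r) (Fin r) ℝ × Matrix (Fin r) (Fin r) ℝ → ℝ := fun p =>
    (n : ℝ)⁻¹ * ‖U * p.1 - Us‖ ^ 2 + (q : ℝ)⁻¹ * ‖V * p.2ᵀ - Vs‖ ^ 2
  have hJ : Continuous J := by fun_prop
  have hJeq : ∀ p, J p = ‖nz U * p.1 - nz Us‖ ^ 2 + ‖nz V * p.2ᵀ - nz Vs‖ ^ 2 := fun p => by
    simp only [J]
    rw [inv_mul_norm_sq _ (Nat.cast_nonneg _), inv_mul_norm_sq _ (Nat.cast_nonneg _), smul_sub,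
      smul_sub, ← Matrix.smul_mul, ← Matrix.smul_mul]
    rfl
  set M₁ := a⁻¹ * (√(J (1, 1)) + ‖nz Us‖) with hM₁
  set M₂ := c⁻¹ * (√(J (1, 1)) + ‖nz Vs‖) with hM₂
  have hJ0 : ∀ p, 0 ≤ J p := fun p => by rw [hJeq]; positivity
  have hbd : ∀ p, J p ≤ J (1, 1) → ‖p.1‖ ≤ M₁ ∧ ‖p.2‖ ≤ M₂ := fun p hp => by
    have h1 : ‖nz U * p.1 - nz Us‖ ≤ √(J (1, 1)) := by
      refine Real.le_sqrt_of_sq_le ?_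
      have := hJeq p
      nlinarith [sq_nonneg ‖nz V * p.2ᵀ - nz Vs‖]
    have h2 : ‖nz V * p.2ᵀ - nz Vs‖ ≤ √(J (1, 1)) := by
      refine Real.le_sqrt_of_sq_le ?_
      have := hJeq p
      nlinarith [sq_nonneg ‖nz U * p.1 - nz Us‖]
    have h3 := hU.le_norm_mul ha.le p.1
    have h4 := hV.le_norm_mul hc.le p.2ᵀ
    rw [Matrix.frobenius_norm_transpose] at h4
    have h5 := norm_sub_norm_le (nz U * p.1) (nz Us)
    have h6 := norm_sub_norm_le (nz V * p.2ᵀ) (nz Vs)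
    constructor
    · rw [hM₁, ← div_eq_inv_mul, le_div_iff₀' ha]; linarith
    · rw [hM₂, ← div_eq_inv_mul, le_div_iff₀' hc]; linarith
  -- The pairs `(G, G⁻¹)` form a closed set, which the invertible matrices alone do not; intersected
  -- with a ball it is compact.
  let S : Set (Matrix (Fin r) (Fin r) ℝ × Matrix (Fin r) (Fin r) ℝ) :=
    {p | p.1 * p.2 = 1} ∩ Metric.closedBall 0 (max M₁ M₂)
  have hS : IsCompact S := by
    refine (isCompact_closedBall _ _).inter_left (isClosed_eq ?_ continuous_const)
    fun_prop
  have hmem : ∀ p, p.1 * p.2 = 1 → J p ≤ J (1, 1) → p ∈ S := fun p hp1 hp2 => by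
    refine ⟨hp1, ?_⟩
    rw [mem_closedBall_zero_iff, Prod.norm_def]
    exact max_le_max (hbd p hp2).1 (hbd p hp2).2
  obtain ⟨p, hp, hmin⟩ := hS.exists_isMinOn ⟨(1, 1), hmem _ (by simp) le_rfl⟩ hJ.continuousOn
  have hpu : p.2 * p.1 = 1 := mul_eq_one_comm.1 hp.1
  refine ⟨⟨p.1, p.2, hp.1, hpu⟩, fun G' => ?_⟩
  change J p ≤ J ((G' : Matrix (Fin r) (Fin r) ℝ), ((G'⁻¹ : GL (Fin r) ℝ) : Matrix _ _ ℝ))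
  by_cases h : J ((G' : Matrix (Fin r) (Fin r) ℝ), ((G'⁻¹ : GL (Fin r) ℝ) : Matrix _ _ ℝ)) ≤
      J (1, 1)
  · refine isMinOn_iff.1 hmin _ (hmem _ ?_ h)
    exact G'.mul_inv
  · exact (isMinOn_iff.1 hmin _ (hmem _ (by simp) le_rfl)).trans (le_of_not_ge h)

theorem GL_mul_inv (G : GL (Fin r) ℝ) :
    (G : Matrix (Fin r) (Fin r) ℝ) * ((G⁻¹ : GL (Fin r) ℝ) : Matrix (Fin r) (Fin r) ℝ) = 1 :=
  G.mul_inv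

theorem GL_inv_mul (G : GL (Fin r) ℝ) :
    ((G⁻¹ : GL (Fin r) ℝ) : Matrix (Fin r) (Fin r) ℝ) * (G : Matrix (Fin r) (Fin r) ℝ) = 1 :=
  G.inv_mul

theorem nz_errU (G : GL (Fin r) ℝ) :
    nz U * (G : Matrix (Fin r) (Fin r) ℝ) = nz Us + nz (errU U Us G) := by
  rw [errU, nz_sub, nz_mul, add_sub_cancel]

theorem nz_errV (G : GL (Fin r) ℝ) :
    nz V * ((G⁻¹ : GL (Fin r) ℝ) : Matrix (Fin r) (Fin r) ℝ)ᵀ = nz Vs + nz (errV V Vs G) := by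
  rw [errV, nz_sub, nz_mul, add_sub_cancel]

theorem LB_of_mul_GL {A : Matrix (Fin n) (Fin r) ℝ} {a : ℝ} (ha : 0 < a) (G : GL (Fin r) ℝ)
    (h : LB (A * (G : Matrix (Fin r) (Fin r) ℝ)) a) : ∃ c, 0 < c ∧ LB A c := by
  have h1 : LB ((G⁻¹ : GL (Fin r) ℝ) : Matrix (Fin r) (Fin r) ℝ)
      (‖(G : Matrix (Fin r) (Fin r) ℝ)‖ + 1)⁻¹ :=
    LB.of_mul_eq_one (by positivity) (GL_mul_inv G) ((UB_norm _).mono (by linarith))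
  have h2 := h.mul h1 ha.le
  rw [Matrix.mul_assoc, GL_mul_inv, Matrix.mul_one] at h2
  exact ⟨_, by positivity, h2⟩

/-- The general linear group element `(G⁻¹)ᵀ`. -/
def invTranspose (G : GL (Fin r) ℝ) : GL (Fin r) ℝ where
  val := ((G⁻¹ : GL (Fin r) ℝ) : Matrix (Fin r) (Fin r) ℝ)ᵀ
  inv := (G : Matrix (Fin r) (Fin r) ℝ)ᵀ
  val_inv := by rw [← Matrix.transpose_mul, GL_mul_inv, Matrix.transpose_one]
  inv_val := by rw [← Matrix.transpose_mul, GL_inv_mul, Matrix.transpose_one]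

section

variable {f : Matrix (Fin n) (Fin q) ℝ → ℝ} {G G' : GL (Fin r) ℝ} {d : ℝ}

theorem LB_nz_left (h : NoiselessBalanced f Us Vs)
    (hd : pairNorm2 (errU U Us G) (errV V Vs G) ≤ d) :
    LB (nz U * (G : Matrix (Fin r) (Fin r) ℝ)) (√(sigmaMin Us Vs) - d) := by
  rw [nz_errU (Us := Us)]
  exact (h.bounds_left.1.add (UB_norm _)).mono
    (by linarith [norm_nz_le_left (errU U Us G) (errV V Vs G)])

theorem LB_nz_right (h : NoiselessBalanced f Us Vs)
    (hd : pairNorm2 (errU U Us G) (errV V Vs G) ≤ d) :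
    LB (nz V * ((G⁻¹ : GL (Fin r) ℝ) : Matrix (Fin r) (Fin r) ℝ)ᵀ) (√(sigmaMin Us Vs) - d) := by
  rw [nz_errV (Vs := Vs)]
  exact (h.bounds_right.1.add (UB_norm _)).mono
    (by linarith [norm_nz_le_right (errU U Us G) (errV V Vs G)])

/-- An error below the least singular value of the true factors leaves `UG` and `VG⁻ᵀ` injective, so
the coercivity argument applies. The witness `G` need not be optimal. -/
theorem exists_isOptAlign (h : NoiselessBalanced f Us Vs)
    (hd : pairNorm2 (errU U Us G) (errV V Vs G) ≤ d) (hd' : d < √(sigmaMin Us Vs)) :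
    ∃ G, IsOptAlign U V Us Vs G := by
  obtain ⟨a, ha, hU⟩ := LB_of_mul_GL (sub_pos.2 hd') G (LB_nz_left h hd)
  obtain ⟨c, hc, hV⟩ := LB_of_mul_GL (sub_pos.2 hd') (invTranspose G) (LB_nz_right h hd)
  exact exists_isOptAlign_of_LB ha hc hU hV

theorem errU_sub_errU : errU U Us G' - errU U Us G = U * (G : Matrix (Fin r) (Fin r) ℝ) *
    (((G⁻¹ * G' : GL (Fin r) ℝ) : Matrix (Fin r) (Fin r) ℝ) - 1) := by
  simp only [errU, Units.val_mul, Matrix.mul_sub, Matrix.mul_one, ← Matrix.mul_assoc]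
  rw [Matrix.mul_assoc U, GL_mul_inv, Matrix.mul_one]
  abel

theorem errV_sub_errV : errV V Vs G' - errV V Vs G =
    V * ((G⁻¹ : GL (Fin r) ℝ) : Matrix (Fin r) (Fin r) ℝ)ᵀ *
      (((G'⁻¹ * G : GL (Fin r) ℝ) : Matrix (Fin r) (Fin r) ℝ)ᵀ - 1) := by
  simp only [errV, Units.val_mul, Matrix.mul_sub, Matrix.mul_one, Matrix.transpose_mul,
    ← Matrix.mul_assoc]
  rw [Matrix.mul_assoc V, ← Matrix.transpose_mul, GL_mul_inv, Matrix.transpose_one,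
    Matrix.mul_one]
  abel

/-- Two alignments with small errors are close to each other. -/
theorem align_close (h : NoiselessBalanced f Us Vs)
    (hd : pairNorm2 (errU U Us G) (errV V Vs G) ≤ d)
    (hd' : pairNorm2 (errU U Us G') (errV V Vs G') ≤ d) (hds : d ≤ √(sigmaMin Us Vs) / 20) :
    ‖((G⁻¹ * G' : GL (Fin r) ℝ) : Matrix (Fin r) (Fin r) ℝ) - 1‖ ≤
        2.2 * (d / √(sigmaMin Us Vs)) ∧
      ‖((G'⁻¹ * G : GL (Fin r) ℝ) : Matrix (Fin r) (Fin r) ℝ)ᵀ - 1‖ ≤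
        2.2 * (d / √(sigmaMin Us Vs)) := by
  have hs : 0 < √(sigmaMin Us Vs) := Real.sqrt_pos.2 h.sigmaMin_pos
  have hs0 : 0 ≤ √(sigmaMin Us Vs) - d := by linarith
  -- Two errors of size `d` differ by at most `2d`, and the aligned factor is bounded below by
  -- `√σ_min - d ≥ 0.95 √σ_min`; `2 / 0.95 ≤ 2.2`.
  have key : ∀ x : ℝ, 0 ≤ x → (√(sigmaMin Us Vs) - d) * x ≤ 2 * d →
      x ≤ 2.2 * (d / √(sigmaMin Us Vs)) := fun x hx hx' => by
    rw [← mul_div_assoc, le_div_iff₀ hs]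
    nlinarith
  constructor
  · refine key _ (norm_nonneg _) (((LB_nz_left h hd).le_norm_mul hs0 _).trans ?_)
    rw [← nz_mul, ← nz_mul, ← errU_sub_errU (Us := Us), nz_sub]
    refine (norm_sub_le _ _).trans ?_
    linarith [norm_nz_le_left (errU U Us G) (errV V Vs G),
      norm_nz_le_left (errU U Us G') (errV V Vs G')]
  · refine key _ (norm_nonneg _) (((LB_nz_right h hd).le_norm_mul hs0 _).trans ?_)
    rw [← nz_mul, ← nz_mul, ← errV_sub_errV (Vs := Vs), nz_sub]
    refine (norm_sub_le _ _).trans ?_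
    linarith [norm_nz_le_right (errU U Us G) (errV V Vs G),
      norm_nz_le_right (errU U Us G') (errV V Vs G')]

theorem vecNorm_row_mul_le {m k l : ℕ} (X : Matrix (Fin m) (Fin k) ℝ)
    (E : Matrix (Fin k) (Fin l) ℝ) (i : Fin m) : vecNorm ((X * E) i) ≤ ‖E‖ * vecNorm (X i) := by
  have h1 := mul_transpose_row X Eᵀ i
  rw [Matrix.transpose_transpose] at h1
  rw [h1, ← Matrix.frobenius_norm_transpose]
  exact UB_norm _ _

/-- A change of alignment multiplies the aligned factor `Y + X` on the right by a matrix near the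
identity, and right multiplication acts on each row separately. -/
theorem rowNorm_add_mul_le {m k : ℕ} {X Y X' : Matrix (Fin m) (Fin k) ℝ}
    {E : Matrix (Fin k) (Fin k) ℝ} {e w c : ℝ} (hX' : X' - X = (Y + X) * E) (hX : rowNorm X ≤ e)
    (hY : rowNorm Y ≤ w) (hE : ‖E‖ ≤ c) : rowNorm X' ≤ e * (1 + c) + c * w := by
  have he := (rowNorm_nonneg X).trans hX
  have hw := (rowNorm_nonneg Y).trans hY
  have hc := (norm_nonneg E).trans hE
  refine rowNorm_le (by positivity) fun i => ?_
  have h0 : X' = X + (Y + X) * E := by rw [← hX', add_sub_cancel]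
  have h1 : X' i = X i + ((Y + X) * E) i := congrFun h0 i
  rw [h1]
  have h2 := vecNorm_row_mul_le (Y + X) E i
  have h3 : vecNorm ((Y + X) i) ≤ w + e :=
    (vecNorm_add_le (Y i) (X i)).trans (add_le_add ((vecNorm_row_le_rowNorm Y i).trans hY)
      ((vecNorm_row_le_rowNorm X i).trans hX))
  have h4 := mul_le_mul hE h3 (vecNorm_nonneg _) hc
  have h5 := (vecNorm_row_le_rowNorm X i).trans hX
  refine (vecNorm_add_le _ _).trans ?_
  linarith

theorem pairNormInf_realign (h : NoiselessBalanced f Us Vs) {e : ℝ}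
    (hd : pairNorm2 (errU U Us G) (errV V Vs G) ≤ d)
    (hd' : pairNorm2 (errU U Us G') (errV V Vs G') ≤ d) (hds : d ≤ √(sigmaMin Us Vs) / 20)
    (he : pairNormInf (errU U Us G) (errV V Vs G) ≤ e) :
    pairNormInf (errU U Us G') (errV V Vs G') ≤
      e * (1 + 2.2 * (d / √(sigmaMin Us Vs))) + 2.2 * (d / √(sigmaMin Us Vs)) *
        omegaStar Us Vs := by
  have hc := align_close h hd hd' hds
  refine max_le (rowNorm_add_mul_le (Y := Us) ?_ ((le_max_left _ _).trans he) (le_max_left _ _)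
    hc.1) (rowNorm_add_mul_le (Y := Vs) ?_ ((le_max_right _ _).trans he) (le_max_right _ _) hc.2)
  · rw [errU_sub_errU, errU, add_sub_cancel]
  · rw [errV_sub_errV, errV, add_sub_cancel]

theorem dist2LE_of_le (h : NoiselessBalanced f Us Vs)
    (hd : pairNorm2 (errU U Us G) (errV V Vs G) ≤ d) (hd' : d < √(sigmaMin Us Vs)) {b : ℝ}
    (hb : d ≤ b) : Dist2LE U V Us Vs b :=
  ⟨exists_isOptAlign h hd hd', fun _ hG => ((isOptAlign_iff.1 hG G).trans hd).trans hb⟩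

theorem mem_region2_of_le (h : NoiselessBalanced f Us Vs)
    (hd : pairNorm2 (errU U Us G) (errV V Vs G) ≤ d) (hd' : d < √(sigmaMin Us Vs)) {ε : ℝ}
    (hε : d ≤ ε * tauStar Us Vs) : (U, V) ∈ region2 Us Vs ε :=
  dist2LE_of_le h hd hd' hε

/-- The region speaks of every optimal alignment. Each of them has Frobenius error at most that of
`G`, hence is close to `G`, and its row errors exceed those of `G` only by the realignment cost. -/
theorem mem_regionInf_of_le (h : NoiselessBalanced f Us Vs) {e : ℝ}
    (hd : pairNorm2 (errU U Us G) (errV V Vs G) ≤ d) (hds : d ≤ √(sigmaMin Us Vs) / 20) {ε : ℝ}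
    (hε : d ≤ ε * tauStar Us Vs) (he : pairNormInf (errU U Us G) (errV V Vs G) ≤ e)
    (heε : e * (1 + 2.2 * (d / √(sigmaMin Us Vs))) + 2.2 * (d / √(sigmaMin Us Vs)) *
        omegaStar Us Vs ≤ ε * omegaStar Us Vs) : (U, V) ∈ regionInf Us Vs ε := by
  have hs : 0 < √(sigmaMin Us Vs) := Real.sqrt_pos.2 h.sigmaMin_pos
  exact ⟨dist2LE_of_le h hd (by linarith) hε, exists_isOptAlign h hd (by linarith),
    fun G' hG' => (pairNormInf_realign h hd ((isOptAlign_iff.1 hG' G).trans hd) hds he).trans heε⟩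

end

/-- Otherwise a small `t` of sign opposite to `c` makes the linear term beat the quadratic one. -/
theorem eq_zero_of_forall_small {c C : ℝ} (h : ∀ t : ℝ, |t| ≤ 1 / 2 → 0 ≤ t * c + t ^ 2 * C) :
    c = 0 := by
  by_contra hc
  have hc' : 0 < |c| := abs_pos.2 hc
  have hD : 0 < |C| + 1 + |c| := by positivity
  set t : ℝ := -(c / (2 * (|C| + 1 + |c|))) with ht
  have h1 : |t| ≤ 1 / 2 := by
    rw [ht, abs_neg, abs_div, abs_of_pos (by positivity : 0 < 2 * (|C| + 1 + |c|)),
      div_le_div_iff₀ (by positivity) (by norm_num)]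
    nlinarith [abs_nonneg C]
  have h2 := h t h1
  have h3 : t * (2 * (|C| + 1 + |c|)) = -c := by
    rw [ht]; field_simp
  have h4 : C ≤ |C| := le_abs_self C
  have h5 : t * c = -(2 * (|C| + 1 + |c|)) * t ^ 2 := by
    rw [show t * c = -(t * -c) by ring, ← h3]; ring
  have h6 : t ≠ 0 := by
    intro h0; rw [h0] at h3; apply hc; linarith
  nlinarith [pow_pos (abs_pos.2 h6) 2, sq_abs t]

/-- The perturbation `1 + t M` of the identity for a matrix with `M² = μ M`. -/
noncomputable def perturb (M : Matrix (Fin r) (Fin r) ℝ) (μ t : ℝ) (hM : M * M = μ • M) (ht : 1 + t * μ ≠ 0) :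
    GL (Fin r) ℝ where
  val := 1 + t • M
  inv := 1 - (t / (1 + t * μ)) • M
  val_inv := by
    have h : t • M = (t / (1 + t * μ) + t / (1 + t * μ) * (t * μ)) • M := by
      congr 1; field_simp
    simp only [Matrix.mul_sub, Matrix.add_mul, Matrix.mul_one, Matrix.one_mul, Matrix.smul_mul,
      Matrix.mul_smul, hM, smul_smul, smul_add]
    rw [add_smul] at h
    rw [← sub_eq_zero] at h ⊢
    rw [← h]
    abel
  inv_val := by
    have h : t • M = (t / (1 + t * μ) + t * (t / (1 + t * μ) * μ)) • M := by
      congr 1; field_simp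
    simp only [Matrix.mul_add, Matrix.sub_mul, Matrix.mul_one, Matrix.one_mul, Matrix.smul_mul,
      Matrix.mul_smul, hM, smul_smul, smul_sub]
    rw [add_smul] at h
    rw [← sub_eq_zero] at h ⊢
    rw [← h]
    abel

/-- First-order optimality condition of an alignment. -/
theorem IsOptAlign.first_order {G : GL (Fin r) ℝ} (h : IsOptAlign U V Us Vs G) :
    (nz U * (G : Matrix (Fin r) (Fin r) ℝ))ᵀ * nz (errU U Us G) =
      (nz (errV V Vs G))ᵀ * (nz V * ((G⁻¹ : GL (Fin r) ℝ) : Matrix (Fin r) (Fin r) ℝ)ᵀ) := by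
  set A := nz U * (G : Matrix (Fin r) (Fin r) ℝ) with hA
  set B := nz V * ((G⁻¹ : GL (Fin r) ℝ) : Matrix (Fin r) (Fin r) ℝ)ᵀ with hB
  set X := nz (errU U Us G)
  set Y := nz (errV V Vs G)
  -- Vary `G` to `G(1 + tM)`. When `M² = μM` the inverse is exactly `1 - τM` with `τ = t/(1 + tμ)`,
  -- so the objective is an explicit quadratic expression and no derivative of matrix inversion is
  -- needed; `τ - t` is of order `t²`.
  have key : ∀ (M : Matrix (Fin r) (Fin r) ℝ) (μ : ℝ), 0 ≤ μ → μ ≤ 1 → M * M = μ • M →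
      ip X (A * M) - ip Y (B * Mᵀ) = 0 := fun M μ h0 h1 hM => by
    refine eq_zero_of_forall_small
      (C := 2 * |ip Y (B * Mᵀ)| + ‖A * M‖ ^ 2 + 4 * ‖B * Mᵀ‖ ^ 2) fun t ht => ?_
    have ht' := abs_le.1 ht
    have hden : 1 / 2 ≤ 1 + t * μ := by nlinarith
    have hden' : 1 + t * μ ≠ 0 := by linarith
    have h2 := isOptAlign_iff.1 h (G * perturb M μ t hM hden')
    have h3 := pow_le_pow_left₀ (pairNorm2_nonneg _ _) h2 2
    rw [pairNorm2_sq, pairNorm2_sq] at h3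
    set τ := t / (1 + t * μ) with hτ
    have hU' : nz (errU U Us (G * perturb M μ t hM hden')) = X + t • (A * M) := by
      have e : ((G * perturb M μ t hM hden' : GL (Fin r) ℝ) : Matrix (Fin r) (Fin r) ℝ) =
        (G : Matrix (Fin r) (Fin r) ℝ) * (1 + t • M) := rfl
      simp only [X, errU, e, hA, nz_sub, nz_add, nz_smul, nz_mul, Matrix.mul_add, Matrix.mul_one, Matrix.mul_smul,
        Matrix.mul_assoc]
      abel
    have hV' : nz (errV V Vs (G * perturb M μ t hM hden')) = Y - τ • (B * Mᵀ) := by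
      have e : (((G * perturb M μ t hM hden')⁻¹ : GL (Fin r) ℝ) : Matrix (Fin r) (Fin r) ℝ) =
        (1 - τ • M) * ((G⁻¹ : GL (Fin r) ℝ) : Matrix (Fin r) (Fin r) ℝ) := by
        rw [mul_inv_rev]; rfl
      simp only [Y, errV, e, hB, nz_sub, nz_smul, nz_mul, Matrix.transpose_mul, Matrix.transpose_sub,
        Matrix.transpose_one, Matrix.transpose_smul, Matrix.mul_sub, Matrix.mul_one,
        Matrix.mul_smul, Matrix.mul_assoc]
      abel
    rw [hU', hV', norm_add_sq_ip, norm_sub_sq_ip, ip_smul_right, ip_smul_right, norm_smul,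
      norm_smul, mul_pow, mul_pow, Real.norm_eq_abs, Real.norm_eq_abs, sq_abs, sq_abs] at h3
    have hτ1 : τ * (1 + t * μ) = t := by rw [hτ]; field_simp
    have hτ2 : |τ| ≤ 2 * |t| := by
      rw [hτ, abs_div, abs_of_pos (by linarith : 0 < 1 + t * μ),
        div_le_iff₀ (by linarith : 0 < 1 + t * μ)]
      nlinarith [abs_nonneg t]
    have hτ3 : τ ^ 2 ≤ 4 * t ^ 2 := by
      rw [← sq_abs τ, ← sq_abs t]
      nlinarith [abs_nonneg τ]
    have hτ4 : |t - τ| ≤ 2 * t ^ 2 := by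
      have : t - τ = τ * t * μ := by linarith
      rw [this, abs_mul, abs_mul, abs_of_nonneg h0, ← sq_abs t]
      have h5 : |τ| * |t| ≤ 2 * |t| ^ 2 := by nlinarith [abs_nonneg t]
      have h6 : 0 ≤ |τ| * |t| := by positivity
      nlinarith
    have h7 : (t - τ) * ip Y (B * Mᵀ) ≤ 2 * t ^ 2 * |ip Y (B * Mᵀ)| := by
      refine (le_abs_self _).trans ?_
      rw [abs_mul]
      exact mul_le_mul_of_nonneg_right hτ4 (abs_nonneg _)
    have h8 : τ ^ 2 * ‖B * Mᵀ‖ ^ 2 ≤ 4 * t ^ 2 * ‖B * Mᵀ‖ ^ 2 :=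
      mul_le_mul_of_nonneg_right hτ3 (sq_nonneg _)
    have h9 : 0 ≤ t ^ 2 * ‖A * M‖ ^ 2 := by positivity
    have h10 : 0 ≤ t ^ 2 * ‖B * Mᵀ‖ ^ 2 := by positivity
    nlinarith
  ext i j
  -- Matrix units satisfy `M² = M` or `M² = 0`, and testing against them recovers every entry of the
  -- identity.
  have h1 : Matrix.single i j (1 : ℝ) * Matrix.single i j 1 =
      (if j = i then (1 : ℝ) else 0) • Matrix.single i j 1 := by
    by_cases hij : j = i
    · subst hij; simp
    · rw [if_neg hij, zero_smul, Matrix.single_mul_single_of_ne]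
      exact hij
  have h2 := key (Matrix.single i j 1) _ (by split_ifs <;> norm_num) (by split_ifs <;> norm_num) h1
  rw [ip_mul_left, ip_single, ip_mul_left, ← ip_transpose, Matrix.transpose_transpose, ip_single]
    at h2
  have h3 : (Bᵀ * Y)ᵀ = Yᵀ * B := by rw [Matrix.transpose_mul, Matrix.transpose_transpose]
  rw [h3] at h2
  linarith

end Alignment

/-! ### One gradient step in the Frobenius norm -/

section FrobeniusStep

variable {n q r : ℕ}

theorem norm_transpose_mul_self_le (X : Matrix (Fin n) (Fin r) ℝ) : ‖Xᵀ * X‖ ≤ ‖X‖ ^ 2 := by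
  have h := Matrix.frobenius_norm_mul Xᵀ X
  rw [Matrix.frobenius_norm_transpose] at h
  rwa [sq]

/-- Errors that satisfy the first-order condition give tangent directions of proportional size. -/
theorem tangent_lower_bound {A₀ ΔA : Matrix (Fin n) (Fin r) ℝ} {B₀ ΔB : Matrix (Fin q) (Fin r) ℝ}
    {a d s : ℝ} (ha : 0 < a) (hA : LB A₀ a) (hB : LB B₀ a) (hd : 0 ≤ d)
    (hd2 : ‖ΔA‖ ^ 2 + ‖ΔB‖ ^ 2 = d ^ 2) (hda : d ≤ a / 20)
    (hfoc : (A₀ + ΔA)ᵀ * ΔA = ΔBᵀ * (B₀ + ΔB)) (hs0 : 0 ≤ s) (hs1 : s ≤ 1) :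
    0.8 * (a ^ 2 * d ^ 2) ≤ ‖(A₀ + s • ΔA) * ΔBᵀ + ΔA * (B₀ + s • ΔB)ᵀ‖ ^ 2 := by
  set S := A₀ᵀ * ΔA with hS
  set T := ΔBᵀ * B₀ with hT
  set P := A₀ * ΔBᵀ + ΔA * B₀ᵀ with hP
  -- The optimality condition says that the two cross Gram matrices agree to second order. Their
  -- inner product, the cross term in `‖P‖²`, is then at least `-d⁴/2`, so the two tangent
  -- components cannot cancel.
  have hST : ‖S - T‖ ≤ d ^ 2 := by
    have h1 : S - T = ΔBᵀ * ΔB - ΔAᵀ * ΔA := by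
      rw [Matrix.transpose_add, Matrix.add_mul, Matrix.mul_add] at hfoc
      rw [sub_eq_sub_iff_add_eq_add, hfoc, add_comm]
    rw [h1]
    refine (norm_sub_le _ _).trans ?_
    linarith [norm_transpose_mul_self_le ΔA, norm_transpose_mul_self_le ΔB]
  have hcross : -(d ^ 2) ^ 2 ≤ 2 * ip S T := by
    have h1 := norm_sub_sq_ip S T
    have h2 := pow_le_pow_left₀ (norm_nonneg _) hST 2
    nlinarith [sq_nonneg ‖S‖, sq_nonneg ‖T‖]
  have hip : ip (A₀ * ΔBᵀ) (ΔA * B₀ᵀ) = ip S T := by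
    rw [ip_mul_right, Matrix.transpose_transpose, ip_comm, Matrix.mul_assoc, ip_mul_left]
  have hA1 := pow_le_pow_left₀ (by positivity) (hA.le_norm_mul ha.le ΔBᵀ) 2
  have hB1 := pow_le_pow_left₀ (by positivity) (hB.le_norm_mul_transpose ha.le ΔA) 2
  rw [Matrix.frobenius_norm_transpose, mul_pow] at hA1
  rw [mul_pow] at hB1
  have hP1 : a ^ 2 * d ^ 2 - (d ^ 2) ^ 2 ≤ ‖P‖ ^ 2 := by
    rw [hP, norm_add_sq_ip, hip, ← hd2]
    rw [← hd2] at hcross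
    nlinarith
  have hP2 : 0.99 * (a * d) ≤ ‖P‖ := by
    refine abs_le_of_sq_le_sq' ?_ (norm_nonneg _) |>.2
    have h1 : d ^ 2 ≤ a ^ 2 / 400 := by nlinarith
    nlinarith [mul_le_mul_of_nonneg_left h1 (sq_nonneg d), sq_nonneg (a * d)]
  -- Along the path the tangent matrix moves only by the quadratic term `2s ΔA ΔBᵀ`, of norm at most
  -- `d²`.
  have hPs : (A₀ + s • ΔA) * ΔBᵀ + ΔA * (B₀ + s • ΔB)ᵀ = P + (2 * s) • (ΔA * ΔBᵀ) := by
    simp only [hP, Matrix.add_mul, Matrix.transpose_add, Matrix.mul_add, Matrix.smul_mul,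
      Matrix.transpose_smul, Matrix.mul_smul, two_mul, add_smul]
    abel
  have hE : ‖(2 * s) • (ΔA * ΔBᵀ)‖ ≤ d ^ 2 := by
    rw [norm_smul, Real.norm_of_nonneg (by linarith)]
    have h1 := Matrix.frobenius_norm_mul ΔA ΔBᵀ
    rw [Matrix.frobenius_norm_transpose] at h1
    have h2 : 2 * (‖ΔA‖ * ‖ΔB‖) ≤ d ^ 2 := by nlinarith [sq_nonneg (‖ΔA‖ - ‖ΔB‖)]
    have h3 : 0 ≤ ‖ΔA * ΔBᵀ‖ := norm_nonneg _
    nlinarith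
  have h1 : ‖P‖ - d ^ 2 ≤ ‖P + (2 * s) • (ΔA * ΔBᵀ)‖ := by
    have := norm_sub_le (P + (2 * s) • (ΔA * ΔBᵀ)) ((2 * s) • (ΔA * ΔBᵀ))
    rw [add_sub_cancel_right] at this
    linarith
  have h2 : d ^ 2 ≤ a * d / 20 := by nlinarith
  have h3 : 0.9 * (a * d) ≤ ‖P + (2 * s) • (ΔA * ΔBᵀ)‖ := by
    have : 0 ≤ a * d := by positivity
    linarith
  rw [hPs]
  have h4 := pow_le_pow_left₀ (by positivity) h3 2
  nlinarith [sq_nonneg (a * d)]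

/-- Replacing `L` by `LK` costs `2ηk‖X‖‖L‖` in the cross term, split as `η²‖L‖² + k²‖X‖²`; the
constant is `2.11 = 1.11 + 1`, with `1.11 ≥ 1.05²`. -/
theorem ip_sub_smul_mul_ge {X L : Matrix (Fin n) (Fin r) ℝ} {K : Matrix (Fin r) (Fin r) ℝ}
    {η k : ℝ} (hη : 0 ≤ η) (hk : k ≤ 1 / 20) (hK : ‖L * K - L‖ ≤ k * ‖L‖) :
    ‖X - η • (L * K)‖ ^ 2 ≤
      ‖X‖ ^ 2 - 2 * η * ip X L + 2.11 * (η ^ 2 * ‖L‖ ^ 2) + k ^ 2 * ‖X‖ ^ 2 := by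
  have hL := norm_nonneg L
  have hX := norm_nonneg X
  have h1 : ip X L - k * ‖X‖ * ‖L‖ ≤ ip X (L * K) := by
    have h2 := (abs_le.1 (abs_ip_le X (L * K - L))).1
    rw [ip_sub_right] at h2
    nlinarith
  have h3 : ‖L * K‖ ≤ 1.05 * ‖L‖ := by
    have := norm_add_le (L * K - L) L
    rw [sub_add_cancel] at this
    nlinarith
  have h4 : ‖L * K‖ ^ 2 ≤ 1.11 * ‖L‖ ^ 2 := by nlinarith [norm_nonneg (L * K)]
  rw [norm_sub_sq_ip, ip_smul_right, norm_smul, mul_pow, Real.norm_eq_abs, sq_abs]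
  have h5 : 2 * η * (ip X L - k * ‖X‖ * ‖L‖) ≤ 2 * η * ip X (L * K) :=
    mul_le_mul_of_nonneg_left h1 (by linarith)
  have h6 : η ^ 2 * ‖L * K‖ ^ 2 ≤ η ^ 2 * (1.11 * ‖L‖ ^ 2) :=
    mul_le_mul_of_nonneg_left h4 (sq_nonneg _)
  linarith [sq_nonneg (η * ‖L‖ - k * ‖X‖)]

set_option maxHeartbeats 1000000 in
/-- One gradient step contracts the Frobenius error. The score along the segment from the truth is
`g`, with derivative given by the forms `H`; the matrices `K`, `K'` stand for the distortion of the
metric by the alignment. -/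
theorem frobenius_step {A₀ ΔA : Matrix (Fin n) (Fin r) ℝ} {B₀ ΔB : Matrix (Fin q) (Fin r) ℝ}
    {g : ℝ → Matrix (Fin n) (Fin q) ℝ}
    {H : ℝ → LinearMap.BilinForm ℝ (Matrix (Fin n) (Fin q) ℝ)}
    {K K' : Matrix (Fin r) (Fin r) ℝ} {a c c' d α β η k M : ℝ}
    (hsymm : ∀ s P Q, H s P Q = H s Q P)
    (hmvt : ∀ Q₀ Q₁, ∃ s ∈ Set.Ioo (0 : ℝ) 1, ip (g 1) (Q₀ + Q₁) =
      H s ((A₀ + s • ΔA) * ΔBᵀ + ΔA * (B₀ + s • ΔB)ᵀ) (Q₀ + s • Q₁) + ip (g s) Q₁)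
    (hcurv : ∀ s ∈ Set.Ioo (0 : ℝ) 1, ∀ (L : Matrix (Fin n) (Fin r) ℝ)
      (R : Matrix (Fin q) (Fin r) ℝ),
      α * ‖(A₀ + s • ΔA) * Rᵀ + L * (B₀ + s • ΔB)ᵀ‖ ^ 2 ≤
          H s ((A₀ + s • ΔA) * Rᵀ + L * (B₀ + s • ΔB)ᵀ)
            ((A₀ + s • ΔA) * Rᵀ + L * (B₀ + s • ΔB)ᵀ) ∧
        H s ((A₀ + s • ΔA) * Rᵀ + L * (B₀ + s • ΔB)ᵀ)
            ((A₀ + s • ΔA) * Rᵀ + L * (B₀ + s • ΔB)ᵀ) ≤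
          β * ‖(A₀ + s • ΔA) * Rᵀ + L * (B₀ + s • ΔB)ᵀ‖ ^ 2)
    (hrem : ∀ s ∈ Set.Ioo (0 : ℝ) 1, ∀ (X : Matrix (Fin n) (Fin r) ℝ)
      (Y : Matrix (Fin q) (Fin r) ℝ), |ip (g s) (X * Yᵀ)| ≤ M * ‖X‖ * ‖Y‖)
    (hUA : ∀ s ∈ Set.Ioo (0 : ℝ) 1, UB (A₀ + s • ΔA) c')
    (hUB : ∀ s ∈ Set.Ioo (0 : ℝ) 1, UB (B₀ + s • ΔB) c')
    (hP : ∀ s ∈ Set.Ioo (0 : ℝ) 1,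
      0.8 * (a ^ 2 * d ^ 2) ≤ ‖(A₀ + s • ΔA) * ΔBᵀ + ΔA * (B₀ + s • ΔB)ᵀ‖ ^ 2)
    (hK : ∀ X : Matrix (Fin n) (Fin r) ℝ, ‖X * K - X‖ ≤ k * ‖X‖)
    (hK' : ∀ X : Matrix (Fin q) (Fin r) ℝ, ‖X * K' - X‖ ≤ k * ‖X‖)
    (hd2 : ‖ΔA‖ ^ 2 + ‖ΔB‖ ^ 2 = d ^ 2) (hη : 0 < η) (hα : 0 < α) (hαβ : α ≤ β)
    (ha : 0 < a) (hac : a ≤ c) (hηc : η * (β * c ^ 2) ≤ 1 / 10) (hc' : 0 ≤ c')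
    (hcc' : c' ^ 2 ≤ 1.1 * c ^ 2) (hM0 : 0 ≤ M) (hM : M ≤ α * a ^ 2 / 20)
    (hk : k ≤ 1 / 20) (hk2 : k ^ 2 ≤ η * (α * a ^ 2) / 10) :
    ‖ΔA - η • (g 1 * (B₀ + ΔB) * K)‖ ^ 2 + ‖ΔB - η • ((g 1)ᵀ * (A₀ + ΔA) * K')‖ ^ 2 +
        η ^ 2 * (‖g 1 * (B₀ + ΔB)‖ ^ 2 + ‖(g 1)ᵀ * (A₀ + ΔA)‖ ^ 2) ≤
      (1 - η * (α * a ^ 2) / 2) * d ^ 2 := by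
  set L := g 1 * (B₀ + ΔB) with hL
  set R := (g 1)ᵀ * (A₀ + ΔA) with hR
  have hβ : 0 < β := hα.trans_le hαβ
  have e1 : ip (g 1) (ΔA * (B₀ + ΔB)ᵀ) = ip ΔA L := by
    rw [ip_mul_right, Matrix.transpose_transpose, ip_comm]
  have e2 : ip (g 1) ((A₀ + ΔA) * ΔBᵀ) = ip ΔB R := by
    rw [← ip_transpose, Matrix.transpose_mul, Matrix.transpose_transpose, ip_mul_right,
      Matrix.transpose_transpose, ip_comm]
  have e3 : ip (g 1) (L * (B₀ + ΔB)ᵀ) = ‖L‖ ^ 2 := by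
    rw [ip_mul_right, Matrix.transpose_transpose, ip_self]
  have e4 : ip (g 1) ((A₀ + ΔA) * Rᵀ) = ‖R‖ ^ 2 := by
    rw [← ip_transpose, Matrix.transpose_mul, Matrix.transpose_transpose, ip_mul_right,
      Matrix.transpose_transpose, ip_self]
  -- One test direction for both the error and the gradient, so that one intermediate point `s`
  -- serves all terms. At parameter `s` it equals `2P - 8ηW`; the coefficient `4` of `ΔA ΔBᵀ` comes
  -- from the factor `2s` in `P`.
  obtain ⟨s, hs, hmv⟩ := hmvt
    ((2 : ℝ) • (A₀ * ΔBᵀ + ΔA * B₀ᵀ) - (8 * η) • (A₀ * Rᵀ + L * B₀ᵀ))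
    ((4 : ℝ) • (ΔA * ΔBᵀ) - (8 * η) • (ΔA * Rᵀ + L * ΔBᵀ))
  set P := (A₀ + s • ΔA) * ΔBᵀ + ΔA * (B₀ + s • ΔB)ᵀ with hPdef
  set W := (A₀ + s • ΔA) * Rᵀ + L * (B₀ + s • ΔB)ᵀ with hW
  have q1 : (2 : ℝ) • (A₀ * ΔBᵀ + ΔA * B₀ᵀ) - (8 * η) • (A₀ * Rᵀ + L * B₀ᵀ) +
      ((4 : ℝ) • (ΔA * ΔBᵀ) - (8 * η) • (ΔA * Rᵀ + L * ΔBᵀ)) =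
      (2 : ℝ) • (ΔA * (B₀ + ΔB)ᵀ + (A₀ + ΔA) * ΔBᵀ) -
        (8 * η) • (L * (B₀ + ΔB)ᵀ + (A₀ + ΔA) * Rᵀ) := by
    simp only [Matrix.add_mul, Matrix.transpose_add, Matrix.mul_add]
    module
  have q2 : (2 : ℝ) • (A₀ * ΔBᵀ + ΔA * B₀ᵀ) - (8 * η) • (A₀ * Rᵀ + L * B₀ᵀ) +
      s • ((4 : ℝ) • (ΔA * ΔBᵀ) - (8 * η) • (ΔA * Rᵀ + L * ΔBᵀ)) =
      (2 : ℝ) • P - (8 * η) • W := by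
    simp only [hPdef, hW, Matrix.add_mul, Matrix.transpose_add, Matrix.mul_add, Matrix.smul_mul,
      Matrix.transpose_smul, Matrix.mul_smul]
    module
  rw [q1, q2, ip_sub_right, ip_smul_right, ip_smul_right, ip_add_right, ip_add_right, e1, e2, e3,
    e4, map_sub, map_smul, map_smul, smul_eq_mul, smul_eq_mul, ip_sub_right, ip_smul_right,
    ip_smul_right, ip_add_right] at hmv
  -- Positivity of the Hessian on the tangent direction `P - 4ηW`. It disposes of the mixed term `H
  -- P W` while keeping one copy of `H P P`.
  have hdiff : 0 ≤ H s P P - 8 * η * H s P W + 16 * η ^ 2 * H s W W := by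
    have h1 := (hcurv s hs (ΔA - (4 * η) • L) (ΔB - (4 * η) • R)).1
    have h2 : (A₀ + s • ΔA) * (ΔB - (4 * η) • R)ᵀ + (ΔA - (4 * η) • L) * (B₀ + s • ΔB)ᵀ =
        P - (4 * η) • W := by
      rw [hPdef, hW, Matrix.transpose_sub, Matrix.mul_sub, Matrix.sub_mul, Matrix.transpose_smul,
        Matrix.mul_smul, Matrix.smul_mul, smul_add]
      abel
    rw [h2] at h1
    simp only [map_sub, map_smul, LinearMap.sub_apply, LinearMap.smul_apply, smul_eq_mul] at h1
    rw [hsymm s W P] at h1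
    have h3 : 0 ≤ α * ‖P - (4 * η) • W‖ ^ 2 := by positivity
    linarith
  have hWn : ‖W‖ ^ 2 ≤ 2.2 * c ^ 2 * (‖L‖ ^ 2 + ‖R‖ ^ 2) := by
    have h1 := (hUA s hs).norm_mul_le hc' Rᵀ
    have h2 := (hUB s hs).norm_mul_transpose_le hc' L
    rw [Matrix.frobenius_norm_transpose] at h1
    have h3 : ‖W‖ ≤ c' * (‖L‖ + ‖R‖) := (norm_add_le _ _).trans (by linarith)
    have h4 := pow_le_pow_left₀ (norm_nonneg _) h3 2
    rw [mul_pow] at h4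
    have h5 : (‖L‖ + ‖R‖) ^ 2 ≤ 2 * (‖L‖ ^ 2 + ‖R‖ ^ 2) := by linarith [sq_nonneg (‖L‖ - ‖R‖)]
    have h6 := mul_le_mul hcc' h5 (sq_nonneg _) (by positivity)
    linarith
  have hHW : 16 * η ^ 2 * H s W W ≤ 3.52 * (η * (‖L‖ ^ 2 + ‖R‖ ^ 2)) := by
    have h1 := (hcurv s hs L R).2
    have h2 : H s W W ≤ β * (2.2 * c ^ 2 * (‖L‖ ^ 2 + ‖R‖ ^ 2)) :=
      h1.trans (mul_le_mul_of_nonneg_left hWn hβ.le)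
    have h3 : 16 * η ^ 2 * H s W W ≤ 16 * η ^ 2 * (β * (2.2 * c ^ 2 * (‖L‖ ^ 2 + ‖R‖ ^ 2))) :=
      mul_le_mul_of_nonneg_left h2 (by positivity)
    have h4 : η * (β * c ^ 2) * (η * (‖L‖ ^ 2 + ‖R‖ ^ 2)) ≤
        1 / 10 * (η * (‖L‖ ^ 2 + ‖R‖ ^ 2)) := mul_le_mul_of_nonneg_right hηc (by positivity)
    linarith
  have hHP : 0.8 * (α * (a ^ 2 * d ^ 2)) ≤ H s P P := by
    have h1 := (hcurv s hs ΔA ΔB).1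
    have h2 := mul_le_mul_of_nonneg_left (hP s hs) hα.le
    linarith
  have hA0 := norm_nonneg ΔA
  have hB0 := norm_nonneg ΔB
  have hL0 := norm_nonneg L
  have hR0 := norm_nonneg R
  have r1 := (abs_le.1 (hrem s hs ΔA ΔB)).1
  have r2 := (abs_le.1 (hrem s hs ΔA R)).2
  have r3 := (abs_le.1 (hrem s hs L ΔB)).2
  have r4 : 4 * (M * ‖ΔA‖ * ‖ΔB‖) ≤ 2 * M * d ^ 2 := by
    rw [← hd2]
    linarith [mul_nonneg hM0 (sq_nonneg (‖ΔA‖ - ‖ΔB‖))]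
  have r5 : 8 * (M * ‖ΔA‖ * ‖R‖) ≤ ‖R‖ ^ 2 + 16 * M ^ 2 * ‖ΔA‖ ^ 2 := by
    linarith [sq_nonneg (‖R‖ - 4 * M * ‖ΔA‖)]
  have r6 : 8 * (M * ‖L‖ * ‖ΔB‖) ≤ ‖L‖ ^ 2 + 16 * M ^ 2 * ‖ΔB‖ ^ 2 := by
    linarith [sq_nonneg (‖L‖ - 4 * M * ‖ΔB‖)]
  have r7 : 8 * η * (ip (g s) (ΔA * Rᵀ) + ip (g s) (L * ΔBᵀ)) ≤
      η * (‖L‖ ^ 2 + ‖R‖ ^ 2 + 16 * M ^ 2 * d ^ 2) := by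
    rw [← hd2]
    have : 8 * (ip (g s) (ΔA * Rᵀ) + ip (g s) (L * ΔBᵀ)) ≤
      ‖L‖ ^ 2 + ‖R‖ ^ 2 + 16 * M ^ 2 * (‖ΔA‖ ^ 2 + ‖ΔB‖ ^ 2) := by linarith
    have := mul_le_mul_of_nonneg_left this hη.le
    linarith
  -- Of the `8` copies of `η(‖L‖² + ‖R‖²)`, the curvature `H W W` uses `3.52` and the remainders use
  -- `1`. The surviving `3.48` pays for the `2.11` of the quadratic step and for the extra copy kept
  -- on the left of the conclusion.
  have hS : 3.48 * (η * (‖L‖ ^ 2 + ‖R‖ ^ 2)) + 0.8 * (α * (a ^ 2 * d ^ 2)) - 2 * M * d ^ 2 -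
      16 * η * M ^ 2 * d ^ 2 ≤ 2 * (ip ΔA L + ip ΔB R) := by
    linarith
  have hηa : η * (α * a ^ 2) ≤ 1 / 10 := by
    have h1 : a ^ 2 ≤ c ^ 2 := pow_le_pow_left₀ ha.le hac 2
    have h2 : α * a ^ 2 ≤ β * c ^ 2 := mul_le_mul hαβ h1 (sq_nonneg _) hβ.le
    exact (mul_le_mul_of_nonneg_left h2 hη.le).trans hηc
  have hMM : 16 * η * M ^ 2 ≤ 0.1 * (α * a ^ 2) := by
    have h1 : η * M ≤ 1 / 200 := by linarith [mul_le_mul_of_nonneg_left hM hη.le]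
    have h2 : η * M * M ≤ 1 / 200 * M := mul_le_mul_of_nonneg_right h1 hM0
    linarith
  -- Budget in units of `ηαa²d²`: a gain of `0.8`, less `0.2` for the remainders here and `0.1` for
  -- the distortion `k²`, leaves the claimed `1/2`.
  have hMd : (2 * M + 16 * η * M ^ 2) * d ^ 2 ≤ 0.2 * (α * a ^ 2) * d ^ 2 :=
    mul_le_mul_of_nonneg_right (by linarith) (sq_nonneg _)
  have hS' := mul_le_mul_of_nonneg_left hS hη.le
  have hMd' := mul_le_mul_of_nonneg_left hMd hη.le
  have hkd := mul_le_mul_of_nonneg_right hk2 (sq_nonneg d)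
  have t1 := ip_sub_smul_mul_ge (X := ΔA) hη.le hk (hK L)
  have t2 := ip_sub_smul_mul_ge (X := ΔB) hη.le hk (hK' R)
  have t3 : k ^ 2 * ‖ΔA‖ ^ 2 + k ^ 2 * ‖ΔB‖ ^ 2 = k ^ 2 * d ^ 2 := by rw [← hd2]; ring
  have t4 : 0 ≤ η ^ 2 * (‖L‖ ^ 2 + ‖R‖ ^ 2) := by positivity
  linarith

/-- A gradient step on both factors changes the imbalance only to second order. -/
theorem imbalance_step (A : Matrix (Fin n) (Fin r) ℝ) (B : Matrix (Fin q) (Fin r) ℝ)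
    (g : Matrix (Fin n) (Fin q) ℝ) (η : ℝ) :
    ‖(A - η • (g * B))ᵀ * (A - η • (g * B)) - (B - η • (gᵀ * A))ᵀ * (B - η • (gᵀ * A))‖ ≤
      ‖Aᵀ * A - Bᵀ * B‖ + η ^ 2 * (‖g * B‖ ^ 2 + ‖gᵀ * A‖ ^ 2) := by
  -- The terms linear in `η` are `AᵀgB + BᵀgᵀA` in both Gram matrices and cancel.
  have h1 : (A - η • (g * B))ᵀ * (A - η • (g * B)) - (B - η • (gᵀ * A))ᵀ * (B - η • (gᵀ * A)) =
      (Aᵀ * A - Bᵀ * B) + (η ^ 2) • ((g * B)ᵀ * (g * B) - (gᵀ * A)ᵀ * (gᵀ * A)) := by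
    simp only [Matrix.transpose_sub, Matrix.transpose_smul, Matrix.transpose_mul,
      Matrix.transpose_transpose, Matrix.sub_mul, Matrix.mul_sub, Matrix.smul_mul, Matrix.mul_smul,
      Matrix.mul_assoc]
    module
  rw [h1]
  refine (norm_add_le _ _).trans (add_le_add le_rfl ?_)
  rw [norm_smul, Real.norm_of_nonneg (sq_nonneg η)]
  refine mul_le_mul_of_nonneg_left ((norm_sub_le _ _).trans ?_) (sq_nonneg η)
  linarith [norm_transpose_mul_self_le (g * B), norm_transpose_mul_self_le (gᵀ * A)]

theorem vecNorm_mulVec_sq (A : Matrix (Fin n) (Fin r) ℝ) (x : Fin r → ℝ) :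
    vecNorm (A *ᵥ x) ^ 2 = x ⬝ᵥ ((Aᵀ * A) *ᵥ x) := by
  rw [vecNorm_sq, ← Matrix.mulVec_mulVec, dotProduct_comm x, transpose_mulVec_dotProduct]

/-- Alignments of nearly balanced factors to balanced ones are nearly orthogonal. -/
theorem gram_close {A A₀ : Matrix (Fin n) (Fin r) ℝ} {B B₀ : Matrix (Fin q) (Fin r) ℝ}
    {G : GL (Fin r) ℝ} {a d m : ℝ} (ha : 0 < a) (hA₀ : LB A₀ a) (hbal : A₀ᵀ * A₀ = B₀ᵀ * B₀)
    (hA : ‖A * (G : Matrix (Fin r) (Fin r) ℝ) - A₀‖ ≤ d)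
    (hB : ‖B * ((G⁻¹ : GL (Fin r) ℝ) : Matrix (Fin r) (Fin r) ℝ)ᵀ - B₀‖ ≤ d) (hda : d ≤ a / 20)
    (hm : ‖Aᵀ * A - Bᵀ * B‖ ≤ m) :
    UB ((G : Matrix (Fin r) (Fin r) ℝ)ᵀ * (G : Matrix (Fin r) (Fin r) ℝ) - 1)
      (3 * (d / a) + 2 * (m / a ^ 2)) := by
  have hd0 : 0 ≤ d := (norm_nonneg _).trans hA
  have hm0 : 0 ≤ m := (norm_nonneg _).trans hm
  refine vecNorm_mulVec_sub_le (by simp) (by positivity) fun v μ hv hμ => ?_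
  set w := (G : Matrix (Fin r) (Fin r) ℝ) *ᵥ v with hw
  set x := vecNorm ((A * (G : Matrix (Fin r) (Fin r) ℝ)) *ᵥ v) with hx
  set y := vecNorm ((B * ((G⁻¹ : GL (Fin r) ℝ) : Matrix (Fin r) (Fin r) ℝ)ᵀ) *ᵥ v) with hy
  set l := vecNorm (A₀ *ᵥ v) with hl
  have hl' : l = vecNorm (B₀ *ᵥ v) := by
    refine (pow_left_inj₀ (vecNorm_nonneg _) (vecNorm_nonneg _) two_ne_zero).1 ?_
    rw [vecNorm_mulVec_sq, vecNorm_mulVec_sq, hbal]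
  have hla : a ≤ l := by have := hA₀ v; rwa [hv, mul_one] at this
  have hw2 : vecNorm w ^ 2 = μ := by
    rw [hw, vecNorm_mulVec_sq, hμ, dotProduct_smul, ← vecNorm_sq, hv]; simp
  have hμ0 : 0 ≤ μ := by rw [← hw2]; positivity
  -- For an eigenvector, `GᵀGv = μv` means `Gv = μG⁻ᵀv`. The single vector `w = Gv` therefore sees
  -- both aligned factors, and near balance at `w` forces `μ` to be near `1`.
  have hBw : B *ᵥ w = μ • ((B * ((G⁻¹ : GL (Fin r) ℝ) : Matrix (Fin r) (Fin r) ℝ)ᵀ) *ᵥ v) := by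
    rw [← Matrix.mulVec_smul, ← hμ, Matrix.mulVec_mulVec, Matrix.mulVec_mulVec]
    congr 1
    rw [Matrix.mul_assoc B, ← Matrix.mul_assoc _ᵀ, ← Matrix.transpose_mul, GL_mul_inv,
      Matrix.transpose_one, Matrix.one_mul]
  have hBw' : vecNorm (B *ᵥ w) = μ * y := by
    rw [hBw, vecNorm_smul, abs_of_nonneg hμ0]
  have hAw : vecNorm (A *ᵥ w) = x := by rw [hw, Matrix.mulVec_mulVec]
  have hD : |x ^ 2 - (μ * y) ^ 2| ≤ m * μ := by
    have h1 : x ^ 2 - (μ * y) ^ 2 = w ⬝ᵥ ((Aᵀ * A - Bᵀ * B) *ᵥ w) := by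
      rw [← hBw', ← hAw, vecNorm_mulVec_sq, vecNorm_mulVec_sq, Matrix.sub_mulVec, dotProduct_sub]
    rw [h1, ← hw2]
    refine (abs_dotProduct_le _ _).trans ?_
    have h2 := UB_norm (Aᵀ * A - Bᵀ * B) w
    have h3 := mul_le_mul_of_nonneg_right hm (vecNorm_nonneg w)
    nlinarith [vecNorm_nonneg w]
  have hxl : |x - l| ≤ d := by
    have h1 := UB_norm (A * (G : Matrix (Fin r) (Fin r) ℝ) - A₀) v
    rw [hv, mul_one, Matrix.sub_mulVec] at h1
    have h2 : |x - l| ≤ vecNorm ((A * (G : Matrix (Fin r) (Fin r) ℝ)) *ᵥ v - A₀ *ᵥ v) := by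
      simpa [vecNorm, hx, hl] using abs_norm_sub_norm_le (WithLp.toLp 2
        ((A * (G : Matrix (Fin r) (Fin r) ℝ)) *ᵥ v)) (WithLp.toLp 2 (A₀ *ᵥ v))
    linarith
  have hyl : |y - l| ≤ d := by
    have h1 := UB_norm (B * ((G⁻¹ : GL (Fin r) ℝ) : Matrix (Fin r) (Fin r) ℝ)ᵀ - B₀) v
    rw [hv, mul_one, Matrix.sub_mulVec] at h1
    have h2 : |y - l| ≤ vecNorm
        ((B * ((G⁻¹ : GL (Fin r) ℝ) : Matrix (Fin r) (Fin r) ℝ)ᵀ) *ᵥ v - B₀ *ᵥ v) := by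
      rw [hl']
      simpa [vecNorm, hy] using abs_norm_sub_norm_le (WithLp.toLp 2
        ((B * ((G⁻¹ : GL (Fin r) ℝ) : Matrix (Fin r) (Fin r) ℝ)ᵀ) *ᵥ v))
        (WithLp.toLp 2 (B₀ *ᵥ v))
    linarith
  obtain ⟨hx1, hx2⟩ := abs_le.1 hxl
  obtain ⟨hy1, hy2⟩ := abs_le.1 hyl
  have hx0 : 0 < x := by linarith
  have hya : 0.95 * a ≤ y := by linarith
  have hy0 : 0 < y := by linarith
  have hμp : 0 < μ := by
    rcases hμ0.eq_or_lt with h | h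
    · rw [← h] at hD
      simp only [zero_mul, mul_zero] at hD
      have := (abs_le.1 hD).2
      nlinarith
    · exact h
  have h1 : |x - μ * y| * y ≤ m := by
    have h2 : |x - μ * y| * (x + μ * y) ≤ m * μ := by
      rw [← abs_of_pos (by positivity : 0 < x + μ * y), ← abs_mul,
        show (x - μ * y) * (x + μ * y) = x ^ 2 - (μ * y) ^ 2 by ring]
      exact hD
    have h3 : |x - μ * y| * (μ * y) ≤ m * μ := by
      have := mul_nonneg (abs_nonneg (x - μ * y)) hx0.le
      linarith
    refine le_of_mul_le_mul_right ?_ hμp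
    linarith
  have h2 : |x - μ * y| * (0.95 * a) ≤ m :=
    (mul_le_mul_of_nonneg_left hya (abs_nonneg _)).trans h1
  have h3 : |μ - 1| * l ≤ |x - μ * y| + d + μ * d := by
    rw [← abs_of_pos (ha.trans_le hla), ← abs_mul]
    have h4 : (μ - 1) * l = -(x - μ * y) + (x - l) - μ * (y - l) := by ring
    rw [h4]
    refine (abs_sub _ _).trans (add_le_add ((abs_add_le _ _).trans ?_) ?_)
    · rw [abs_neg]; linarith
    · rw [abs_mul, abs_of_pos hμp]
      exact mul_le_mul_of_nonneg_left hyl hμ0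
  have h5 : |μ - 1| * (0.95 * a) ≤ |x - μ * y| + 2 * d := by
    have h6 : μ ≤ 1 + |μ - 1| := by linarith [le_abs_self (μ - 1)]
    have h7 := mul_le_mul_of_nonneg_right h6 hd0
    have h8 := mul_le_mul_of_nonneg_left hla (abs_nonneg (μ - 1))
    have h9 := mul_le_mul_of_nonneg_left hda (abs_nonneg (μ - 1))
    linarith
  have h6 : |μ - 1| * a ^ 2 ≤ 3 * (d * a) + 2 * m := by
    have h7 := mul_le_mul_of_nonneg_right h5 (by positivity : (0 : ℝ) ≤ 0.95 * a)
    have h8 : 0 ≤ d * a := by positivity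
    nlinarith
  have h7 : 3 * (d / a) + 2 * (m / a ^ 2) = (3 * (d * a) + 2 * m) / a ^ 2 := by
    field_simp
  rw [h7, le_div_iff₀ (by positivity)]
  exact h6

end FrobeniusStep

/-! ### One gradient step, row by row -/

section RowStep

variable {n q r : ℕ}

/-- A step along a symmetric form with values in `[θ, 1]` contracts, up to a perturbation. -/
theorem vecNorm_step_le {T : LinearMap.BilinForm ℝ (Fin r → ℝ)} {θ C : ℝ} {x y z : Fin r → ℝ}
    (hsymm : ∀ u v, T u v = T v u) (hlow : ∀ u, θ * vecNorm u ^ 2 ≤ T u u)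
    (hup : ∀ u, T u u ≤ vecNorm u ^ 2) (hθ : θ ≤ 1) (hy : y = x - z)
    (hz : T x y - C * vecNorm y ≤ z ⬝ᵥ y) (hC : 0 ≤ C) :
    vecNorm y ≤ (1 - θ) * vecNorm x + C := by
  have hS : ∀ u, 0 ≤ u ⬝ᵥ u - T u u := fun u => by
    rw [← vecNorm_sq]; linarith [hup u]
  have hS' : ∀ u, u ⬝ᵥ u - T u u ≤ (1 - θ) * vecNorm u ^ 2 := fun u => by
    rw [← vecNorm_sq]; linarith [hlow u]
  have hx := vecNorm_nonneg x
  have hy0 := vecNorm_nonneg y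
  have hxy : x ⬝ᵥ y - T x y ≤ (1 - θ) * (vecNorm x * vecNorm y) := by
    refine abs_le_of_sq_le_sq' ?_ (mul_nonneg (by linarith) (by positivity)) |>.2
    -- Cauchy–Schwarz for the positive semidefinite form `⟨u, u⟩ - T u u`, through the discriminant.
    -- The form is at most `(1 - θ)|u|²`, which gives the contraction when it is tested against the
    -- new row `y`.
    have hq : ∀ t : ℝ, 0 ≤ (y ⬝ᵥ y - T y y) * (t * t) + (2 * (x ⬝ᵥ y - T x y)) * t +
        (x ⬝ᵥ x - T x x) := fun t => by
      have h1 := hS (x + t • y)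
      simp only [dotProduct_add, add_dotProduct, dotProduct_smul, smul_dotProduct, map_add,
        map_smul, LinearMap.add_apply, LinearMap.smul_apply, smul_eq_mul, hsymm y x,
        dotProduct_comm y x] at h1
      linarith
    have h2 := discrim_le_zero hq
    rw [discrim] at h2
    have h3 := mul_le_mul (hS' x) (hS' y) (hS y) (mul_nonneg (by linarith) (sq_nonneg _))
    nlinarith
  have h1 : vecNorm y ^ 2 = x ⬝ᵥ y - z ⬝ᵥ y := by
    rw [vecNorm_sq, ← sub_dotProduct, ← hy]
  rcases hy0.eq_or_lt with h | h
  · rw [← h]; exact add_nonneg (mul_nonneg (by linarith) hx) hC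
  · refine le_of_mul_le_mul_right ?_ h
    nlinarith

/-- The row form of a gradient step: the derivative of the score along the path splits into the
contribution of the row itself and a remainder. -/
theorem vecNorm_row_step_le {H : LinearMap.BilinForm ℝ (Matrix (Fin n) (Fin q) ℝ)}
    {Φ : (Fin r → ℝ) →ₗ[ℝ] Matrix (Fin n) (Fin q) ℝ} {P : Matrix (Fin n) (Fin q) ℝ}
    {α β c l u C₁ C₂ ρ : ℝ} {x y ζ : Fin r → ℝ} (hsymm : ∀ P Q, H P Q = H Q P)
    (hlow : ∀ w, α * (l * vecNorm w) ^ 2 ≤ H (Φ w) (Φ w))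
    (hup : ∀ w, H (Φ w) (Φ w) ≤ β * (u * vecNorm w) ^ 2)
    (hc : 0 ≤ c) (hcu : c * (β * u ^ 2) ≤ 1) (hlu : α * l ^ 2 ≤ β * u ^ 2)
    (hy : y = x - c • ζ)
    (hζ : ζ ⬝ᵥ y = H (P + Φ x) (Φ y) + ρ) (hP : |H (Φ y) P| ≤ C₁ * vecNorm y)
    (hρ : |ρ| ≤ C₂ * vecNorm y) (hC₁ : 0 ≤ C₁) (hC₂ : 0 ≤ C₂) :
    vecNorm y ≤ (1 - c * (α * l ^ 2)) * vecNorm x + c * (C₁ + C₂) := by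
  refine vecNorm_step_le (T := c • H.comp Φ Φ) (z := c • ζ) ?_ ?_ ?_ ?_ hy ?_
    (mul_nonneg hc (add_nonneg hC₁ hC₂))
  · intro u v
    simp [hsymm (Φ u) (Φ v)]
  · intro w
    have := mul_le_mul_of_nonneg_left (hlow w) hc
    simp only [LinearMap.smul_apply, LinearMap.BilinForm.comp_apply, smul_eq_mul]
    linarith
  · intro w
    have h1 := mul_le_mul_of_nonneg_left (hup w) hc
    have h2 := mul_le_mul_of_nonneg_right hcu (sq_nonneg (vecNorm w))
    simp only [LinearMap.smul_apply, LinearMap.BilinForm.comp_apply, smul_eq_mul]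
    linarith
  · exact (mul_le_mul_of_nonneg_left hlu hc).trans hcu
  · simp only [LinearMap.smul_apply, LinearMap.BilinForm.comp_apply, smul_eq_mul, smul_dotProduct]
    rw [hζ, map_add, LinearMap.add_apply, hsymm P]
    have h1 := mul_le_mul_of_nonneg_left (abs_le.1 hP).1 hc
    have h2 := mul_le_mul_of_nonneg_left (abs_le.1 hρ).1 hc
    linarith

/-- The matrix whose only nonzero row is `h`, at position `i`. -/
def rowMatrix (i : Fin n) : (Fin r → ℝ) →ₗ[ℝ] Matrix (Fin n) (Fin r) ℝ where
  toFun h := Matrix.vecMulVec (Pi.single i 1) h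
  map_add' _ _ := Matrix.vecMulVec_add _ _ _
  map_smul' _ _ := Matrix.vecMulVec_smul _ _ _

theorem rowMatrix_apply (i : Fin n) (h : Fin r → ℝ) :
    rowMatrix i h = Matrix.vecMulVec (Pi.single i 1) h := rfl

theorem ip_rowMatrix (M : Matrix (Fin n) (Fin r) ℝ) (i : Fin n) (h : Fin r → ℝ) :
    ip M (rowMatrix i h) = M i ⬝ᵥ h := by
  rw [ip_eq_sum, Finset.sum_eq_single i]
  · congr 1
    ext j
    simp [rowMatrix_apply, Matrix.vecMulVec_apply]
  · intro b _ hb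
    have : rowMatrix i h b = 0 := by
      ext j
      simp [rowMatrix_apply, Matrix.vecMulVec_apply, hb]
    rw [this, dotProduct_zero]
  · simp

theorem rowMatrix_mul_transpose (V : Matrix (Fin q) (Fin r) ℝ) (i : Fin n) (h : Fin r → ℝ) :
    rowMatrix i h * Vᵀ = rowMatrix i (V *ᵥ h) := by
  rw [rowMatrix_apply, Matrix.vecMulVec_mul, Matrix.vecMul_transpose, rowMatrix_apply]

theorem norm_rowMatrix (i : Fin n) (h : Fin r → ℝ) : ‖rowMatrix i h‖ = vecNorm h := by
  refine (pow_left_inj₀ (norm_nonneg _) (vecNorm_nonneg _) two_ne_zero).1 ?_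
  have h1 : rowMatrix i h i = h := by
    ext j
    simp [rowMatrix_apply, Matrix.vecMulVec_apply]
  rw [← ip_self, ip_rowMatrix, h1, vecNorm_sq]

theorem updateRow_add_rowMatrix (M : Matrix (Fin n) (Fin r) ℝ) (i : Fin n) :
    M.updateRow i 0 + rowMatrix i (M i) = M := by
  ext a b
  rw [Matrix.add_apply, Matrix.updateRow_apply, rowMatrix_apply, Matrix.vecMulVec_apply]
  by_cases h : a = i
  · subst h; simp
  · simp [h]

variable {f : Matrix (Fin n) (Fin q) ℝ → ℝ}
  {D : Set (Matrix (Fin n) (Fin r) ℝ × Matrix (Fin q) (Fin r) ℝ)}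
  {U dU : Matrix (Fin n) (Fin r) ℝ} {V dV : Matrix (Fin q) (Fin r) ℝ}
  {α β Linf c l u w ξ e : ℝ}

/-- Testing the score against a direction supported on row `i` isolates that row's gradient. The
derivative splits into the quadratic form of the row itself, a cross term with row `i` removed
(`RowCrossCurvature`), and the remainder from the moving direction (`ScoreLipRow`). -/
theorem vecNorm_row_step_left (hf : ContDiff ℝ 2 f) (h0 : matGrad f (U * Vᵀ) = 0)
    (hα : 0 < α) (hαβ : α ≤ β) (hRIP : LocalRIP f D α β) (hrow : RowCrossCurvature f D β)
    (hlip : ScoreLipRow f D Linf) (hmem0 : (U, V) ∈ D)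
    (hmem : ∀ s ∈ Set.Ioo (0 : ℝ) 1, (U + s • dU, V + s • dV) ∈ D)
    (hl : 0 ≤ l) (hlu : l ≤ u) (hc : 0 ≤ c) (hcu : c * (β * u ^ 2) ≤ 1)
    (hLB : ∀ s ∈ Set.Ioo (0 : ℝ) 1, LB (V + s • dV) l)
    (hUB : ∀ s ∈ Set.Ioo (0 : ℝ) 1, UB (V + s • dV) u)
    (hw : ∀ s ∈ Set.Ioo (0 : ℝ) 1, rowNorm (U + s • dU) ≤ w) (he : ‖dV‖ ≤ e)
    (hξ : ∀ s ∈ Set.Ioo (0 : ℝ) 1,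
      rowNorm ((U + s • dU) * (V + s • dV)ᵀ - U * Vᵀ) ≤ ξ) (i : Fin n) :
    vecNorm ((dU - c • (matGrad f ((U + dU) * (V + dV)ᵀ) * (V + dV))) i) ≤
      (1 - c * (α * l ^ 2)) * vecNorm (dU i) + c * (β * u * (w * e) + |Linf| * ξ * e) := by
  set y : Fin r → ℝ := (dU - c • (matGrad f ((U + dU) * (V + dV)ᵀ) * (V + dV))) i with hy
  -- The tested row is the updated error `y`, not the old one: its squared norm is the quantity to
  -- bound. The direction at parameter `s` is `e_i yᵀ (V + s dV)ᵀ`, tangent at that point.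
  obtain ⟨s, hs, hmv⟩ := exists_ip_score_eq hf (dU := dU) (dV := dV) h0 (rowMatrix i y * Vᵀ)
    (rowMatrix i y * dVᵀ)
  have hβ : 0 < β := hα.trans_le hαβ
  have he0 : 0 ≤ e := (norm_nonneg _).trans he
  have hw0 : 0 ≤ w := (rowNorm_nonneg _).trans (hw s hs)
  have hξ0 : 0 ≤ ξ := (rowNorm_nonneg _).trans (hξ s hs)
  have hu0 : 0 ≤ u := hl.trans hlu
  set Us := U + s • dU with hUs
  set Vs := V + s • dV with hVs
  let Φ : (Fin r → ℝ) →ₗ[ℝ] Matrix (Fin n) (Fin q) ℝ := mulTransposeRight Vs ∘ₗ rowMatrix i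
  have hΦ : ∀ x, Φ x = rowMatrix i x * Vsᵀ := fun x => rfl
  have hΦt : ∀ x, Us * (0 : Matrix (Fin q) (Fin r) ℝ)ᵀ + rowMatrix i x * Vsᵀ = Φ x := fun x => by
    rw [hΦ, Matrix.transpose_zero, Matrix.mul_zero, zero_add]
  have hΦn : ∀ x, ‖Φ x‖ = vecNorm (Vs *ᵥ x) := fun x => by
    rw [hΦ, rowMatrix_mul_transpose, norm_rowMatrix]
  have hcur : ∀ x, α * vecNorm (Vs *ᵥ x) ^ 2 ≤ hessForm f (Us * Vsᵀ) (Φ x) (Φ x) ∧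
      hessForm f (Us * Vsᵀ) (Φ x) (Φ x) ≤ β * vecNorm (Vs *ᵥ x) ^ 2 := fun x => by
    have h1 := hRIP Us Vs (hmem s hs) (rowMatrix i x) 0
    simp only [tangent, hΦt] at h1
    rwa [hΦn] at h1
  refine vecNorm_row_step_le (H := hessForm f (Us * Vsᵀ)) (Φ := Φ)
    (P := tangent Us Vs dV (dU.updateRow i 0)) (ρ := ip (matGrad f (Us * Vsᵀ))
      (rowMatrix i y * dVᵀ)) (β := β) (u := u)
    (ζ := (matGrad f ((U + dU) * (V + dV)ᵀ) * (V + dV)) i)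
    (hessForm_symm hf _) (fun x => ?_) (fun x => ?_) hc hcu ?_ rfl ?_ ?_ ?_
    (by positivity) (by positivity)
  · refine le_trans ?_ (hcur x).1
    exact mul_le_mul_of_nonneg_left (pow_le_pow_left₀ (mul_nonneg hl (vecNorm_nonneg x))
      (hLB s hs x) 2) hα.le
  · refine (hcur x).2.trans ?_
    exact mul_le_mul_of_nonneg_left (pow_le_pow_left₀ (vecNorm_nonneg _) (hUB s hs x) 2) hβ.le
  · exact mul_le_mul hαβ (pow_le_pow_left₀ hl hlu 2) (sq_nonneg _) hβ.le
  · have h1 : tangent Us Vs dV (dU.updateRow i 0) + Φ (dU i) = Us * dVᵀ + dU * Vsᵀ := by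
      rw [tangent, hΦ, add_assoc, ← Matrix.add_mul, updateRow_add_rowMatrix]
    have h2 : rowMatrix i y * Vᵀ + s • (rowMatrix i y * dVᵀ) = Φ y := by
      rw [hΦ, hVs, Matrix.transpose_add, Matrix.transpose_smul, Matrix.mul_add, Matrix.mul_smul]
    have h3 : rowMatrix i y * Vᵀ + rowMatrix i y * dVᵀ = rowMatrix i y * (V + dV)ᵀ := by
      rw [Matrix.transpose_add, Matrix.mul_add]
    rw [h2, h3, ip_mul_right, Matrix.transpose_transpose, ip_rowMatrix] at hmv
    rw [h1, hmv]
  · have h1 := (hrow Us Vs (hmem s hs) y dU dV).1 i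
    rw [← rowMatrix_apply, tangent, hΦt] at h1
    refine (show |hessForm f (Us * Vsᵀ) (Φ y) (tangent Us Vs dV (dU.updateRow i 0))| ≤ _
      from h1).trans ?_
    rw [Matrix.vecMul_transpose]
    have h2 : vecNorm (dV *ᵥ Us i) ≤ e * w :=
      (UB_norm dV _).trans (mul_le_mul he ((vecNorm_row_le_rowNorm _ i).trans (hw s hs))
        (vecNorm_nonneg _) he0)
    have h3 := mul_le_mul (hUB s hs y) h2 (vecNorm_nonneg _)
      (mul_nonneg hu0 (vecNorm_nonneg y))
    have h4 := mul_le_mul_of_nonneg_left h3 hβ.le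
    linarith
  · rw [ip_comm, ip_comm, rowMatrix_mul_transpose, ip_rowMatrix]
    refine (abs_dotProduct_le _ _).trans ?_
    have h1 := (hlip Us Vs U V (hmem s hs) hmem0).1
    rw [score, score, h0, sub_zero] at h1
    have h2 : vecNorm (matGrad f (Us * Vsᵀ) i) ≤ |Linf| * ξ :=
      (vecNorm_row_le_rowNorm _ i).trans (h1.trans (mul_le_mul (le_abs_self _) (hξ s hs)
        (rowNorm_nonneg _) (abs_nonneg _)))
    have h3 : vecNorm (dV *ᵥ y) ≤ e * vecNorm y := (UB_norm dV).mono he y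
    have h4 := mul_le_mul h2 h3 (vecNorm_nonneg _) (by positivity)
    linarith

/-- The same argument with the roles of the factors exchanged; it uses the second halves of the row
conditions. -/
theorem vecNorm_row_step_right (hf : ContDiff ℝ 2 f) (h0 : matGrad f (U * Vᵀ) = 0)
    (hα : 0 < α) (hαβ : α ≤ β) (hRIP : LocalRIP f D α β) (hrow : RowCrossCurvature f D β)
    (hlip : ScoreLipRow f D Linf) (hmem0 : (U, V) ∈ D)
    (hmem : ∀ s ∈ Set.Ioo (0 : ℝ) 1, (U + s • dU, V + s • dV) ∈ D)
    (hl : 0 ≤ l) (hlu : l ≤ u) (hc : 0 ≤ c) (hcu : c * (β * u ^ 2) ≤ 1)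
    (hLB : ∀ s ∈ Set.Ioo (0 : ℝ) 1, LB (U + s • dU) l)
    (hUB : ∀ s ∈ Set.Ioo (0 : ℝ) 1, UB (U + s • dU) u)
    (hw : ∀ s ∈ Set.Ioo (0 : ℝ) 1, rowNorm (V + s • dV) ≤ w) (he : ‖dU‖ ≤ e)
    (hξ : ∀ s ∈ Set.Ioo (0 : ℝ) 1,
      rowNorm ((V + s • dV) * (U + s • dU)ᵀ - V * Uᵀ) ≤ ξ) (j : Fin q) :
    vecNorm ((dV - c • ((matGrad f ((U + dU) * (V + dV)ᵀ))ᵀ * (U + dU))) j) ≤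
      (1 - c * (α * l ^ 2)) * vecNorm (dV j) + c * (β * u * (w * e) + |Linf| * ξ * e) := by
  set y : Fin r → ℝ := (dV - c • ((matGrad f ((U + dU) * (V + dV)ᵀ))ᵀ * (U + dU))) j with hy
  obtain ⟨s, hs, hmv⟩ := exists_ip_score_eq hf (dU := dU) (dV := dV) h0 (U * (rowMatrix j y)ᵀ)
    (dU * (rowMatrix j y)ᵀ)
  have hβ : 0 < β := hα.trans_le hαβ
  have he0 : 0 ≤ e := (norm_nonneg _).trans he
  have hw0 : 0 ≤ w := (rowNorm_nonneg _).trans (hw s hs)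
  have hξ0 : 0 ≤ ξ := (rowNorm_nonneg _).trans (hξ s hs)
  have hu0 : 0 ≤ u := hl.trans hlu
  set Us := U + s • dU with hUs
  set Vs := V + s • dV with hVs
  let Φ : (Fin r → ℝ) →ₗ[ℝ] Matrix (Fin n) (Fin q) ℝ := mulTransposeLeft Us ∘ₗ rowMatrix j
  have hΦ : ∀ x, Φ x = Us * (rowMatrix j x)ᵀ := fun x => rfl
  have hΦt : ∀ x, Us * (rowMatrix j x)ᵀ + (0 : Matrix (Fin n) (Fin r) ℝ) * Vsᵀ = Φ x := fun x => by
    rw [hΦ, Matrix.zero_mul, add_zero]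
  have hΦn : ∀ x, ‖Φ x‖ = vecNorm (Us *ᵥ x) := fun x => by
    rw [hΦ, ← Matrix.frobenius_norm_transpose, Matrix.transpose_mul, Matrix.transpose_transpose,
      rowMatrix_mul_transpose, norm_rowMatrix]
  have hcur : ∀ x, α * vecNorm (Us *ᵥ x) ^ 2 ≤ hessForm f (Us * Vsᵀ) (Φ x) (Φ x) ∧
      hessForm f (Us * Vsᵀ) (Φ x) (Φ x) ≤ β * vecNorm (Us *ᵥ x) ^ 2 := fun x => by
    have h1 := hRIP Us Vs (hmem s hs) 0 (rowMatrix j x)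
    simp only [tangent, hΦt] at h1
    rwa [hΦn] at h1
  refine vecNorm_row_step_le (H := hessForm f (Us * Vsᵀ)) (Φ := Φ)
    (P := tangent Us Vs (dV.updateRow j 0) dU) (ρ := ip (matGrad f (Us * Vsᵀ))
      (dU * (rowMatrix j y)ᵀ)) (β := β) (u := u)
    (ζ := ((matGrad f ((U + dU) * (V + dV)ᵀ))ᵀ * (U + dU)) j)
    (hessForm_symm hf _) (fun x => ?_) (fun x => ?_) hc hcu ?_ rfl ?_ ?_ ?_
    (by positivity) (by positivity)
  · refine le_trans ?_ (hcur x).1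
    exact mul_le_mul_of_nonneg_left (pow_le_pow_left₀ (mul_nonneg hl (vecNorm_nonneg x))
      (hLB s hs x) 2) hα.le
  · refine (hcur x).2.trans ?_
    exact mul_le_mul_of_nonneg_left (pow_le_pow_left₀ (vecNorm_nonneg _) (hUB s hs x) 2) hβ.le
  · exact mul_le_mul hαβ (pow_le_pow_left₀ hl hlu 2) (sq_nonneg _) hβ.le
  · have h1 : tangent Us Vs (dV.updateRow j 0) dU + Φ (dV j) = Us * dVᵀ + dU * Vsᵀ := by
      rw [tangent, hΦ, add_right_comm, ← Matrix.mul_add, ← Matrix.transpose_add,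
        updateRow_add_rowMatrix]
    have h2 : U * (rowMatrix j y)ᵀ + s • (dU * (rowMatrix j y)ᵀ) = Φ y := by
      rw [hΦ, hUs, Matrix.add_mul, Matrix.smul_mul]
    have h3 : U * (rowMatrix j y)ᵀ + dU * (rowMatrix j y)ᵀ = (U + dU) * (rowMatrix j y)ᵀ := by
      rw [Matrix.add_mul]
    rw [h2, h3, ← ip_transpose, Matrix.transpose_mul, Matrix.transpose_transpose, ip_mul_right,
      Matrix.transpose_transpose, ip_rowMatrix] at hmv
    rw [h1, hmv]
  · have h1 := (hrow Us Vs (hmem s hs) y dU dV).2 j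
    rw [← rowMatrix_apply, tangent, hΦt] at h1
    refine (show |hessForm f (Us * Vsᵀ) (Φ y) (tangent Us Vs (dV.updateRow j 0) dU)| ≤ _
      from h1).trans ?_
    have h2 : vecNorm (dU *ᵥ Vs j) ≤ e * w :=
      (UB_norm dU _).trans (mul_le_mul he ((vecNorm_row_le_rowNorm _ j).trans (hw s hs))
        (vecNorm_nonneg _) he0)
    have h3 := mul_le_mul (hUB s hs y) h2 (vecNorm_nonneg _)
      (mul_nonneg hu0 (vecNorm_nonneg y))
    have h4 := mul_le_mul_of_nonneg_left h3 hβ.le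
    linarith
  · rw [← ip_transpose, Matrix.transpose_mul, Matrix.transpose_transpose,
      rowMatrix_mul_transpose, ip_rowMatrix]
    refine (abs_dotProduct_le _ _).trans ?_
    have h1 := (hlip Us Vs U V (hmem s hs) hmem0).2
    rw [score, score, h0, sub_zero] at h1
    have h2 : vecNorm ((matGrad f (Us * Vsᵀ))ᵀ j) ≤ |Linf| * ξ :=
      (vecNorm_row_le_rowNorm _ j).trans (h1.trans (mul_le_mul (le_abs_self _) (hξ s hs)
        (rowNorm_nonneg _) (abs_nonneg _)))
    have h3 : vecNorm (dU *ᵥ y) ≤ e * vecNorm y := (UB_norm dU).mono he y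
    have h4 := mul_le_mul h2 h3 (vecNorm_nonneg _) (by positivity)
    linarith

end RowStep

/-! ### One iteration of gradient descent -/

section Iteration

variable {n q r : ℕ}

/-- Since `K K' = 1`, one has `K' - 1 = -(K - 1)K'`, and `K'` is itself bounded by `1.1`. -/
theorem UB_inv_sub_one {K K' : Matrix (Fin r) (Fin r) ℝ} {k : ℝ} (hK : UB (K - 1) k)
    (h : K * K' = 1) (hk0 : 0 ≤ k) (hk : k ≤ 1 / 50) : UB (K' - 1) (1.1 * k) := fun x => by
  have h1 := hK (K' *ᵥ x)
  have h2 : (K - 1) *ᵥ (K' *ᵥ x) = x - K' *ᵥ x := by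
    rw [Matrix.sub_mulVec, Matrix.mulVec_mulVec, h, Matrix.one_mulVec, Matrix.one_mulVec]
  rw [h2] at h1
  have h3 : (K' - 1) *ᵥ x = -(x - K' *ᵥ x) := by
    rw [Matrix.sub_mulVec, Matrix.one_mulVec, neg_sub]
  have h4 : vecNorm (K' *ᵥ x) ≤ vecNorm x + vecNorm (x - K' *ᵥ x) := by
    have := vecNorm_sub_le x (x - K' *ᵥ x)
    rwa [sub_sub_cancel] at this
  rw [h3, vecNorm_neg]
  have h5 := vecNorm_nonneg (K' *ᵥ x)
  have h6 := vecNorm_nonneg x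
  have h7 : vecNorm (K' *ᵥ x) ≤ 1.1 * vecNorm x := by nlinarith
  nlinarith

theorem UB_of_gram {G : GL (Fin r) ℝ} {k : ℝ}
    (hK : UB ((G : Matrix (Fin r) (Fin r) ℝ)ᵀ * (G : Matrix (Fin r) (Fin r) ℝ) - 1) k)
    (hk : k ≤ 1 / 50) : UB (G : Matrix (Fin r) (Fin r) ℝ) 1.02 ∧
      UB ((G⁻¹ : GL (Fin r) ℝ) : Matrix (Fin r) (Fin r) ℝ) 1.02 := by
  have h1 : ∀ x, |vecNorm ((G : Matrix (Fin r) (Fin r) ℝ) *ᵥ x) ^ 2 - vecNorm x ^ 2| ≤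
      1 / 50 * vecNorm x ^ 2 := fun x => by
    have h2 : vecNorm ((G : Matrix (Fin r) (Fin r) ℝ) *ᵥ x) ^ 2 - vecNorm x ^ 2 =
        x ⬝ᵥ (((G : Matrix (Fin r) (Fin r) ℝ)ᵀ * (G : Matrix (Fin r) (Fin r) ℝ) - 1) *ᵥ x) := by
      rw [vecNorm_mulVec_sq, Matrix.sub_mulVec, dotProduct_sub, Matrix.one_mulVec, vecNorm_sq]
    rw [h2]
    refine (abs_dotProduct_le _ _).trans ?_
    have h3 := (hK.mono hk) x
    nlinarith [vecNorm_nonneg x]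
  constructor
  · intro x
    refine abs_le_of_sq_le_sq' ?_ (mul_nonneg (by norm_num) (vecNorm_nonneg x)) |>.2
    have := (abs_le.1 (h1 x)).2
    nlinarith [sq_nonneg (vecNorm x)]
  · intro x
    have h2 := (abs_le.1 (h1 (((G⁻¹ : GL (Fin r) ℝ) : Matrix (Fin r) (Fin r) ℝ) *ᵥ x))).1
    rw [Matrix.mulVec_mulVec, GL_mul_inv, Matrix.one_mulVec] at h2
    refine abs_le_of_sq_le_sq' ?_ (mul_nonneg (by norm_num) (vecNorm_nonneg x)) |>.2
    nlinarith [sq_nonneg (vecNorm x),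
      sq_nonneg (vecNorm (((G⁻¹ : GL (Fin r) ℝ) : Matrix (Fin r) (Fin r) ℝ) *ᵥ x))]

/-- The normalized imbalance of a pair of factors. -/
noncomputable def imbalance (U : Matrix (Fin n) (Fin r) ℝ) (V : Matrix (Fin q) (Fin r) ℝ) : ℝ :=
  ‖(nz U)ᵀ * nz U - (nz V)ᵀ * nz V‖

variable {f : Matrix (Fin n) (Fin q) ℝ → ℝ} {Us : Matrix (Fin n) (Fin r) ℝ}
  {Vs : Matrix (Fin q) (Fin r) ℝ} {U U' : Matrix (Fin n) (Fin r) ℝ}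
  {V V' : Matrix (Fin q) (Fin r) ℝ}
  {D : Set (Matrix (Fin n) (Fin r) ℝ × Matrix (Fin q) (Fin r) ℝ)}
  {G : GL (Fin r) ℝ} {α β L₂ a c d η k m : ℝ}

theorem nz_mul_nz_transpose (X : Matrix (Fin n) (Fin r) ℝ) (Y : Matrix (Fin q) (Fin r) ℝ) :
    nz X * (nz Y)ᵀ = ((√(n : ℝ))⁻¹ * (√(q : ℝ))⁻¹) • (X * Yᵀ) := by
  rw [nz, nz, Matrix.transpose_smul, Matrix.smul_mul, Matrix.mul_smul, smul_smul]

/-- The score divided by `√(n q)`, along the segment from the truth to an aligned pair. -/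
noncomputable def pathScore (f : Matrix (Fin n) (Fin q) ℝ → ℝ) (U₀ dU : Matrix (Fin n) (Fin r) ℝ)
    (V₀ dV : Matrix (Fin q) (Fin r) ℝ) (s : ℝ) : Matrix (Fin n) (Fin q) ℝ :=
  ((√(n : ℝ))⁻¹ * (√(q : ℝ))⁻¹) • matGrad f ((U₀ + s • dU) * (V₀ + s • dV)ᵀ)

theorem exists_ip_pathScore_eq (hf : ContDiff ℝ 2 f) {U₀ dU : Matrix (Fin n) (Fin r) ℝ}
    {V₀ dV : Matrix (Fin q) (Fin r) ℝ} (h0 : matGrad f (U₀ * V₀ᵀ) = 0)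
    (Q₀ Q₁ : Matrix (Fin n) (Fin q) ℝ) :
    ∃ s ∈ Set.Ioo (0 : ℝ) 1, ip (pathScore f U₀ dU V₀ dV 1) (Q₀ + Q₁) =
      hessForm f ((U₀ + s • dU) * (V₀ + s • dV)ᵀ)
          ((nz U₀ + s • nz dU) * (nz dV)ᵀ + nz dU * (nz V₀ + s • nz dV)ᵀ) (Q₀ + s • Q₁) +
        ip (pathScore f U₀ dU V₀ dV s) Q₁ := by
  obtain ⟨s, hs, h⟩ := exists_ip_score_eq hf (dU := dU) (dV := dV) h0 Q₀ Q₁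
  refine ⟨s, hs, ?_⟩
  rw [← nz_smul, ← nz_smul, ← nz_add, ← nz_add, nz_mul_nz_transpose, nz_mul_nz_transpose,
    ← smul_add, map_smul, LinearMap.smul_apply, smul_eq_mul, pathScore, pathScore, ip_smul_left,
    ip_smul_left, one_smul, one_smul, h]
  ring

/-- The normalizing scalars are absorbed into the arbitrary blocks `R` and `L`, so restricted
isometry carries over with the same constants. -/
theorem hessForm_normalized_bounds (hRIP : LocalRIP f D α β) {W : Matrix (Fin n) (Fin r) ℝ}
    {Z : Matrix (Fin q) (Fin r) ℝ} (hmem : (W, Z) ∈ D) (L : Matrix (Fin n) (Fin r) ℝ)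
    (R : Matrix (Fin q) (Fin r) ℝ) :
    α * ‖nz W * Rᵀ + L * (nz Z)ᵀ‖ ^ 2 ≤
        hessForm f (W * Zᵀ) (nz W * Rᵀ + L * (nz Z)ᵀ) (nz W * Rᵀ + L * (nz Z)ᵀ) ∧
      hessForm f (W * Zᵀ) (nz W * Rᵀ + L * (nz Z)ᵀ) (nz W * Rᵀ + L * (nz Z)ᵀ) ≤
        β * ‖nz W * Rᵀ + L * (nz Z)ᵀ‖ ^ 2 := by
  have h1 : nz W * Rᵀ + L * (nz Z)ᵀ =
      tangent W Z ((√(n : ℝ))⁻¹ • R) ((√(q : ℝ))⁻¹ • L) := by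
    simp only [tangent, nz, Matrix.transpose_smul, Matrix.smul_mul, Matrix.mul_smul]
  rw [h1]
  exact hRIP W Z hmem _ _

/-- The score vanishes at the truth, so its operator norm is at most `L₂` times the distance
travelled by the product. In normalized units that distance is at most `(c + 1.04c)d`. -/
theorem abs_ip_pathScore_le (hLip : ScoreLipOp f D L₂) {U₀ dU : Matrix (Fin n) (Fin r) ℝ}
    {V₀ dV : Matrix (Fin q) (Fin r) ℝ} (h0 : matGrad f (U₀ * V₀ᵀ) = 0) (hmem0 : (U₀, V₀) ∈ D)
    {s : ℝ} (hmem : (U₀ + s • dU, V₀ + s • dV) ∈ D) (hs0 : 0 ≤ s) (hs1 : s ≤ 1) (hL₂ : 0 ≤ L₂)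
    (hU₀ : UB (nz U₀) c) (hV₀ : UB (nz V₀ + s • nz dV) (1.04 * c)) (hc : 0 ≤ c)
    (hdU : ‖nz dU‖ ≤ d) (hdV : ‖nz dV‖ ≤ d)
    (X : Matrix (Fin n) (Fin r) ℝ) (Y : Matrix (Fin q) (Fin r) ℝ) :
    |ip (pathScore f U₀ dU V₀ dV s) (X * Yᵀ)| ≤ 2.04 * L₂ * c * d * ‖X‖ * ‖Y‖ := by
  set ν := (√(n : ℝ))⁻¹ * (√(q : ℝ))⁻¹ with hν
  have hν0 : 0 ≤ ν := by positivity
  set W := U₀ + s • dU with hW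
  set Z := V₀ + s • dV with hZ
  have h1 := hLip W Z U₀ V₀ hmem hmem0
  rw [score, score, h0, sub_zero] at h1
  have h2 : ν * ‖W * Zᵀ - U₀ * V₀ᵀ‖ ≤ 2.04 * c * d := by
    have e1 : ν * ‖W * Zᵀ - U₀ * V₀ᵀ‖ = ‖nz W * (nz Z)ᵀ - nz U₀ * (nz V₀)ᵀ‖ := by
      rw [nz_mul_nz_transpose, nz_mul_nz_transpose, ← smul_sub, norm_smul,
        Real.norm_of_nonneg hν0]
    have e2 : nz W * (nz Z)ᵀ - nz U₀ * (nz V₀)ᵀ =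
        s • (nz U₀ * (nz dV)ᵀ + nz dU * (nz V₀ + s • nz dV)ᵀ) := by
      rw [hW, hZ, nz_add, nz_add, nz_smul, nz_smul]
      simp only [Matrix.transpose_add, Matrix.add_mul, Matrix.mul_add, Matrix.transpose_smul,
        Matrix.smul_mul, Matrix.mul_smul]
      module
    rw [e1, e2, norm_smul, Real.norm_of_nonneg hs0]
    have h3 := hU₀.norm_mul_le hc (nz dV)ᵀ
    rw [Matrix.frobenius_norm_transpose] at h3
    have h4 := hV₀.norm_mul_transpose_le (by positivity) (nz dU)
    have h5 := norm_add_le (nz U₀ * (nz dV)ᵀ) (nz dU * (nz V₀ + s • nz dV)ᵀ)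
    have h6 := norm_nonneg (nz U₀ * (nz dV)ᵀ + nz dU * (nz V₀ + s • nz dV)ᵀ)
    have h7 := mul_le_mul_of_nonneg_left hdU hc
    have h8 := mul_le_mul_of_nonneg_left hdV hc
    nlinarith
  rw [pathScore, ip_smul_left, abs_mul, abs_of_nonneg hν0]
  have h3 := abs_ip_mul_transpose_le (UB_opNorm (matGrad f (W * Zᵀ))) (opNorm_nonneg _) X Y
  have h4 : ν * opNorm (matGrad f (W * Zᵀ)) ≤ 2.04 * L₂ * c * d := by
    have h5 := mul_le_mul_of_nonneg_left h1 hν0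
    have h6 := mul_le_mul_of_nonneg_left h2 hL₂
    linarith
  have h5 := mul_le_mul_of_nonneg_left h3 hν0
  have h6 := mul_le_mul_of_nonneg_right h4 (mul_nonneg (norm_nonneg X) (norm_nonneg Y))
  linarith

theorem matGrad_aligned (U : Matrix (Fin n) (Fin r) ℝ) (V : Matrix (Fin q) (Fin r) ℝ)
    (G : GL (Fin r) ℝ) :
    (Us + errU U Us G) * (Vs + errV V Vs G)ᵀ = U * Vᵀ := by
  rw [errU, errV, add_sub_cancel, add_sub_cancel, Matrix.transpose_mul, Matrix.transpose_transpose,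
    Matrix.mul_assoc, ← Matrix.mul_assoc _ _ Vᵀ, GL_mul_inv, Matrix.one_mul]

theorem sq_le_of_le_mul {x y : ℝ} (hx : 0 ≤ x) (h : x ≤ 1.02 * y) : x ^ 2 ≤ 1.1 * y ^ 2 := by
  have h1 := pow_le_pow_left₀ hx h 2
  rw [mul_pow] at h1
  linarith [sq_nonneg y]

theorem UB.add_smul {p : ℕ} {X Δ : Matrix (Fin p) (Fin r) ℝ} {s : ℝ} (hX : UB X c)
    (hΔ : ‖Δ‖ ≤ d) (hdc : d ≤ c / 100) (hs0 : 0 ≤ s) (hs1 : s ≤ 1) :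
    UB (X + s • Δ) (1.04 * c) := by
  refine (hX.add ((UB_norm Δ).smul s)).mono ?_
  rw [abs_of_nonneg hs0]
  have h1 := mul_le_mul_of_nonneg_right hs1 (norm_nonneg Δ)
  linarith [norm_nonneg Δ]

set_option maxHeartbeats 1000000 in
/-- A gradient step contracts the error with respect to a fixed optimal alignment and controls the
change of the imbalance. -/
theorem pairNorm2_step (h : NoiselessBalanced f Us Vs) (hα : 0 < α) (hαβ : α ≤ β) (hL₂ : 0 ≤ L₂)
    (hRIP : LocalRIP f D α β) (hLip : ScoreLipOp f D L₂) (hopt : IsOptAlign U V Us Vs G)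
    (hd : pairNorm2 (errU U Us G) (errV V Vs G) = d) (hmem0 : (Us, Vs) ∈ D)
    (hmem : ∀ s ∈ Set.Ioo (0 : ℝ) 1, (Us + s • errU U Us G, Vs + s • errV V Vs G) ∈ D)
    (hU' : U' = U - ((q : ℝ)⁻¹ * η) • (matGrad f (U * Vᵀ) * V))
    (hV' : V' = V - ((n : ℝ)⁻¹ * η) • ((matGrad f (U * Vᵀ))ᵀ * U))
    (ha : a = √(sigmaMin Us Vs)) (hc : c = √(kappa Us Vs * sigmaMin Us Vs))
    (hη : 0 < η) (hηc : η * (β * c ^ 2) ≤ 1 / 10) (hda : d ≤ a / 100)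
    (hK : UB ((G : Matrix (Fin r) (Fin r) ℝ)ᵀ * (G : Matrix (Fin r) (Fin r) ℝ) - 1) k)
    (hk0 : 0 ≤ k) (hk : k ≤ 1 / 50) (hk2 : k ^ 2 ≤ η * (α * a ^ 2) / 20)
    (hM : 2.04 * L₂ * c * d ≤ α * a ^ 2 / 20) :
    pairNorm2 (errU U' Us G) (errV V' Vs G) ^ 2 ≤ (1 - η * (α * a ^ 2) / 2) * d ^ 2 ∧
      imbalance U' V' ≤ imbalance U V +
        1.1 * (d ^ 2 - pairNorm2 (errU U' Us G) (errV V' Vs G) ^ 2) := by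
  have hsm := h.sigmaMin_pos
  have hκ := h.one_le_kappa
  have ha0 : 0 < a := by rw [ha]; exact Real.sqrt_pos.2 hsm
  have hac : a ≤ c := by rw [ha, hc]; exact Real.sqrt_le_sqrt (by nlinarith)
  have hc0 : 0 < c := ha0.trans_le hac
  have hd0 : 0 ≤ d := by rw [← hd]; exact pairNorm2_nonneg _ _
  set ΔA := nz (errU U Us G) with hΔA
  set ΔB := nz (errV V Vs G) with hΔB
  have hΔAd : ‖ΔA‖ ≤ d := (norm_nz_le_left _ _).trans hd.le
  have hΔBd : ‖ΔB‖ ≤ d := (norm_nz_le_right _ _).trans hd.le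
  obtain ⟨hLA, hUA⟩ := h.bounds_left
  obtain ⟨hLB, hUB⟩ := h.bounds_right
  rw [← ha] at hLA hLB
  rw [← hc] at hUA hUB
  have hdc : d ≤ c / 100 := by linarith
  have hθ : 0 ≤ η * (α * a ^ 2) := by positivity
  have hkk : (1.1 * k) ^ 2 ≤ η * (α * a ^ 2) / 16 := by
    rw [mul_pow]
    linarith
  have hcc : 0 ≤ c ^ 2 := sq_nonneg c
  have hA1 : nz Us + ΔA = nz U * (G : Matrix (Fin r) (Fin r) ℝ) := (nz_errU G).symm
  have hB1 : nz Vs + ΔB = nz V * ((G⁻¹ : GL (Fin r) ℝ) : Matrix (Fin r) (Fin r) ℝ)ᵀ :=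
    (nz_errV G).symm
  have hd2 : ‖ΔA‖ ^ 2 + ‖ΔB‖ ^ 2 = d ^ 2 := by rw [← hd, pairNorm2_sq]
  have hfoc : (nz Us + ΔA)ᵀ * ΔA = ΔBᵀ * (nz Vs + ΔB) := by
    rw [hA1, hB1]; exact hopt.first_order
  set K := (G : Matrix (Fin r) (Fin r) ℝ)ᵀ * (G : Matrix (Fin r) (Fin r) ℝ) with hKdef
  set K' := ((G⁻¹ : GL (Fin r) ℝ) : Matrix (Fin r) (Fin r) ℝ) *
    ((G⁻¹ : GL (Fin r) ℝ) : Matrix (Fin r) (Fin r) ℝ)ᵀ with hK'def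
  have hKK' : K * K' = 1 := by
    rw [hKdef, hK'def, Matrix.mul_assoc, ← Matrix.mul_assoc (G : Matrix (Fin r) (Fin r) ℝ),
      GL_mul_inv, Matrix.one_mul, ← Matrix.transpose_mul, GL_inv_mul, Matrix.transpose_one]
  have hKt : (K - 1)ᵀ = K - 1 := by simp [hKdef]
  have hKt' : (K' - 1)ᵀ = K' - 1 := by simp [hK'def]
  have hK' : UB (K' - 1) (1.1 * k) := UB_inv_sub_one hK hKK' hk0 hk
  have key := frobenius_step (A₀ := nz Us) (ΔA := ΔA) (B₀ := nz Vs) (ΔB := ΔB)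
    (g := pathScore f Us (errU U Us G) Vs (errV V Vs G))
    (H := fun s => hessForm f ((Us + s • errU U Us G) * (Vs + s • errV V Vs G)ᵀ))
    (K := K) (K' := K') (a := a) (c := c) (c' := 1.04 * c) (d := d) (α := α) (β := β) (η := η)
    (k := 1.1 * k) (M := 2.04 * L₂ * c * d)
    (fun s => hessForm_symm h.smooth _)
    (fun Q₀ Q₁ => exists_ip_pathScore_eq h.smooth h.stationary Q₀ Q₁)
    (fun s hs L R => by
      rw [hΔA, hΔB, ← nz_smul, ← nz_smul, ← nz_add, ← nz_add]
      exact hessForm_normalized_bounds hRIP (hmem s hs) L R)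
    (fun s hs X Y => abs_ip_pathScore_le hLip h.stationary hmem0 (hmem s hs) hs.1.le hs.2.le hL₂
      hUA (hUB.add_smul hΔBd hdc hs.1.le hs.2.le) hc0.le hΔAd hΔBd X Y)
    (fun s hs => hUA.add_smul hΔAd hdc hs.1.le hs.2.le) (fun s hs => hUB.add_smul hΔBd hdc hs.1.le hs.2.le)
    (fun s hs => tangent_lower_bound ha0 hLA hLB hd0 hd2 (by linarith) hfoc hs.1.le hs.2.le)
    (fun X => by
      have h1 := (hK.mono (by linarith : k ≤ 1.1 * k)).norm_mul_transpose_le (by linarith) X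
      rwa [hKt, Matrix.mul_sub, Matrix.mul_one] at h1)
    (fun X => by
      have h1 := hK'.norm_mul_transpose_le (by linarith) X
      rwa [hKt', Matrix.mul_sub, Matrix.mul_one] at h1)
    hd2 hη hα hαβ ha0 hac hηc (by linarith) (by nlinarith [sq_nonneg c]) (by positivity) hM
    (by linarith) (by nlinarith [mul_pos hη (mul_pos hα (pow_pos ha0 2))])
  set g := pathScore f Us (errU U Us G) Vs (errV V Vs G) 1 with hg
  have hgeq : g = ((√(n : ℝ))⁻¹ * (√(q : ℝ))⁻¹) • matGrad f (U * Vᵀ) := by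
    rw [hg, pathScore, one_smul, one_smul, matGrad_aligned]
  have hnU : nz U' = nz U - η • (g * nz V) := by
    rw [hU', nz_sub, nz_smul, hgeq, nz, nz, nz, Matrix.smul_mul, Matrix.mul_smul, smul_smul,
      smul_smul, smul_smul]
    have hq : (q : ℝ)⁻¹ = (√(q : ℝ))⁻¹ * (√(q : ℝ))⁻¹ := by
      rw [← mul_inv, Real.mul_self_sqrt h.q_pos.le]
    rw [hq]
    congr 2
    ring
  have hnV : nz V' = nz V - η • (gᵀ * nz U) := by
    rw [hV', nz_sub, nz_smul, hgeq, nz, nz, nz, Matrix.transpose_smul, Matrix.smul_mul,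
      Matrix.mul_smul, smul_smul, smul_smul, smul_smul]
    have hn : (n : ℝ)⁻¹ = (√(n : ℝ))⁻¹ * (√(n : ℝ))⁻¹ := by
      rw [← mul_inv, Real.mul_self_sqrt h.n_pos.le]
    rw [hn]
    congr 2
    ring
  -- The unaligned gradient is the aligned one times `Gᵀ`. Aligning the update multiplies by `G`
  -- once more, which is how the distortion `K = GᵀG` enters; `K'` arises in the same way from
  -- `G⁻¹`.
  have hgB : g * (nz Vs + ΔB) * (G : Matrix (Fin r) (Fin r) ℝ)ᵀ = g * nz V := by
    rw [hB1, Matrix.mul_assoc, Matrix.mul_assoc (nz V), ← Matrix.transpose_mul, GL_mul_inv,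
      Matrix.transpose_one, Matrix.mul_one]
  have hgA : gᵀ * (nz Us + ΔA) * ((G⁻¹ : GL (Fin r) ℝ) : Matrix (Fin r) (Fin r) ℝ) =
      gᵀ * nz U := by
    rw [hA1, Matrix.mul_assoc, Matrix.mul_assoc (nz U), GL_mul_inv, Matrix.mul_one]
  have heU : nz (errU U' Us G) = ΔA - η • (g * (nz Vs + ΔB) * K) := by
    have e1 : nz (errU U' Us G) = nz U' * (G : Matrix (Fin r) (Fin r) ℝ) - nz Us := by
      rw [errU, nz_sub, nz_mul]
    have e2 : ΔA = nz U * (G : Matrix (Fin r) (Fin r) ℝ) - nz Us := by rw [← hA1, add_sub_cancel_left]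
    rw [e1, e2, hnU, hKdef, ← Matrix.mul_assoc, hgB, Matrix.sub_mul, Matrix.smul_mul]
    abel
  have heV : nz (errV V' Vs G) = ΔB - η • (gᵀ * (nz Us + ΔA) * K') := by
    have e1 : nz (errV V' Vs G) =
        nz V' * ((G⁻¹ : GL (Fin r) ℝ) : Matrix (Fin r) (Fin r) ℝ)ᵀ - nz Vs := by
      rw [errV, nz_sub, nz_mul]
    have e2 : ΔB = nz V * ((G⁻¹ : GL (Fin r) ℝ) : Matrix (Fin r) (Fin r) ℝ)ᵀ - nz Vs := by
      rw [← hB1, add_sub_cancel_left]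
    rw [e1, e2, hnV, hK'def, ← Matrix.mul_assoc, hgA, Matrix.sub_mul, Matrix.smul_mul]
    abel
  rw [← heU, ← heV, ← pairNorm2_sq] at key
  set N := ‖g * (nz Vs + ΔB)‖ ^ 2 + ‖gᵀ * (nz Us + ΔA)‖ ^ 2 with hN
  have hN0 : 0 ≤ η ^ 2 * N := by positivity
  refine ⟨by linarith, ?_⟩
  obtain ⟨hG1, hG2⟩ := UB_of_gram hK hk
  have n1 : ‖g * nz V‖ ^ 2 ≤ 1.1 * ‖g * (nz Vs + ΔB)‖ ^ 2 := by
    rw [← hgB]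
    have h1 := hG1.norm_mul_transpose_le (by norm_num) (g * (nz Vs + ΔB))
    exact sq_le_of_le_mul (norm_nonneg _) h1
  have n2 : ‖gᵀ * nz U‖ ^ 2 ≤ 1.1 * ‖gᵀ * (nz Us + ΔA)‖ ^ 2 := by
    rw [← hgA]
    have h1 := (hG2.transpose (by norm_num)).norm_mul_transpose_le (by norm_num)
      (gᵀ * (nz Us + ΔA))
    rw [Matrix.transpose_transpose] at h1
    exact sq_le_of_le_mul (norm_nonneg _) h1
  -- The imbalance is taken in the original coordinates, where the step is undistorted.
  -- Near-orthogonality of `G` transfers the squared gradient with a factor `1.1`, and `key` bounds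
  -- it by the decrease of `d²`.
  have h1 := imbalance_step (nz U) (nz V) g η
  rw [← hnU, ← hnV] at h1
  have h2 : η ^ 2 * (‖g * nz V‖ ^ 2 + ‖gᵀ * nz U‖ ^ 2) ≤ η ^ 2 * (1.1 * N) :=
    mul_le_mul_of_nonneg_left (by linarith) (sq_nonneg _)
  have h3 : (1 - η * (α * a ^ 2) / 2) * d ^ 2 ≤ d ^ 2 := by
    have := mul_nonneg hθ (sq_nonneg d)
    linarith
  unfold imbalance
  linarith

end Iteration

/-! ### One iteration of gradient descent, row by row -/

section RowIteration

variable {n q r : ℕ}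

theorem rowNorm_mul_le {m k l : ℕ} {X : Matrix (Fin m) (Fin k) ℝ} {T : Matrix (Fin k) (Fin l) ℝ}
    {t w : ℝ} (hT : UB T t) (ht : 0 ≤ t) (hX : rowNorm X ≤ w) : rowNorm (X * T) ≤ t * w := by
  refine rowNorm_le (mul_nonneg ht ((rowNorm_nonneg X).trans hX)) fun i => ?_
  have h1 := mul_transpose_row X Tᵀ i
  rw [Matrix.transpose_transpose] at h1
  rw [h1]
  exact (hT.transpose ht (X i)).trans
    (mul_le_mul_of_nonneg_left ((vecNorm_row_le_rowNorm X i).trans hX) ht)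

theorem rowNorm_add_le {m k : ℕ} {X Y : Matrix (Fin m) (Fin k) ℝ} {x y : ℝ} (hX : rowNorm X ≤ x)
    (hY : rowNorm Y ≤ y) : rowNorm (X + Y) ≤ x + y :=
  rowNorm_le (add_nonneg ((rowNorm_nonneg X).trans hX) ((rowNorm_nonneg Y).trans hY)) fun i =>
    (vecNorm_add_le (X i) (Y i)).trans (add_le_add ((vecNorm_row_le_rowNorm X i).trans hX)
      ((vecNorm_row_le_rowNorm Y i).trans hY))

theorem rowNorm_smul_le {m k : ℕ} {X : Matrix (Fin m) (Fin k) ℝ} {x s : ℝ} (hX : rowNorm X ≤ x)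
    (hs0 : 0 ≤ s) (hs1 : s ≤ 1) : rowNorm (s • X) ≤ x :=
  rowNorm_le ((rowNorm_nonneg X).trans hX) fun i => by
    have h1 : vecNorm ((s • X) i) = |s| * vecNorm (X i) := vecNorm_smul s (X i)
    have h2 := vecNorm_row_le_rowNorm X i
    have h3 := mul_le_mul_of_nonneg_right hs1 (vecNorm_nonneg (X i))
    rw [h1, abs_of_nonneg hs0]
    linarith

theorem rowNorm_sub_le {m k : ℕ} {X Y : Matrix (Fin m) (Fin k) ℝ} {x y : ℝ} (hX : rowNorm X ≤ x)
    (hY : rowNorm Y ≤ y) : rowNorm (X - Y) ≤ x + y :=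
  rowNorm_le (add_nonneg ((rowNorm_nonneg X).trans hX) ((rowNorm_nonneg Y).trans hY)) fun i =>
    (vecNorm_sub_le (X i) (Y i)).trans (add_le_add ((vecNorm_row_le_rowNorm X i).trans hX)
      ((vecNorm_row_le_rowNorm Y i).trans hY))

theorem eq_sqrt_smul_nz {p : ℕ} (hp : (0 : ℝ) < p) (X : Matrix (Fin p) (Fin r) ℝ) :
    X = √(p : ℝ) • nz X := by
  rw [nz, smul_smul, mul_inv_cancel₀ (Real.sqrt_pos.2 hp).ne', one_smul]

/-- Bounds on a perturbed factor after a nearly orthogonal change of basis. -/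
theorem perturbed_factor_bounds {p : ℕ} (hp : (0 : ℝ) < p) {X Δ : Matrix (Fin p) (Fin r) ℝ}
    {T T' : Matrix (Fin r) (Fin r) ℝ} {a c d s : ℝ} (hX : LB (nz X) a) (hX' : UB (nz X) c)
    (hΔ : ‖nz Δ‖ ≤ d) (ha : 0 < a) (hac : a ≤ c) (hda : d ≤ a / 100) (hT : UB T 1.02)
    (hT' : UB T' 1.02) (hTT' : T' * T = 1) (hs0 : 0 ≤ s) (hs1 : s ≤ 1) :
    LB (X * T + s • (Δ * T)) (√(p : ℝ) * (0.97 * a)) ∧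
      UB (X * T + s • (Δ * T)) (√(p : ℝ) * (1.05 * c)) ∧ ‖Δ * T‖ ≤ √(p : ℝ) * (1.02 * d) := by
  have hs : 0 < √(p : ℝ) := Real.sqrt_pos.2 hp
  have e1 : X * T + s • (Δ * T) = √(p : ℝ) • ((nz X + s • nz Δ) * T) := by
    rw [← nz_smul, ← nz_add, ← nz_mul, ← eq_sqrt_smul_nz hp, Matrix.add_mul, Matrix.smul_mul]
  have hsΔ : UB (s • nz Δ) d := ((UB_norm (nz Δ)).smul s).mono (by
    rw [abs_of_nonneg hs0]
    have := mul_le_mul_of_nonneg_right hs1 (norm_nonneg (nz Δ))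
    linarith)
  refine ⟨?_, ?_, ?_⟩
  -- `0.97 ≤ 0.99 / 1.02` for the lower bound; below, `1.01 * 1.02 ≤ 1.05` for the upper one.
  · have h1 := ((hX.add hsΔ).mul (LB.of_mul_eq_one (by norm_num) hTT' hT')
      (by linarith)).smul √(p : ℝ)
    rw [← e1, abs_of_pos hs] at h1
    refine h1.mono (mul_le_mul_of_nonneg_left ?_ hs.le)
    rw [← div_eq_mul_inv, le_div_iff₀ (by norm_num)]
    linarith
  · have h1 := ((hX'.add hsΔ).mul hT (by linarith [(norm_nonneg _).trans hΔ])).smul √(p : ℝ)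
    rw [← e1, abs_of_pos hs] at h1
    refine h1.mono (mul_le_mul_of_nonneg_left ?_ hs.le)
    linarith
  · have h1 := (hT.transpose (by norm_num)).norm_mul_transpose_le (by norm_num) Δ
    rw [Matrix.transpose_transpose] at h1
    rw [norm_nz, inv_mul_le_iff₀ hs] at hΔ
    linarith

/-- Telescoping: the product changes by `s dX Y_sᵀ + s X dYᵀ`. This is the displacement that enters
the row Lipschitz condition of the score. -/
theorem rowNorm_product_sub_le {X dX : Matrix (Fin n) (Fin r) ℝ} {Y dY : Matrix (Fin q) (Fin r) ℝ}
    {w e u δ s : ℝ} (hX : rowNorm X ≤ w) (hdX : rowNorm dX ≤ e) (hY : UB (Y + s • dY) u)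
    (hu : 0 ≤ u) (hdY : ‖dY‖ ≤ δ) (hs0 : 0 ≤ s) (hs1 : s ≤ 1) :
    rowNorm ((X + s • dX) * (Y + s • dY)ᵀ - X * Yᵀ) ≤ u * e + δ * w := by
  have e1 : (X + s • dX) * (Y + s • dY)ᵀ - X * Yᵀ =
      s • (dX * (Y + s • dY)ᵀ) + s • (X * dYᵀ) := by
    simp only [Matrix.transpose_add, Matrix.add_mul, Matrix.mul_add, Matrix.transpose_smul,
      Matrix.smul_mul, Matrix.mul_smul]
    module
  rw [e1]
  have hδ := (norm_nonneg _).trans hdY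
  exact rowNorm_add_le (rowNorm_smul_le (rowNorm_mul_le (hY.transpose hu) hu hdX) hs0 hs1)
    (rowNorm_smul_le (rowNorm_mul_le (((UB_norm dY).mono hdY).transpose hδ) hδ hX) hs0 hs1)

/-- The `√p` coming from unnormalized factors cancels against `p⁻¹` in the step. The margin between
`0.97² = 0.9409` and `0.8` is discarded. -/
theorem row_step_bound {p η α β a c d e ω x Λ : ℝ} (hp : 0 < p) (hη : 0 ≤ η) (hα : 0 ≤ α)
    (hβ : 0 ≤ β) (hc : 0 ≤ c) (hd : 0 ≤ d) (he : 0 ≤ e) (hω : 0 ≤ ω) (hΛ : 0 ≤ Λ)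
    (hθ : η * (α * a ^ 2) ≤ 1) (hx0 : 0 ≤ x) (hx : x ≤ e) :
    (1 - p⁻¹ * η * (α * (√p * (0.97 * a)) ^ 2)) * x +
        p⁻¹ * η * (β * (√p * (1.05 * c)) * ((1.02 * ω + e) * (√p * (1.02 * d))) +
          Λ * (√p * (1.05 * c) * e + √p * (1.02 * d) * (1.02 * ω)) * (√p * (1.02 * d))) ≤
      (1 - 0.8 * (η * (α * a ^ 2))) * e +
        1.1 * (η * d) * (β * c * (1.02 * ω + e) + Λ * (c * e + d * ω)) := by
  have hs : √p * √p = p := Real.mul_self_sqrt hp.le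
  have e1 : p⁻¹ * η * (α * (√p * (0.97 * a)) ^ 2) = 0.9409 * (η * (α * a ^ 2)) := by
    have : p⁻¹ * η * (α * (√p * (0.97 * a)) ^ 2) =
      p⁻¹ * (√p * √p) * (0.9409 * (η * (α * a ^ 2))) := by ring
    rw [this, hs, inv_mul_cancel₀ hp.ne', one_mul]
  have e2 : p⁻¹ * η * (β * (√p * (1.05 * c)) * ((1.02 * ω + e) * (√p * (1.02 * d))) +
        Λ * (√p * (1.05 * c) * e + √p * (1.02 * d) * (1.02 * ω)) * (√p * (1.02 * d))) =
      (η * d) * (1.071 * (β * c * (1.02 * ω + e)) + Λ * (1.071 * (c * e) + 1.061208 * (d * ω))) := by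
    have : p⁻¹ * η * (β * (√p * (1.05 * c)) * ((1.02 * ω + e) * (√p * (1.02 * d))) +
        Λ * (√p * (1.05 * c) * e + √p * (1.02 * d) * (1.02 * ω)) * (√p * (1.02 * d))) =
      p⁻¹ * (√p * √p) * ((η * d) * (1.071 * (β * c * (1.02 * ω + e)) +
        Λ * (1.071 * (c * e) + 1.061208 * (d * ω)))) := by ring
    rw [this, hs, inv_mul_cancel₀ hp.ne', one_mul]
  have hθ0 : 0 ≤ η * (α * a ^ 2) := by positivity
  have h1 : 0 ≤ η * d * (β * c * (1.02 * ω + e)) := by positivity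
  have h2 : 0 ≤ η * d * (Λ * (c * e)) := by positivity
  have h3 : 0 ≤ η * d * (Λ * (d * ω)) := by positivity
  have h4 : (1 - 0.9409 * (η * (α * a ^ 2))) * x ≤ (1 - 0.8 * (η * (α * a ^ 2))) * e :=
    mul_le_mul (by linarith) hx hx0 (by linarith)
  rw [e1, e2]
  linarith

variable {f : Matrix (Fin n) (Fin q) ℝ → ℝ} {Us : Matrix (Fin n) (Fin r) ℝ}
  {Vs : Matrix (Fin q) (Fin r) ℝ} {U U' : Matrix (Fin n) (Fin r) ℝ}
  {V V' : Matrix (Fin q) (Fin r) ℝ}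
  {D : Set (Matrix (Fin n) (Fin r) ℝ × Matrix (Fin q) (Fin r) ℝ)}
  {G G' : GL (Fin r) ℝ} {α β Linf a c d e η : ℝ}

/-- `U - U* G⁻¹`. -/
noncomputable def resU (U Us : Matrix (Fin n) (Fin r) ℝ) (G : GL (Fin r) ℝ) :
    Matrix (Fin n) (Fin r) ℝ :=
  U - Us * ((G⁻¹ : GL (Fin r) ℝ) : Matrix (Fin r) (Fin r) ℝ)

/-- `V - V* Gᵀ`. -/
noncomputable def resV (V Vs : Matrix (Fin q) (Fin r) ℝ) (G : GL (Fin r) ℝ) :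
    Matrix (Fin q) (Fin r) ℝ :=
  V - Vs * (G : Matrix (Fin r) (Fin r) ℝ)ᵀ

theorem errU_mul_inv :
    errU U Us G * ((G⁻¹ : GL (Fin r) ℝ) : Matrix (Fin r) (Fin r) ℝ) = resU U Us G := by
  rw [errU, resU, Matrix.sub_mul, Matrix.mul_assoc, GL_mul_inv, Matrix.mul_one]

theorem errV_mul_transpose : errV V Vs G * (G : Matrix (Fin r) (Fin r) ℝ)ᵀ = resV V Vs G := by
  rw [errV, resV, Matrix.sub_mul, Matrix.mul_assoc, ← Matrix.transpose_mul, GL_mul_inv,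
    Matrix.transpose_one, Matrix.mul_one]

theorem truth_transformed (G : GL (Fin r) ℝ) :
    Us * ((G⁻¹ : GL (Fin r) ℝ) : Matrix (Fin r) (Fin r) ℝ) *
      (Vs * (G : Matrix (Fin r) (Fin r) ℝ)ᵀ)ᵀ = Us * Vsᵀ := by
  rw [Matrix.transpose_mul, Matrix.transpose_transpose, Matrix.mul_assoc,
    ← Matrix.mul_assoc _ _ Vsᵀ, GL_inv_mul, Matrix.one_mul]

set_option maxHeartbeats 1000000 in
/-- A gradient step contracts the row errors with respect to a fixed alignment, up to terms
proportional to the error in Frobenius norm. -/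
theorem rowNorm_step (h : NoiselessBalanced f Us Vs) (hα : 0 < α) (hαβ : α ≤ β)
    (hRIP : LocalRIP f D α β) (hrow : RowCrossCurvature f D β) (hlip : ScoreLipRow f D Linf)
    (hmem0 : (Us * ((G⁻¹ : GL (Fin r) ℝ) : Matrix (Fin r) (Fin r) ℝ),
      Vs * (G : Matrix (Fin r) (Fin r) ℝ)ᵀ) ∈ D)
    (hmem : ∀ s ∈ Set.Ioo (0 : ℝ) 1,
      (Us * ((G⁻¹ : GL (Fin r) ℝ) : Matrix (Fin r) (Fin r) ℝ) + s • resU U Us G,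
        Vs * (G : Matrix (Fin r) (Fin r) ℝ)ᵀ + s • resV V Vs G) ∈ D)
    (hU' : U' = U - ((q : ℝ)⁻¹ * η) • (matGrad f (U * Vᵀ) * V))
    (hV' : V' = V - ((n : ℝ)⁻¹ * η) • ((matGrad f (U * Vᵀ))ᵀ * U))
    (ha : a = √(sigmaMin Us Vs)) (hc : c = √(kappa Us Vs * sigmaMin Us Vs))
    (hη : 0 < η) (hηc : η * (β * c ^ 2) ≤ 1 / 10) (hda : d ≤ a / 100)
    (hd : pairNorm2 (errU U Us G) (errV V Vs G) ≤ d)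
    (hG : UB (G : Matrix (Fin r) (Fin r) ℝ) 1.02)
    (hG' : UB ((G⁻¹ : GL (Fin r) ℝ) : Matrix (Fin r) (Fin r) ℝ) 1.02)
    (heU : rowNorm (resU U Us G) ≤ e) (heV : rowNorm (resV V Vs G) ≤ e) :
    max (rowNorm (resU U' Us G)) (rowNorm (resV V' Vs G)) ≤
      (1 - 0.8 * (η * (α * a ^ 2))) * e + 1.1 * (η * d) *
        (β * c * (1.02 * omegaStar Us Vs + e) + |Linf| * (c * e + d * omegaStar Us Vs)) := by
  have hsm := h.sigmaMin_pos
  have hκ := h.one_le_kappa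
  have hβ : 0 < β := hα.trans_le hαβ
  have ha0 : 0 < a := by rw [ha]; exact Real.sqrt_pos.2 hsm
  have hac : a ≤ c := by
    rw [ha, hc]
    exact Real.sqrt_le_sqrt (by linarith [mul_le_mul_of_nonneg_right hκ hsm.le])
  have hc0 : 0 < c := ha0.trans_le hac
  have hd0 : 0 ≤ d := (pairNorm2_nonneg _ _).trans hd
  have he0 : 0 ≤ e := (rowNorm_nonneg _).trans heU
  have hω := h.omegaStar_pos
  set ω := omegaStar Us Vs with hωdef
  set T := ((G⁻¹ : GL (Fin r) ℝ) : Matrix (Fin r) (Fin r) ℝ) with hT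
  set S := (G : Matrix (Fin r) (Fin r) ℝ)ᵀ with hS
  have hSu : UB S 1.02 := hG.transpose (by norm_num)
  have hSu' : UB Tᵀ 1.02 := hG'.transpose (by norm_num)
  have hSS : Tᵀ * S = 1 := by
    rw [hT, hS, ← Matrix.transpose_mul, GL_mul_inv, Matrix.transpose_one]
  have hTT : (G : Matrix (Fin r) (Fin r) ℝ) * T = 1 := GL_mul_inv G
  obtain ⟨hLA, hUA⟩ := h.bounds_left
  obtain ⟨hLB, hUB⟩ := h.bounds_right
  rw [← ha] at hLA hLB
  rw [← hc] at hUA hUB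
  have bU : ∀ s : ℝ, 0 ≤ s → s ≤ 1 → _ := fun s hs0 hs1 =>
    perturbed_factor_bounds h.n_pos hLA hUA ((norm_nz_le_left _ _).trans hd) ha0 hac hda hG' hG
      hTT hs0 hs1
  have bV : ∀ s : ℝ, 0 ≤ s → s ≤ 1 → _ := fun s hs0 hs1 =>
    perturbed_factor_bounds h.q_pos hLB hUB ((norm_nz_le_right _ _).trans hd) ha0 hac hda hSu hSu'
      hSS hs0 hs1
  simp only [hT, errU_mul_inv] at bU
  simp only [hS, errV_mul_transpose] at bV
  rw [← hT] at bU
  rw [← hS] at bV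
  have wU : rowNorm (Us * T) ≤ 1.02 * ω := rowNorm_mul_le hG' (by norm_num) (le_max_left _ _)
  have wV : rowNorm (Vs * S) ≤ 1.02 * ω := rowNorm_mul_le hSu (by norm_num) (le_max_right _ _)
  have hpU : Us * T + resU U Us G = U := by rw [resU, ← hT, add_sub_cancel]
  have hpV : Vs * S + resV V Vs G = V := by rw [resV, ← hS, add_sub_cancel]
  have h0 : matGrad f (Us * T * (Vs * S)ᵀ) = 0 := by
    rw [hT, hS, truth_transformed]; exact h.stationary
  have hcu : ∀ p : ℝ, 0 < p → p⁻¹ * η * (β * (√p * (1.05 * c)) ^ 2) ≤ 1 := fun p hp => by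
    have e1 : p⁻¹ * η * (β * (√p * (1.05 * c)) ^ 2) =
        p⁻¹ * (√p * √p) * (1.1025 * (η * (β * c ^ 2))) := by ring
    rw [e1, Real.mul_self_sqrt hp.le, inv_mul_cancel₀ hp.ne']
    linarith
  have hθ : η * (α * a ^ 2) ≤ 1 := by
    have h1 : η * (α * a ^ 2) ≤ η * (β * c ^ 2) := mul_le_mul_of_nonneg_left
      (mul_le_mul hαβ (pow_le_pow_left₀ ha0.le hac 2) (sq_nonneg a) hβ.le) hη.le
    linarith
  have hB0 : 0 ≤ (1 - 0.8 * (η * (α * a ^ 2))) * e + 1.1 * (η * d) *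
        (β * c * (1.02 * ω + e) + |Linf| * (c * e + d * ω)) := by
    have : 0 ≤ 1 - 0.8 * (η * (α * a ^ 2)) := by linarith
    positivity
  refine max_le (rowNorm_le hB0 fun i => ?_) (rowNorm_le hB0 fun j => ?_)
  · have h1 := vecNorm_row_step_left h.smooth h0 hα hαβ hRIP hrow hlip hmem0 hmem
      (l := √(q : ℝ) * (0.97 * a)) (u := √(q : ℝ) * (1.05 * c)) (c := (q : ℝ)⁻¹ * η)
      (by positivity) (mul_le_mul_of_nonneg_left (by linarith) (Real.sqrt_nonneg _))
      (by positivity) (hcu _ h.q_pos) (fun s hs => (bV s hs.1.le hs.2.le).1)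
      (fun s hs => (bV s hs.1.le hs.2.le).2.1)
      (fun s hs => rowNorm_add_le wU (rowNorm_smul_le heU hs.1.le hs.2.le))
      (bV 0 le_rfl zero_le_one).2.2
      (fun s hs => rowNorm_product_sub_le wU heU (bV s hs.1.le hs.2.le).2.1 (by positivity)
        (bV 0 le_rfl zero_le_one).2.2 hs.1.le hs.2.le) i
    have e1 : resU U' Us G = resU U Us G - ((q : ℝ)⁻¹ * η) • (matGrad f (U * Vᵀ) * V) := by
      rw [resU, resU, hU', sub_right_comm]
    rw [hpU, hpV, ← e1] at h1
    exact h1.trans (row_step_bound h.q_pos hη.le hα.le hβ.le hc0.le hd0 he0 hω.le (abs_nonneg _) hθ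
      (vecNorm_nonneg _) ((vecNorm_row_le_rowNorm _ i).trans heU))
  · have h1 := vecNorm_row_step_right h.smooth h0 hα hαβ hRIP hrow hlip hmem0 hmem
      (l := √(n : ℝ) * (0.97 * a)) (u := √(n : ℝ) * (1.05 * c)) (c := (n : ℝ)⁻¹ * η)
      (by positivity) (mul_le_mul_of_nonneg_left (by linarith) (Real.sqrt_nonneg _))
      (by positivity) (hcu _ h.n_pos) (fun s hs => (bU s hs.1.le hs.2.le).1)
      (fun s hs => (bU s hs.1.le hs.2.le).2.1)
      (fun s hs => rowNorm_add_le wV (rowNorm_smul_le heV hs.1.le hs.2.le))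
      (bU 0 le_rfl zero_le_one).2.2
      (fun s hs => rowNorm_product_sub_le wV heV (bU s hs.1.le hs.2.le).2.1 (by positivity)
        (bU 0 le_rfl zero_le_one).2.2 hs.1.le hs.2.le) j
    have e1 : resV V' Vs G = resV V Vs G - ((n : ℝ)⁻¹ * η) • ((matGrad f (U * Vᵀ))ᵀ * U) := by
      rw [resV, resV, hV', sub_right_comm]
    rw [hpU, hpV, ← e1] at h1
    exact h1.trans (row_step_bound h.n_pos hη.le hα.le hβ.le hc0.le hd0 he0 hω.le (abs_nonneg _) hθ
      (vecNorm_nonneg _) ((vecNorm_row_le_rowNorm _ j).trans heV))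

/-- The residuals with respect to two alignments with small errors are close, row by row. -/
theorem rowNorm_res_shift (h : NoiselessBalanced f Us Vs)
    (hd : pairNorm2 (errU U Us G) (errV V Vs G) ≤ d)
    (hd' : pairNorm2 (errU U Us G') (errV V Vs G') ≤ d) (hds : d ≤ √(sigmaMin Us Vs) / 20)
    (hG : UB (G : Matrix (Fin r) (Fin r) ℝ) 1.02)
    (hG' : UB ((G⁻¹ : GL (Fin r) ℝ) : Matrix (Fin r) (Fin r) ℝ) 1.02)
    (he : max (rowNorm (resU U Us G)) (rowNorm (resV V Vs G)) ≤ e) :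
    max (rowNorm (resU U Us G')) (rowNorm (resV V Vs G')) ≤
      e + 2.3 * (d / √(sigmaMin Us Vs)) * omegaStar Us Vs := by
  obtain ⟨h1, h2⟩ := align_close h hd hd' hds
  have hδ : 0 ≤ d / √(sigmaMin Us Vs) :=
    div_nonneg ((pairNorm2_nonneg _ _).trans hd) (Real.sqrt_nonneg _)
  set δ := d / √(sigmaMin Us Vs)
  have key : ∀ {p : ℕ} {X X' Y : Matrix (Fin p) (Fin r) ℝ} {E T : Matrix (Fin r) (Fin r) ℝ},
      X' = X - Y * (E * T) → ‖E‖ ≤ 2.2 * δ → UB T 1.02 → rowNorm X ≤ e →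
      rowNorm Y ≤ omegaStar Us Vs → rowNorm X' ≤ e + 2.3 * δ * omegaStar Us Vs :=
    fun {p X X' Y E T} hX' hE hT hX hY => by
      have hω := (rowNorm_nonneg Y).trans hY
      have h3 := rowNorm_mul_le (((UB_norm E).mono hE).mul hT (by positivity)) (by positivity) hY
      have h4 := rowNorm_sub_le hX h3
      rw [← hX'] at h4
      have := mul_nonneg hδ hω
      linarith
  refine max_le (key (Y := Us) (E := ((G'⁻¹ * G : GL (Fin r) ℝ) : Matrix (Fin r) (Fin r) ℝ) - 1)
    ?_ ?_ hG' ((le_max_left _ _).trans he) (le_max_left _ _))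
    (key (Y := Vs) (E := (((G⁻¹ * G' : GL (Fin r) ℝ) : Matrix (Fin r) (Fin r) ℝ) - 1)ᵀ)
    ?_ ?_ (hG.transpose (by norm_num)) ((le_max_right _ _).trans he) (le_max_right _ _))
  · rw [resU, resU, Matrix.sub_mul, Matrix.one_mul, Units.val_mul, Matrix.mul_assoc, GL_mul_inv,
      Matrix.mul_one, Matrix.mul_sub]
    abel
  · rwa [← Matrix.frobenius_norm_transpose, Matrix.transpose_sub, Matrix.transpose_one]
  · rw [resV, resV, ← Matrix.transpose_mul, Matrix.mul_sub, Matrix.mul_one, Units.val_mul,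
      ← Matrix.mul_assoc, GL_mul_inv, Matrix.one_mul, Matrix.transpose_sub, Matrix.mul_sub]
    abel
  · rwa [Matrix.frobenius_norm_transpose]

end RowIteration

/-! ### Consequences of the initialization -/

section Initialization

variable {n q r : ℕ} {f : Matrix (Fin n) (Fin q) ℝ → ℝ} {Us : Matrix (Fin n) (Fin r) ℝ}
  {Vs : Matrix (Fin q) (Fin r) ℝ} {U U' : Matrix (Fin n) (Fin r) ℝ}
  {V V' : Matrix (Fin q) (Fin r) ℝ}
  {D : Set (Matrix (Fin n) (Fin r) ℝ × Matrix (Fin q) (Fin r) ℝ)}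
  {G G' : GL (Fin r) ℝ} {α β L₂ Linf ε a c d e η : ℝ}

theorem errU_one : errU U Us 1 = U - Us := by
  rw [errU, Units.val_one, Matrix.mul_one]

theorem errV_one : errV V Vs 1 = V - Vs := by
  rw [errV, inv_one, Units.val_one, Matrix.transpose_one, Matrix.mul_one]

theorem exists_pos_mul_le {x y : ℝ} (hx : 0 < x) (hy : 0 ≤ y) :
    ∃ t₀ : ℝ, 0 < t₀ ∧ ∀ t : ℝ, 0 < t → t ≤ t₀ → t * y ≤ x :=
  ⟨x / (y + 1), by positivity, fun t ht htx => by
    rw [le_div_iff₀ (by positivity)] at htx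
    linarith⟩

/-- The region contains a short segment from the truth in any direction of the left factor, which is
the room needed to compare the curvature with the Lipschitz constant. -/
theorem exists_small_mem_regionInf (h : NoiselessBalanced f Us Vs) (hε : 0 < ε)
    (L : Matrix (Fin n) (Fin r) ℝ) :
    ∃ t₀ : ℝ, 0 < t₀ ∧ ∀ t : ℝ, 0 < t → t ≤ t₀ → (Us + t • L, Vs) ∈ regionInf Us Vs ε := by
  have hs : 0 < √(sigmaMin Us Vs) := Real.sqrt_pos.2 h.sigmaMin_pos
  have hτ := h.tauStar_pos
  have hω := h.omegaStar_pos
  set p := pairNorm2 L (0 : Matrix (Fin q) (Fin r) ℝ) with hp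
  have hp0 : 0 ≤ p := pairNorm2_nonneg _ _
  set m := rowNorm L with hm
  have hm0 : 0 ≤ m := rowNorm_nonneg _
  obtain ⟨t₁, ht₁, h1⟩ := exists_pos_mul_le (by positivity : 0 < √(sigmaMin Us Vs) / 20) hp0
  obtain ⟨t₂, ht₂, h2⟩ := exists_pos_mul_le (mul_pos hε hτ) hp0
  obtain ⟨t₃, ht₃, h3⟩ := exists_pos_mul_le (mul_pos hε hω)
    (by positivity : 0 ≤ m * 1.11 + 2.2 * (p / √(sigmaMin Us Vs)) * omegaStar Us Vs)
  refine ⟨min t₁ (min t₂ t₃), by positivity, fun t ht hle => ?_⟩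
  have k1 := h1 t ht (hle.trans (min_le_left _ _))
  have k2 := h2 t ht (hle.trans ((min_le_right _ _).trans (min_le_left _ _)))
  have k3 := h3 t ht (hle.trans ((min_le_right _ _).trans (min_le_right _ _)))
  have eU : errU (Us + t • L) Us 1 = t • L := by rw [errU_one, add_sub_cancel_left]
  have eV : errV Vs Vs 1 = t • (0 : Matrix (Fin q) (Fin r) ℝ) := by
    rw [errV_one, sub_self, smul_zero]
  refine mem_regionInf_of_le h (G := 1) (d := t * p) (e := t * m) ?_ k1 k2 ?_ ?_
  · rw [eU, eV, pairNorm2_smul ht.le]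
  · rw [eU, eV, pairNormInf, smul_zero]
    refine max_le (rowNorm_le (by positivity) fun i => ?_) (rowNorm_le (by positivity) fun i => ?_)
    · refine (vecNorm_smul t (L i)).le.trans ?_
      rw [abs_of_pos ht]
      exact mul_le_mul_of_nonneg_left (vecNorm_row_le_rowNorm L i) ht.le
    · refine vecNorm_zero.le.trans (by positivity)
  · have h4 : t * p / √(sigmaMin Us Vs) ≤ 1 / 20 := by
      rw [div_le_iff₀ hs]; linarith
    have h5 := mul_le_mul_of_nonneg_left h4 (mul_nonneg ht.le hm0)
    have h6 : t * p / √(sigmaMin Us Vs) = t * (p / √(sigmaMin Us Vs)) := mul_div_assoc _ _ _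
    rw [h6] at h5 ⊢
    linarith

theorem regionInf_subset : regionInf Us Vs ε ⊆ region2 Us Vs ε := fun _ h => h.1

/-- The lower curvature is at most the Lipschitz constant of the score. -/
theorem alpha_le_of_scoreLip (h : NoiselessBalanced f Us Vs) (hε : 0 < ε)
    (hD : regionInf Us Vs ε ⊆ D) (hmem0 : (Us, Vs) ∈ D) (hRIP : LocalRIP f D α β)
    (hLip : ScoreLipOp f D L₂) : α ≤ L₂ := by
  have hn : 0 < n := by exact_mod_cast h.n_pos
  have hr := h.one_le
  let i : Fin n := ⟨0, hn⟩
  let x : Fin r → ℝ := Pi.single ⟨0, hr⟩ 1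
  have hx : x ≠ 0 := fun h0 => by
    have := congrFun h0 ⟨0, hr⟩
    simp [x] at this
  have hv := vecNorm_pos (mulVec_ne_zero_of_rank h.rank_right hx)
  set v := Vs *ᵥ x with hvdef
  -- Perturbing one row of `U*` changes the product by a rank-one matrix, whose Frobenius and
  -- operator norms coincide. The pairing of the score with it is at least `αt|v|²` by curvature and
  -- at most `L₂t|v|²` by the Lipschitz condition.
  obtain ⟨t, ht, hmem⟩ := exists_small_mem_regionInf h hε (rowMatrix i x)
  obtain ⟨s, hs, hmv⟩ := exists_ip_score_eq h.smooth (dU := t • rowMatrix i x)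
    (dV := (0 : Matrix (Fin q) (Fin r) ℝ)) h.stationary (rowMatrix i v) 0
  simp only [smul_zero, add_zero, Matrix.transpose_zero, Matrix.mul_zero, zero_add, ip_zero_right,
    Matrix.smul_mul, rowMatrix_mul_transpose, smul_smul, map_smul, LinearMap.smul_apply,
    smul_eq_mul, Matrix.add_mul, ← hvdef] at hmv
  have hst : 0 < s * t := mul_pos hs.1 ht
  have hst' : s * t ≤ t := by
    have := mul_le_mul_of_nonneg_right hs.2.le ht.le
    linarith
  have h1 := (hRIP _ _ (hD (hmem _ hst hst')) (rowMatrix i x) 0).1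
  simp only [tangent, Matrix.transpose_zero, Matrix.mul_zero, zero_add, Matrix.add_mul,
    Matrix.smul_mul, rowMatrix_mul_transpose, ← hvdef, norm_rowMatrix] at h1
  have h2 := hLip _ _ _ _ (hD (hmem t ht le_rfl)) hmem0
  rw [score, score, h.stationary, sub_zero, Matrix.add_mul, add_sub_cancel_left, Matrix.smul_mul,
    rowMatrix_mul_transpose, norm_smul, norm_rowMatrix, Real.norm_of_nonneg ht.le, ← hvdef] at h2
  rw [ip_rowMatrix, hessForm_apply] at hmv
  set M := matGrad f (Us * Vsᵀ + t • rowMatrix i v) with hM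
  have h3 : M i ⬝ᵥ v ≤ opNorm M * vecNorm v :=
    (le_abs_self _).trans ((PiLp.norm_apply_le (WithLp.toLp 2 (M *ᵥ v)) i).trans (UB_opNorm M v))
  have h4 := mul_le_mul_of_nonneg_right h2 hv.le
  have h5 := mul_le_mul_of_nonneg_left h1 ht.le
  have h6 : 0 < t * vecNorm v ^ 2 := by positivity
  refine le_of_mul_le_mul_right ?_ h6
  rw [hmv] at h3
  linarith

/-- Initialization by an orthogonal alignment: the general linear group element. -/
noncomputable def ofOrthogonal {R : Matrix (Fin r) (Fin r) ℝ}
    (hR : R ∈ Matrix.orthogonalGroup (Fin r) ℝ) : GL (Fin r) ℝ where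
  val := R
  inv := Rᵀ
  val_inv := (Matrix.mem_orthogonalGroup_iff (Fin r) ℝ).1 hR
  inv_val := (Matrix.mem_orthogonalGroup_iff' (Fin r) ℝ).1 hR

variable {R : Matrix (Fin r) (Fin r) ℝ}

theorem errU_ofOrthogonal (hR : R ∈ Matrix.orthogonalGroup (Fin r) ℝ) :
    errU U Us (ofOrthogonal hR) = U * R - Us := rfl

theorem errV_ofOrthogonal (hR : R ∈ Matrix.orthogonalGroup (Fin r) ℝ) :
    errV V Vs (ofOrthogonal hR) = V * R - Vs := rfl

theorem UB_orthogonal (hR : R ∈ Matrix.orthogonalGroup (Fin r) ℝ) : UB R 1 := fun x => by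
  have h1 : Rᵀ * R = 1 := (Matrix.mem_orthogonalGroup_iff' (Fin r) ℝ).1 hR
  refine abs_le_of_sq_le_sq' ?_ (mul_nonneg zero_le_one (vecNorm_nonneg x)) |>.2
  rw [vecNorm_mulVec_sq, h1, Matrix.one_mulVec, one_mul, vecNorm_sq]

theorem norm_gram_add_sub_le {X Δ : Matrix (Fin n) (Fin r) ℝ} (hX : UB X c) (hc : 0 ≤ c) :
    ‖(X + Δ)ᵀ * (X + Δ) - Xᵀ * X‖ ≤ 2 * c * ‖Δ‖ + ‖Δ‖ ^ 2 := by
  have h1 : (X + Δ)ᵀ * (X + Δ) - Xᵀ * X = Xᵀ * Δ + (Xᵀ * Δ)ᵀ + Δᵀ * Δ := by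
    simp only [Matrix.transpose_add, Matrix.transpose_mul, Matrix.transpose_transpose,
      Matrix.add_mul, Matrix.mul_add]
    abel
  have h2 := (hX.transpose hc).norm_mul_le hc Δ
  have h3 := norm_transpose_mul_self_le Δ
  have h4 := norm_add_le (Xᵀ * Δ + (Xᵀ * Δ)ᵀ) (Δᵀ * Δ)
  have h5 := norm_add_le (Xᵀ * Δ) (Xᵀ * Δ)ᵀ
  rw [Matrix.frobenius_norm_transpose] at h5
  rw [h1]
  linarith

/-- Factors close to the truth up to a rotation are nearly balanced. -/
theorem imbalance_le (h : NoiselessBalanced f Us Vs)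
    (hc : c = √(kappa Us Vs * sigmaMin Us Vs)) (hR : R ∈ Matrix.orthogonalGroup (Fin r) ℝ)
    (hd : pairNorm2 (errU U Us (ofOrthogonal hR)) (errV V Vs (ofOrthogonal hR)) ≤ d) :
    imbalance U V ≤ 4 * c * d + d ^ 2 := by
  have hc0 : 0 ≤ c := by rw [hc]; exact Real.sqrt_nonneg _
  have hR1 : R * Rᵀ = 1 := (Matrix.mem_orthogonalGroup_iff (Fin r) ℝ).1 hR
  set ΔA := nz (errU U Us (ofOrthogonal hR)) with hΔA
  set ΔB := nz (errV V Vs (ofOrthogonal hR)) with hΔB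
  have hA : nz U * R = nz Us + ΔA := nz_errU (ofOrthogonal hR)
  have hB : nz V * R = nz Vs + ΔB := nz_errV (ofOrthogonal hR)
  have hd2 : ‖ΔA‖ ^ 2 + ‖ΔB‖ ^ 2 ≤ d ^ 2 := by
    rw [← pairNorm2_sq]
    exact pow_le_pow_left₀ (pairNorm2_nonneg _ _) hd 2
  have hUA : UB (nz Us) c := by rw [hc]; exact h.bounds_left.2
  have hUB : UB (nz Vs) c := by rw [hc]; exact h.bounds_right.2
  have hbal : (nz Us)ᵀ * nz Us = (nz Vs)ᵀ * nz Vs := h.balanced_normalized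
  have h1 := norm_gram_add_sub_le (Δ := ΔA) hUA hc0
  have h2 := norm_gram_add_sub_le (Δ := ΔB) hUB hc0
  have h3 := norm_sub_le ((nz Us + ΔA)ᵀ * (nz Us + ΔA) - (nz Us)ᵀ * nz Us)
    ((nz Vs + ΔB)ᵀ * (nz Vs + ΔB) - (nz Vs)ᵀ * nz Vs)
  rw [hbal, sub_sub_sub_cancel_right, ← hA, ← hB] at h3
  rw [hbal, ← hA] at h1
  rw [← hB] at h2
  set Y := (nz U * R)ᵀ * (nz U * R) - (nz V * R)ᵀ * (nz V * R) with hY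
  have h4 : (nz U)ᵀ * nz U - (nz V)ᵀ * nz V = R * (Y * Rᵀ) := by
    have h5 : ∀ {p : ℕ} (X : Matrix (Fin p) (Fin r) ℝ),
        R * ((X * R)ᵀ * (X * R) * Rᵀ) = Xᵀ * X := fun {p} X => by
      rw [Matrix.mul_assoc _ _ Rᵀ, Matrix.mul_assoc X, hR1, Matrix.mul_one, Matrix.transpose_mul,
        Matrix.mul_assoc, ← Matrix.mul_assoc R, hR1, Matrix.one_mul]
    rw [hY, Matrix.sub_mul, Matrix.mul_sub, h5, h5]
  have hRu := UB_orthogonal hR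
  have h5 := hRu.norm_mul_le zero_le_one (Y * Rᵀ)
  have h6 := hRu.norm_mul_transpose_le zero_le_one Y
  have h7 : ‖ΔA‖ ≤ d := (norm_nz_le_left _ _).trans hd
  have h8 : ‖ΔB‖ ≤ d := (norm_nz_le_right _ _).trans hd
  have h9 := mul_le_mul_of_nonneg_left h7 hc0
  have h10 := mul_le_mul_of_nonneg_left h8 hc0
  rw [imbalance, h4]
  linarith

end Initialization

/-! ### Contraction along the iteration in the Frobenius norm -/

section Contraction

variable {n q r : ℕ} {f : Matrix (Fin n) (Fin q) ℝ → ℝ} {Us : Matrix (Fin n) (Fin r) ℝ}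
  {Vs : Matrix (Fin q) (Fin r) ℝ} {U U' : Matrix (Fin n) (Fin r) ℝ}
  {V V' : Matrix (Fin q) (Fin r) ℝ}
  {D : Set (Matrix (Fin n) (Fin r) ℝ × Matrix (Fin q) (Fin r) ℝ)}
  {G G' : GL (Fin r) ℝ} {α β L₂ Linf ε a c d d₀ e η x κ σ : ℝ}

/-- Because `κ ≥ 1`, `c = √κ a` is at most `κa`, so one power of `κ` in the hypothesis pays for the
passage from `a` to `c`. -/
theorem mul_sqrt_kappa_le (ha : 0 < a) (hκ : 1 ≤ κ) (hc : c ^ 2 = κ * a ^ 2) (hβ : 0 < β)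
    (hd : 0 ≤ d) (h : d * (κ * β) ≤ σ * (α * a)) : c * d * β ≤ σ * (α * a ^ 2) := by
  have h1 : c ≤ κ * a := by
    refine abs_le_of_sq_le_sq' ?_ (by positivity) |>.2
    rw [hc, mul_pow]
    exact mul_le_mul_of_nonneg_right (by nlinarith) (sq_nonneg a)
  have h2 := mul_le_mul_of_nonneg_right h1 (mul_nonneg hd hβ.le)
  have h3 := mul_le_mul_of_nonneg_left h ha.le
  linarith

theorem le_of_mul_kappa_le (hκ : 1 ≤ κ) (hβ : 0 < β) (ha : 0 < a) (hαβ : α ≤ β)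
    (hσ : 0 ≤ σ) (hd : 0 ≤ d) (h : d * (κ * β) ≤ σ * (α * a)) : d ≤ σ * a := by
  refine le_of_mul_le_mul_right ?_ hβ
  have h1 := mul_le_mul_of_nonneg_right hκ (mul_nonneg hd hβ.le)
  have h2 := mul_le_mul_of_nonneg_right hαβ (mul_nonneg hσ ha.le)
  linarith

/-- The distortion must have square of order `θ = ηαa²`, since it competes with the contraction.
This holds because `c²d²/a⁴ = κd²/a²` is quadratic in `d`, while `θ` is at least `α/(20βκ)`. -/
theorem gram_error_bounds {θ : ℝ} (ha : 0 < a) (hκ : 1 ≤ κ) (hc : c ^ 2 = κ * a ^ 2)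
    (hα : 0 < α) (hαβ : α ≤ β) (hd : 0 ≤ d) (h : d * (κ * β) ≤ 1 / 1000 * (α * a))
    (hθ : α ≤ 20 * θ * (β * κ)) :
    13 * (c * d / a ^ 2) ≤ 1 / 50 ∧ (13 * (c * d / a ^ 2)) ^ 2 ≤ θ / 20 := by
  have hβ : 0 < β := hα.trans_le hαβ
  have ha2 : 0 < a ^ 2 := by positivity
  constructor
  · have h1 := mul_sqrt_kappa_le ha hκ hc hβ hd h
    have h2 : c * d ≤ 1 / 1000 * a ^ 2 := by
      refine le_of_mul_le_mul_right ?_ hβ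
      linarith [mul_le_mul_of_nonneg_right hαβ ha2.le]
    have h3 : c * d / a ^ 2 ≤ 1 / 1000 := (div_le_iff₀ ha2).2 h2
    linarith
  · have h1 : (d * (κ * β)) ^ 2 ≤ (1 / 1000 * (α * a)) ^ 2 :=
      pow_le_pow_left₀ (by positivity) h 2
    have h2 : α ^ 2 ≤ β * (20 * θ * (β * κ)) := by
      rw [sq]; exact mul_le_mul hαβ hθ hα.le hβ.le
    have h3 : (c * d / a ^ 2) ^ 2 = κ * d ^ 2 / a ^ 2 := by
      rw [div_pow, mul_pow, hc]
      field_simp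
    have h4 : κ * d ^ 2 / a ^ 2 ≤ 20 * θ / 1000000 := by
      rw [div_le_iff₀ ha2]
      refine le_of_mul_le_mul_right ?_ (by positivity : 0 < κ * β ^ 2)
      have h5 := mul_le_mul_of_nonneg_right h2 ha2.le
      linarith
    rw [mul_pow, h3]
    have hθ0 : 0 ≤ κ * d ^ 2 / a ^ 2 := by positivity
    linarith

/-- The step size in terms of the normalized singular values. -/
theorem stepSize_facts (h : NoiselessBalanced f Us Vs) (hα : 0 < α) (hαβ : α ≤ β)
    (ha : a = √(sigmaMin Us Vs)) (hc : c = √(kappa Us Vs * sigmaMin Us Vs))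
    (hη : η = stepSize α β Us Vs) :
    0 < a ∧ a ≤ c ∧ c ^ 2 = kappa Us Vs * a ^ 2 ∧ 0 < η ∧ η * (β * c ^ 2) ≤ 1 / 10 ∧
      α ≤ 20 * (η * (α * a ^ 2)) * (β * kappa Us Vs) ∧
      rate α β Us Vs = 1 - η * (α * a ^ 2) / 4 ∧ η * (α * a ^ 2) ≤ 1 / 10 := by
  have hsm := h.sigmaMin_pos
  have hκ := h.one_le_kappa
  have hβ : 0 < β := hα.trans_le hαβ
  have hκ0 : 0 < kappa Us Vs := by linarith
  have ha2 : a ^ 2 = sigmaMin Us Vs := by rw [ha, Real.sq_sqrt hsm.le]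
  have hc2 : c ^ 2 = kappa Us Vs * sigmaMin Us Vs := by rw [hc, Real.sq_sqrt (by positivity)]
  have hac : a ≤ c := by
    rw [ha, hc]
    exact Real.sqrt_le_sqrt (by linarith [mul_le_mul_of_nonneg_right hκ hsm.le])
  have ha0 : 0 < a := by rw [ha]; exact Real.sqrt_pos.2 hsm
  have hη0 : 0 < η := by rw [hη, stepSize]; positivity
  have hηeq : η * (10 * (α + β) * kappa Us Vs * sigmaMin Us Vs) = 1 := by
    rw [hη, stepSize]; exact inv_mul_cancel₀ (by positivity)
  have e1 : η * (β * c ^ 2) ≤ 1 / 10 := by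
    rw [hc2]
    have : 0 ≤ η * (α * (kappa Us Vs * sigmaMin Us Vs)) := by positivity
    linarith
  refine ⟨ha0, hac, by rw [hc2, ha2], hη0, e1, ?_, ?_, ?_⟩
  · have h1 : η * ((β - α) * kappa Us Vs * sigmaMin Us Vs) ≥ 0 := by
      have : 0 ≤ β - α := by linarith
      positivity
    have h2 : 1 ≤ 20 * (η * (β * kappa Us Vs * sigmaMin Us Vs)) := by linarith
    have h3 := mul_le_mul_of_nonneg_left h2 hα.le
    rw [ha2]
    linarith
  · rw [rate, ha2, hη, mul_assoc]
  · have h1 : η * (α * a ^ 2) ≤ η * (β * c ^ 2) := mul_le_mul_of_nonneg_left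
      (mul_le_mul hαβ (pow_le_pow_left₀ ha0.le hac 2) (sq_nonneg a) hβ.le) hη0.le
    linarith

/-- In the estimate of `gram_close`, the error contributes `3` and the imbalance `2 * 5` multiples
of `c d₀ / a²`, whence `13`. -/
theorem alignment_gram_bound (h : NoiselessBalanced f Us Vs) (ha : a = √(sigmaMin Us Vs))
    (ha0 : 0 < a) (hac : a ≤ c) (hd : pairNorm2 (errU U Us G) (errV V Vs G) ≤ d₀)
    (hda : d₀ ≤ a / 20) (him : imbalance U V ≤ 5 * c * d₀) :
    UB ((G : Matrix (Fin r) (Fin r) ℝ)ᵀ * (G : Matrix (Fin r) (Fin r) ℝ) - 1)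
      (13 * (c * d₀ / a ^ 2)) := by
  have hd0 : 0 ≤ d₀ := (pairNorm2_nonneg _ _).trans hd
  have hLA : LB (nz Us) a := by rw [ha]; exact h.bounds_left.1
  refine (gram_close (A := nz U) (B := nz V) (A₀ := nz Us) (B₀ := nz Vs) ha0 hLA
    h.balanced_normalized (d := d₀) (m := 5 * c * d₀) ?_ ?_ hda him).mono ?_
  · rw [nz_errU (Us := Us), add_sub_cancel_left]
    exact (norm_nz_le_left _ _).trans hd
  · rw [nz_errV (Vs := Vs), add_sub_cancel_left]
    exact (norm_nz_le_right _ _).trans hd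
  · have h1 : d₀ / a ≤ c * d₀ / a ^ 2 := by
      rw [div_le_div_iff₀ ha0 (by positivity)]
      have := mul_le_mul_of_nonneg_right hac (mul_nonneg hd0 ha0.le)
      linarith
    have h2 : 5 * c * d₀ / a ^ 2 = 5 * (c * d₀ / a ^ 2) := by ring
    rw [h2]
    linarith

/-- One iteration: contraction with respect to the current optimal alignment, and control of the
imbalance. -/
theorem pairNorm2_iterate (h : NoiselessBalanced f Us Vs) (hα : 0 < α) (hαβ : α ≤ β)
    (hL₂ : 0 ≤ L₂) (hRIP : LocalRIP f D α β) (hLip : ScoreLipOp f D L₂)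
    (hopt : IsOptAlign U V Us Vs G) (hmem0 : (Us, Vs) ∈ D)
    (hmem : ∀ s ∈ Set.Ioo (0 : ℝ) 1, (Us + s • errU U Us G, Vs + s • errV V Vs G) ∈ D)
    (hη : η = stepSize α β Us Vs)
    (hU' : U' = U - ((q : ℝ)⁻¹ * η) • (matGrad f (U * Vᵀ) * V))
    (hV' : V' = V - ((n : ℝ)⁻¹ * η) • ((matGrad f (U * Vᵀ))ᵀ * U))
    (ha : a = √(sigmaMin Us Vs)) (hc : c = √(kappa Us Vs * sigmaMin Us Vs))
    (hS : d₀ * (kappa Us Vs * β) ≤ σ * (α * a)) (hσ : σ ≤ 1 / 1000) (hσL : σ * L₂ ≤ β / 1000)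
    (hd : pairNorm2 (errU U Us G) (errV V Vs G) ≤ d₀)
    (him : imbalance U V + 1.1 * pairNorm2 (errU U Us G) (errV V Vs G) ^ 2 ≤ 5 * c * d₀) :
    pairNorm2 (errU U' Us G) (errV V' Vs G) ≤
        rate α β Us Vs * pairNorm2 (errU U Us G) (errV V Vs G) ∧
      imbalance U' V' + 1.1 * pairNorm2 (errU U' Us G) (errV V' Vs G) ^ 2 ≤ 5 * c * d₀ := by
  obtain ⟨ha0, hac, hc2, hη0, hηc, hθ, hrate, hθ1⟩ := stepSize_facts h hα hαβ ha hc hη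
  have hκ := h.one_le_kappa
  have hβ : 0 < β := hα.trans_le hαβ
  have hd0 : 0 ≤ d₀ := (pairNorm2_nonneg _ _).trans hd
  have hS' : d₀ * (kappa Us Vs * β) ≤ 1 / 1000 * (α * a) :=
    hS.trans (mul_le_mul_of_nonneg_right hσ (by positivity))
  have hda := le_of_mul_kappa_le hκ hβ ha0 hαβ (by norm_num) hd0 hS'
  obtain ⟨hk, hk2⟩ := gram_error_bounds ha0 hκ hc2 hα hαβ hd0 hS' hθ
  set d := pairNorm2 (errU U Us G) (errV V Vs G) with hdef
  have hdn : 0 ≤ d := pairNorm2_nonneg _ _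
  have hK := alignment_gram_bound h ha ha0 hac hd (by linarith) (by linarith [sq_nonneg d])
  have hM : 2.04 * L₂ * c * d ≤ α * a ^ 2 / 20 := by
    have hc0 : 0 ≤ c := ha0.le.trans hac
    have h1 := mul_le_mul_of_nonneg_left (mul_sqrt_kappa_le ha0 hκ hc2 hβ hd0 hS) hL₂
    have h2 := mul_le_mul_of_nonneg_right hσL (by positivity : 0 ≤ α * a ^ 2)
    have h3 : L₂ * (c * d₀) ≤ α * a ^ 2 / 1000 := by
      refine le_of_mul_le_mul_right ?_ hβ
      linarith
    have h4 := mul_le_mul_of_nonneg_left hd (mul_nonneg hL₂ hc0)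
    have h5 : 0 ≤ α * a ^ 2 := by positivity
    linarith
  have hk0 : 0 ≤ 13 * (c * d₀ / a ^ 2) := by
    have hc0 : 0 ≤ c := ha0.le.trans hac
    positivity
  obtain ⟨h1, h2⟩ := pairNorm2_step h hα hαβ hL₂ hRIP hLip hopt hdef.symm hmem0 hmem hU' hV' ha hc
    hη0 hηc (by linarith) hK hk0 hk hk2 hM
  have hθ0 : 0 ≤ η * (α * a ^ 2) := by positivity
  refine ⟨?_, by linarith⟩
  rw [hrate]
  -- Square roots are taken by `1 - θ/2 ≤ (1 - θ/4)²`, which is why the rate has `4` in its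
  -- denominator.
  refine abs_le_of_sq_le_sq' (h1.trans ?_) (mul_nonneg (by linarith) hdn) |>.2
  rw [mul_pow]
  exact mul_le_mul_of_nonneg_right (by nlinarith) (sq_nonneg d)

/-- The identity alignment, optimal or not, certifies every point of the segment from the truth. -/
theorem mem_region2_path (h : NoiselessBalanced f Us Vs)
    (hd : pairNorm2 (errU U Us G) (errV V Vs G) ≤ d) (hds : d < √(sigmaMin Us Vs))
    (hdε : d ≤ ε * tauStar Us Vs) {s : ℝ} (hs0 : 0 ≤ s) (hs1 : s ≤ 1) :
    (Us + s • errU U Us G, Vs + s • errV V Vs G) ∈ region2 Us Vs ε := by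
  refine mem_region2_of_le h (G := 1) (d := d) ?_ hds hdε
  rw [errU_one, errV_one, add_sub_cancel_left, add_sub_cancel_left, pairNorm2_smul hs0]
  have := mul_le_mul_of_nonneg_right hs1 (pairNorm2_nonneg (errU U Us G) (errV V Vs G))
  linarith

/-- The rotation `R` bounds the imbalance by `4c d₀ + d₀²`; adding `1.1 d₀²` still gives at most `5c
d₀` because `d₀ ≤ c/100`. This starts the monotone quantity. -/
theorem exists_isOptAlign_init {R : Matrix (Fin r) (Fin r) ℝ} (h : NoiselessBalanced f Us Vs)
    (ha : a = √(sigmaMin Us Vs)) (hac : a ≤ c) (ha0 : 0 < a)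
    (hc : c = √(kappa Us Vs * sigmaMin Us Vs)) (hR : R ∈ Matrix.orthogonalGroup (Fin r) ℝ)
    (hd : pairNorm2 (U * R - Us) (V * R - Vs) ≤ d₀) (hda : d₀ ≤ a / 100) :
    ∃ G, IsOptAlign U V Us Vs G ∧ pairNorm2 (errU U Us G) (errV V Vs G) ≤ d₀ ∧
      imbalance U V + 1.1 * pairNorm2 (errU U Us G) (errV V Vs G) ^ 2 ≤ 5 * c * d₀ := by
  rw [← errU_ofOrthogonal hR, ← errV_ofOrthogonal hR] at hd
  have hd0 : 0 ≤ d₀ := (pairNorm2_nonneg _ _).trans hd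
  obtain ⟨G, hG⟩ := exists_isOptAlign h hd (by rw [← ha]; linarith)
  have h1 := (isOptAlign_iff.1 hG (ofOrthogonal hR)).trans hd
  refine ⟨G, hG, h1, ?_⟩
  have h2 := imbalance_le h hc hR hd
  have h3 := pow_le_pow_left₀ (pairNorm2_nonneg _ _) h1 2
  have h4 := mul_le_mul_of_nonneg_right (hda.trans (div_le_div_of_nonneg_right hac (by norm_num)))
    hd0
  rw [sq d₀] at h2 h3
  linarith [mul_nonneg (ha0.le.trans hac) hd0]

theorem IsGradientDescent.step {Us' : ℕ → Matrix (Fin n) (Fin r) ℝ}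
    {Vs' : ℕ → Matrix (Fin q) (Fin r) ℝ} (hf : ContDiff ℝ 2 f)
    (hgd : IsGradientDescent f η Us' Vs') (t : ℕ) :
    Us' (t + 1) = Us' t - ((q : ℝ)⁻¹ * η) • (matGrad f (Us' t * (Vs' t)ᵀ) * Vs' t) ∧
      Vs' (t + 1) = Vs' t - ((n : ℝ)⁻¹ * η) • ((matGrad f (Us' t * (Vs' t)ᵀ))ᵀ * Us' t) := by
  have hd : Differentiable ℝ f := hf.differentiable two_ne_zero
  obtain ⟨h1, h2⟩ := hgd t
  rw [matGrad_mul_transpose_left hd] at h1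
  rw [matGrad_mul_transpose_right hd] at h2
  exact ⟨h1, h2⟩

theorem rate_bounds (h : NoiselessBalanced f Us Vs) (hα : 0 < α) (hαβ : α ≤ β) :
    0 ≤ rate α β Us Vs ∧ rate α β Us Vs ≤ 1 := by
  obtain ⟨ha0, -, -, hη0, -, -, hrate, hθ1⟩ := stepSize_facts h hα hαβ rfl rfl rfl
  have : 0 ≤ stepSize α β Us Vs * (α * √(sigmaMin Us Vs) ^ 2) := by positivity
  rw [hrate]
  constructor <;> linarith

/-- The error in Frobenius norm decreases geometrically. -/
theorem l2_contraction {U : ℕ → Matrix (Fin n) (Fin r) ℝ} {V : ℕ → Matrix (Fin q) (Fin r) ℝ}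
    {R : Matrix (Fin r) (Fin r) ℝ} (h : NoiselessBalanced f Us Vs) (hα : 0 < α) (hαβ : α ≤ β)
    (hL₂ : 0 ≤ L₂) (hRIP : LocalRIP f (region2 Us Vs ε) α β)
    (hLip : ScoreLipOp f (region2 Us Vs ε) L₂)
    (hgd : IsGradientDescent f (stepSize α β Us Vs) U V)
    (hR : R ∈ Matrix.orthogonalGroup (Fin r) ℝ)
    (hd : pairNorm2 (U 0 * R - Us) (V 0 * R - Vs) ≤ d₀) (hdε : d₀ ≤ ε * tauStar Us Vs)
    (hS : d₀ * (kappa Us Vs * β) ≤ σ * (α * √(sigmaMin Us Vs))) (hσ : σ ≤ 1 / 1000)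
    (hσL : σ * L₂ ≤ β / 1000) (t : ℕ) :
    ∃ G, IsOptAlign (U t) (V t) Us Vs G ∧
      pairNorm2 (errU (U t) Us G) (errV (V t) Vs G) ≤ rate α β Us Vs ^ t * d₀ ∧
      imbalance (U t) (V t) + 1.1 * pairNorm2 (errU (U t) Us G) (errV (V t) Vs G) ^ 2 ≤
        5 * √(kappa Us Vs * sigmaMin Us Vs) * d₀ := by
  obtain ⟨ha0, hac, -⟩ := stepSize_facts h hα hαβ rfl rfl rfl
  obtain ⟨hr0, hr1⟩ := rate_bounds h hα hαβ
  have hd0 : 0 ≤ d₀ := (pairNorm2_nonneg _ _).trans hd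
  have hda : d₀ ≤ 1 / 1000 * √(sigmaMin Us Vs) :=
    le_of_mul_kappa_le h.one_le_kappa (hα.trans_le hαβ) ha0 hαβ (by norm_num) hd0
      (hS.trans (mul_le_mul_of_nonneg_right hσ (by positivity)))
  induction t with
  | zero =>
    rw [pow_zero, one_mul]
    exact exists_isOptAlign_init h rfl hac ha0 rfl hR hd (by linarith)
  | succ t ih =>
    obtain ⟨G, hG, h1, h2⟩ := ih
    obtain ⟨e1, e2⟩ := hgd.step h.smooth t
    have h3 : rate α β Us Vs ^ t * d₀ ≤ d₀ := by
      have := mul_le_mul_of_nonneg_right (pow_le_one₀ hr0 hr1 (n := t)) hd0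
      linarith
    have hpath : ∀ s : ℝ, 0 ≤ s → s ≤ 1 →
        (Us + s • errU (U t) Us G, Vs + s • errV (V t) Vs G) ∈ region2 Us Vs ε :=
      fun s hs0 hs1 => mem_region2_path h (h1.trans h3) (by linarith) hdε hs0 hs1
    have hmem0 := hpath 0 le_rfl zero_le_one
    rw [zero_smul, zero_smul, add_zero, add_zero] at hmem0
    obtain ⟨h4, h5⟩ := pairNorm2_iterate h hα hαβ hL₂ hRIP hLip hG hmem0
      (fun s hs => hpath s hs.1.le hs.2.le) rfl e1 e2 rfl rfl hS hσ hσL (h1.trans h3) h2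
    have h6 : pairNorm2 (errU (U (t + 1)) Us G) (errV (V (t + 1)) Vs G) ≤
        rate α β Us Vs ^ (t + 1) * d₀ := by
      refine h4.trans ?_
      rw [pow_succ]
      linarith [mul_le_mul_of_nonneg_left h1 hr0]
    have h7 : rate α β Us Vs ^ (t + 1) * d₀ ≤ d₀ := by
      have := mul_le_mul_of_nonneg_right (pow_le_one₀ hr0 hr1 (n := t + 1)) hd0
      linarith
    -- Re-optimizing does not alter the imbalance and can only lower the error, so both parts of the
    -- induction hypothesis pass to the new alignment.
    obtain ⟨G', hG'⟩ := exists_isOptAlign h (h6.trans h7) (by linarith)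
    have h8 := isOptAlign_iff.1 hG' G
    refine ⟨G', hG', h8.trans h6, ?_⟩
    linarith [pow_le_pow_left₀ (pairNorm2_nonneg _ _) h8 2]

end Contraction

/-! ### Contraction along the iteration in the two-to-infinity norm -/

section RowContraction

variable {n q r : ℕ} {f : Matrix (Fin n) (Fin q) ℝ → ℝ} {Us : Matrix (Fin n) (Fin r) ℝ}
  {Vs : Matrix (Fin q) (Fin r) ℝ} {U : Matrix (Fin n) (Fin r) ℝ} {V : Matrix (Fin q) (Fin r) ℝ}
  {G : GL (Fin r) ℝ} {α β L₂ Linf ε a c d d₀ e η κ σ ψ : ℝ}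

theorem resU_mul_right : resU U Us G * (G : Matrix (Fin r) (Fin r) ℝ) = errU U Us G := by
  rw [resU, errU, Matrix.sub_mul, Matrix.mul_assoc, GL_inv_mul, Matrix.mul_one]

theorem resV_mul_inv_transpose :
    resV V Vs G * ((G⁻¹ : GL (Fin r) ℝ) : Matrix (Fin r) (Fin r) ℝ)ᵀ = errV V Vs G := by
  rw [resV, errV, Matrix.sub_mul, Matrix.mul_assoc, ← Matrix.transpose_mul, GL_inv_mul,
    Matrix.transpose_one, Matrix.mul_one]

theorem pairNormInf_err_le (hG : UB (G : Matrix (Fin r) (Fin r) ℝ) 1.02)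
    (hG' : UB ((G⁻¹ : GL (Fin r) ℝ) : Matrix (Fin r) (Fin r) ℝ) 1.02)
    (he : max (rowNorm (resU U Us G)) (rowNorm (resV V Vs G)) ≤ e) :
    pairNormInf (errU U Us G) (errV V Vs G) ≤ 1.02 * e := by
  rw [pairNormInf, ← resU_mul_right, ← resV_mul_inv_transpose]
  exact max_le (rowNorm_mul_le hG (by norm_num) ((le_max_left _ _).trans he))
    (rowNorm_mul_le (hG'.transpose (by norm_num)) (by norm_num) ((le_max_right _ _).trans he))

/-- A pair whose error for some alignment is a fraction of that of a pair close to the truth lies in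
the local region. -/
theorem mem_regionInf_of_err_eq (h : NoiselessBalanced f Us Vs) {X EU : Matrix (Fin n) (Fin r) ℝ}
    {Y EV : Matrix (Fin q) (Fin r) ℝ} {s : ℝ} (hs0 : 0 ≤ s) (hs1 : s ≤ 1)
    (hX : errU X Us G = s • EU) (hY : errV Y Vs G = s • EV) (hd : pairNorm2 EU EV ≤ d)
    (hda : d ≤ 1 / 1000 * √(sigmaMin Us Vs)) (hdψ : d ≤ 1 / 1000 * ψ * √(sigmaMin Us Vs))
    (hψ : 0 ≤ ψ) (hdε : d ≤ ε * tauStar Us Vs) (hψε : ψ ≤ ε / 2)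
    (he : pairNormInf EU EV ≤ 1.02 * (0.8 * (ψ * omegaStar Us Vs))) :
    (X, Y) ∈ regionInf Us Vs ε := by
  have hs : 0 < √(sigmaMin Us Vs) := Real.sqrt_pos.2 h.sigmaMin_pos
  have hω := h.omegaStar_pos
  refine mem_regionInf_of_le h (G := G) (d := d) (e := 1.02 * (0.8 * (ψ * omegaStar Us Vs))) ?_
    (by linarith) hdε ?_ ?_
  · rw [hX, hY, pairNorm2_smul hs0]
    have := mul_le_mul_of_nonneg_right hs1 (pairNorm2_nonneg EU EV)
    linarith
  · rw [hX, hY]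
    exact max_le (rowNorm_smul_le ((le_max_left _ _).trans he) hs0 hs1)
      (rowNorm_smul_le ((le_max_right _ _).trans he) hs0 hs1)
  · have h1 : d / √(sigmaMin Us Vs) ≤ 1 / 1000 := (div_le_iff₀ hs).2 hda
    have h2 : d / √(sigmaMin Us Vs) ≤ 1 / 1000 * ψ := (div_le_iff₀ hs).2 hdψ
    have hψω := mul_nonneg hψ hω.le
    have h3 := mul_le_mul_of_nonneg_left h1 hψω
    have h4 := mul_le_mul_of_nonneg_right h2 hω.le
    have h5 := mul_le_mul_of_nonneg_right hψε hω.le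
    linarith

/-- The row error after one iteration, in terms of the scales of the errors. -/
theorem row_contraction_bound {θ p ω Λ : ℝ} (ha : 0 < a) (hac : a ≤ c) (hκ : 1 ≤ κ)
    (hc : c ^ 2 = κ * a ^ 2) (hα : 0 < α) (hαβ : α ≤ β) (hη : 0 < η)
    (hθ : θ = η * (α * a ^ 2)) (hθα : α ≤ 20 * θ * (β * κ)) (hd : 0 ≤ d₀)
    (hS : d₀ * (κ * β) ≤ σ * (α * a)) (hσ : σ ≤ 1 / 1000) (hσΛ : σ * Λ ≤ β / 1000)
    (hψ : 0 < ψ) (hS' : d₀ * (κ * β) ≤ 1 / 1000 * ψ * (α * a)) (hΛ : 0 ≤ Λ) (hω : 0 ≤ ω)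
    (hp0 : 0 ≤ p) (hp1 : p ≤ 1) :
    (1 - 0.8 * θ) * (0.8 * (p * ψ * ω)) + 1.1 * (η * (p * d₀)) *
          (β * c * (1.02 * ω + 0.8 * (p * ψ * ω)) +
            Λ * (c * (0.8 * (p * ψ * ω)) + p * d₀ * ω)) +
        2.3 * (p * d₀ / a) * ω ≤ 0.8 * ((1 - θ / 4) * p * ψ * ω) := by
  have hβ : 0 < β := hα.trans_le hαβ
  have hc0 : 0 < c := ha.trans_le hac
  have ha2 : 0 < a ^ 2 := by positivity
  have hθ0 : 0 < θ := by rw [hθ]; positivity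
  have hE : 0 ≤ p * ψ * ω := by positivity
  have x1 := mul_sqrt_kappa_le ha hκ hc hβ hd hS
  have x2 := mul_sqrt_kappa_le ha hκ hc hβ hd hS'
  have x3 := le_of_mul_kappa_le hκ hβ ha hαβ (by positivity) hd hS'
  have t1 : η * (β * c * d₀) ≤ θ * ψ / 1000 := by
    rw [hθ]
    linarith [mul_le_mul_of_nonneg_left x2 hη.le]
  have t2 : η * (β * c * d₀) ≤ θ / 1000 := by
    rw [hθ]
    linarith [mul_le_mul_of_nonneg_left x1 hη.le,
      mul_le_mul_of_nonneg_right hσ (by positivity : 0 ≤ η * (α * a ^ 2))]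
  have t3 : η * (Λ * (c * d₀)) ≤ θ / 1000 := by
    have h1 : Λ * (c * d₀) ≤ α * a ^ 2 / 1000 := by
      refine le_of_mul_le_mul_right ?_ hβ
      linarith [mul_le_mul_of_nonneg_left x1 hΛ,
        mul_le_mul_of_nonneg_right hσΛ (by positivity : 0 ≤ α * a ^ 2)]
    rw [hθ]
    linarith [mul_le_mul_of_nonneg_left h1 hη.le]
  have t4 : η * (Λ * (d₀ * d₀)) ≤ θ * ψ / 1000 := by
    have h1 : d₀ * d₀ ≤ ψ * (c * d₀) := by
      have h2 := mul_le_mul_of_nonneg_right x3 hd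
      have h3 := mul_le_mul_of_nonneg_right hac (mul_nonneg hψ.le hd)
      have h4 : 0 ≤ ψ * (a * d₀) := by positivity
      linarith
    have h2 := mul_le_mul_of_nonneg_left h1 (mul_nonneg hη.le hΛ)
    have h3 := mul_le_mul_of_nonneg_left t3 hψ.le
    linarith
  -- The realignment cost carries no factor `η`, so it must be small relative to `θψ`. This is where
  -- the smallness of `φ/ψ` is essential, combined with `θ ≥ α/(20βκ)`; `20/1000 = 1/50`.
  have t5 : d₀ / a ≤ θ * ψ / 50 := by
    rw [div_le_iff₀ ha]
    refine le_of_mul_le_mul_right ?_ (by positivity : 0 < κ * β)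
    linarith [mul_le_mul_of_nonneg_left hθα (by positivity : 0 ≤ 1 / 1000 * ψ * a)]
  have hpp : p * p ≤ p := by
    have := mul_le_mul_of_nonneg_left hp1 hp0
    linarith
  have hpω : 0 ≤ p * ω := by positivity
  have hθE : 0 ≤ θ * (p * ψ * ω) := by positivity
  have u1 := mul_le_mul_of_nonneg_right t1 hpω
  have u2 := mul_le_mul_of_nonneg_right t2 (mul_nonneg hp0 hE)
  have u3 := mul_le_mul_of_nonneg_right t3 (mul_nonneg hp0 hE)
  have u4 := mul_le_mul_of_nonneg_right t4 (mul_nonneg hp0 hpω)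
  have u5 := mul_le_mul_of_nonneg_right t5 hpω
  have v1 := mul_le_mul_of_nonneg_right hp1 hθE
  have e5 : 2.3 * (p * d₀ / a) * ω = 2.3 * (d₀ / a * (p * ω)) := by ring
  -- In units of `θpψω`, slowing the rate from `1 - 0.8θ` to `1 - θ/4` frees `0.8 * 0.55 = 0.44`.
  -- Realignment takes `2.3/50` and the remaining errors are a few thousandths.
  rw [e5]
  linarith

/-- The errors in Frobenius norm and row by row decrease geometrically. -/
theorem linf_contraction {U : ℕ → Matrix (Fin n) (Fin r) ℝ} {V : ℕ → Matrix (Fin q) (Fin r) ℝ}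
    {R : Matrix (Fin r) (Fin r) ℝ} (h : NoiselessBalanced f Us Vs) (hα : 0 < α) (hαβ : α ≤ β)
    (hL₂ : 0 ≤ L₂) (hRIP : LocalRIP f (regionInf Us Vs ε) α β)
    (hLip : ScoreLipOp f (regionInf Us Vs ε) L₂)
    (hrow : RowCrossCurvature f (regionInf Us Vs ε) β)
    (hLipRow : ScoreLipRow f (regionInf Us Vs ε) Linf)
    (hgd : IsGradientDescent f (stepSize α β Us Vs) U V)
    (hR : R ∈ Matrix.orthogonalGroup (Fin r) ℝ)
    (hd : pairNorm2 (U 0 * R - Us) (V 0 * R - Vs) ≤ d₀) (hdε : d₀ ≤ ε * tauStar Us Vs)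
    (hS : d₀ * (kappa Us Vs * β) ≤ σ * (α * √(sigmaMin Us Vs))) (hσ : σ ≤ 1 / 1000)
    (hσL : σ * L₂ ≤ β / 1000) (hσΛ : σ * |Linf| ≤ β / 1000) (hψ : 0 < ψ) (hψε : ψ ≤ ε / 2)
    (hS' : d₀ * (kappa Us Vs * β) ≤ 1 / 1000 * ψ * (α * √(sigmaMin Us Vs)))
    (hrow0 : pairNormInf (U 0 * R - Us) (V 0 * R - Vs) ≤ 1 / 2 * ψ * omegaStar Us Vs) (t : ℕ) :
    ∃ G, IsOptAlign (U t) (V t) Us Vs G ∧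
      pairNorm2 (errU (U t) Us G) (errV (V t) Vs G) ≤ rate α β Us Vs ^ t * d₀ ∧
      imbalance (U t) (V t) + 1.1 * pairNorm2 (errU (U t) Us G) (errV (V t) Vs G) ^ 2 ≤
        5 * √(kappa Us Vs * sigmaMin Us Vs) * d₀ ∧
      UB (G : Matrix (Fin r) (Fin r) ℝ) 1.02 ∧
      UB ((G⁻¹ : GL (Fin r) ℝ) : Matrix (Fin r) (Fin r) ℝ) 1.02 ∧
      max (rowNorm (resU (U t) Us G)) (rowNorm (resV (V t) Vs G)) ≤
        0.8 * (rate α β Us Vs ^ t * ψ * omegaStar Us Vs) := by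
  obtain ⟨ha0, hac, hc2, hη0, hηc, hθ, hrate, hθ1⟩ := stepSize_facts h hα hαβ rfl rfl rfl
  obtain ⟨hr0, hr1⟩ := rate_bounds h hα hαβ
  have hκ := h.one_le_kappa
  have hβ := hα.trans_le hαβ
  have hω := h.omegaStar_pos
  have hd0 : 0 ≤ d₀ := (pairNorm2_nonneg _ _).trans hd
  have hS'' := hS.trans (mul_le_mul_of_nonneg_right hσ (by positivity))
  have hda : d₀ ≤ 1 / 1000 * √(sigmaMin Us Vs) :=
    le_of_mul_kappa_le hκ hβ ha0 hαβ (by norm_num) hd0 hS''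
  have hdψ : d₀ ≤ 1 / 1000 * ψ * √(sigmaMin Us Vs) :=
    le_of_mul_kappa_le hκ hβ ha0 hαβ (by positivity) hd0 hS'
  have hgram : ∀ {X : Matrix (Fin n) (Fin r) ℝ} {Y : Matrix (Fin q) (Fin r) ℝ} {G : GL (Fin r) ℝ},
      pairNorm2 (errU X Us G) (errV Y Vs G) ≤ d₀ →
      imbalance X Y + 1.1 * pairNorm2 (errU X Us G) (errV Y Vs G) ^ 2 ≤
        5 * √(kappa Us Vs * sigmaMin Us Vs) * d₀ →
      UB (G : Matrix (Fin r) (Fin r) ℝ) 1.02 ∧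
        UB ((G⁻¹ : GL (Fin r) ℝ) : Matrix (Fin r) (Fin r) ℝ) 1.02 := fun {X Y G} h1 h2 =>
    UB_of_gram (alignment_gram_bound h rfl ha0 hac h1 (by linarith)
      (by linarith [sq_nonneg (pairNorm2 (errU X Us G) (errV Y Vs G))]))
      (gram_error_bounds ha0 hκ hc2 hα hαβ hd0 hS'' hθ).1
  induction t with
  | zero =>
    obtain ⟨G, hG, h1, h2⟩ := exists_isOptAlign_init h rfl hac ha0 rfl hR hd (by linarith)
    obtain ⟨g1, g2⟩ := hgram h1 h2
    refine ⟨G, hG, by rwa [pow_zero, one_mul], h2, g1, g2, ?_⟩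
    have hRu := UB_orthogonal hR
    have hRt : UB ((ofOrthogonal hR : GL (Fin r) ℝ)⁻¹ : GL (Fin r) ℝ).val 1 :=
      hRu.transpose zero_le_one
    rw [← errU_ofOrthogonal hR, ← errV_ofOrthogonal hR] at hd hrow0
    -- The initial row bound is for the rotation `R`; moving to the optimal alignment raises `1/2`
    -- by a small multiple of `ψω`, within the `0.8` carried by the induction.
    have h3 : max (rowNorm (resU (U 0) Us (ofOrthogonal hR)))
        (rowNorm (resV (V 0) Vs (ofOrthogonal hR))) ≤ 1 * (1 / 2 * ψ * omegaStar Us Vs) := by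
      rw [← errU_mul_inv, ← errV_mul_transpose]
      exact max_le (rowNorm_mul_le hRt zero_le_one ((le_max_left _ _).trans hrow0))
        (rowNorm_mul_le (hRu.transpose zero_le_one) zero_le_one ((le_max_right _ _).trans hrow0))
    have h4 := rowNorm_res_shift h hd h1 (by linarith) (hRu.mono (by norm_num))
      (hRt.mono (by norm_num)) h3
    have h5 : d₀ / √(sigmaMin Us Vs) ≤ 1 / 1000 * ψ := (div_le_iff₀ ha0).2 hdψ
    have h6 := mul_le_mul_of_nonneg_right h5 hω.le
    rw [pow_zero]
    linarith [mul_pos hψ hω]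
  | succ t ih =>
    obtain ⟨G, hG, h1, h2, g1, g2, hres⟩ := ih
    obtain ⟨e1, e2⟩ := hgd.step h.smooth t
    have hp0 : 0 ≤ rate α β Us Vs ^ t := pow_nonneg hr0 t
    have hp1 : rate α β Us Vs ^ t ≤ 1 := pow_le_one₀ hr0 hr1
    have h3 : rate α β Us Vs ^ t * d₀ ≤ d₀ := by
      have := mul_le_mul_of_nonneg_right hp1 hd0
      linarith
    have herr : pairNormInf (errU (U t) Us G) (errV (V t) Vs G) ≤
        1.02 * (0.8 * (ψ * omegaStar Us Vs)) := by
      refine pairNormInf_err_le g1 g2 (hres.trans ?_)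
      linarith [mul_le_mul_of_nonneg_right hp1 (mul_pos hψ hω).le]
    -- Two segments are needed. This one runs in aligned coordinates and serves the Frobenius step;
    -- the next runs from the truth moved along its orbit to the actual iterate and serves the row
    -- step, where the update is undistorted.
    have hpath : ∀ s : ℝ, 0 ≤ s → s ≤ 1 →
        (Us + s • errU (U t) Us G, Vs + s • errV (V t) Vs G) ∈ regionInf Us Vs ε :=
      fun s hs0 hs1 => mem_regionInf_of_err_eq h (G := 1) hs0 hs1
        (by rw [errU_one, add_sub_cancel_left]) (by rw [errV_one, add_sub_cancel_left])
        (h1.trans h3) hda hdψ hψ.le hdε hψε herr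
    have hpath' : ∀ s : ℝ, 0 ≤ s → s ≤ 1 →
        (Us * ((G⁻¹ : GL (Fin r) ℝ) : Matrix (Fin r) (Fin r) ℝ) + s • resU (U t) Us G,
          Vs * (G : Matrix (Fin r) (Fin r) ℝ)ᵀ + s • resV (V t) Vs G) ∈ regionInf Us Vs ε :=
      fun s hs0 hs1 => mem_regionInf_of_err_eq h (G := G) hs0 hs1
        (by rw [errU, Matrix.add_mul, Matrix.smul_mul, resU_mul_right, Matrix.mul_assoc,
              GL_inv_mul, Matrix.mul_one, add_sub_cancel_left])
        (by rw [errV, Matrix.add_mul, Matrix.smul_mul, resV_mul_inv_transpose, Matrix.mul_assoc,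
              ← Matrix.transpose_mul, GL_inv_mul, Matrix.transpose_one, Matrix.mul_one,
              add_sub_cancel_left])
        (h1.trans h3) hda hdψ hψ.le hdε hψε herr
    have hmem0 := hpath 0 le_rfl zero_le_one
    rw [zero_smul, zero_smul, add_zero, add_zero] at hmem0
    have hmem0' := hpath' 0 le_rfl zero_le_one
    rw [zero_smul, zero_smul, add_zero, add_zero] at hmem0'
    obtain ⟨h4, h5⟩ := pairNorm2_iterate h hα hαβ hL₂ hRIP hLip hG hmem0
      (fun s hs => hpath s hs.1.le hs.2.le) rfl e1 e2 rfl rfl hS hσ hσL (h1.trans h3) h2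
    have h6 : pairNorm2 (errU (U (t + 1)) Us G) (errV (V (t + 1)) Vs G) ≤
        rate α β Us Vs ^ (t + 1) * d₀ := by
      refine h4.trans ?_
      rw [pow_succ]
      linarith [mul_le_mul_of_nonneg_left h1 hr0]
    have h7 : rate α β Us Vs ^ (t + 1) * d₀ ≤ rate α β Us Vs ^ t * d₀ :=
      mul_le_mul_of_nonneg_right (pow_le_pow_of_le_one hr0 hr1 (Nat.le_succ t)) hd0
    obtain ⟨G', hG'⟩ := exists_isOptAlign h (h6.trans (h7.trans h3)) (by linarith)
    have h8 := isOptAlign_iff.1 hG' G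
    have h9 : imbalance (U (t + 1)) (V (t + 1)) +
        1.1 * pairNorm2 (errU (U (t + 1)) Us G') (errV (V (t + 1)) Vs G') ^ 2 ≤
        5 * √(kappa Us Vs * sigmaMin Us Vs) * d₀ := by
      linarith [pow_le_pow_left₀ (pairNorm2_nonneg _ _) h8 2]
    obtain ⟨g1', g2'⟩ := hgram ((h8.trans h6).trans (h7.trans h3)) h9
    refine ⟨G', hG', h8.trans h6, h9, g1', g2', ?_⟩
    have h10 := rowNorm_step h hα hαβ hRIP hrow hLipRow hmem0'
      (fun s hs => hpath' s hs.1.le hs.2.le) e1 e2 rfl rfl hη0 hηc (by linarith) h1 g1 g2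
      ((le_max_left _ _).trans hres) ((le_max_right _ _).trans hres)
    have h11 := rowNorm_res_shift h (h6.trans h7) ((h8.trans h6).trans h7) (by linarith) g1 g2 h10
    have h12 := row_contraction_bound ha0 hac hκ hc2 hα hαβ hη0 rfl hθ hd0 hS hσ hσΛ hψ hS'
      (abs_nonneg Linf) hω.le hp0 hp1
    rw [← hrate] at h12
    refine h11.trans (h12.trans_eq ?_)
    rw [pow_succ']

end RowContraction

/-! ### The initialization conditions in terms of the normalized scales -/

section Constants

variable {n q r : ℕ} {f : Matrix (Fin n) (Fin q) ℝ → ℝ} {Us : Matrix (Fin n) (Fin r) ℝ}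
  {Vs : Matrix (Fin q) (Fin r) ℝ} {α β L₂ c₀ φ ψ : ℝ}

theorem NoiselessBalanced.tauStar_le (h : NoiselessBalanced f Us Vs) :
    tauStar Us Vs ≤ √((r : ℝ) * kappa Us Vs) * √(sigmaMin Us Vs) := by
  rw [← Real.sqrt_mul (mul_nonneg (Nat.cast_nonneg r) (by linarith [h.one_le_kappa]))]
  exact Real.le_sqrt_of_sq_le h.tauStar_sq_le

theorem initial_error_le (h : NoiselessBalanced f Us Vs) (hβ : 0 < β) (hφ : 0 ≤ φ) :
    1 / 2 * φ * tauStar Us Vs * (kappa Us Vs * β) ≤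
      1 / 2 * (φ * (β * kappa Us Vs * √((r : ℝ) * kappa Us Vs))) * √(sigmaMin Us Vs) := by
  have hκ := h.one_le_kappa
  have h1 := mul_le_mul_of_nonneg_left h.tauStar_le
    (by positivity : 0 ≤ φ * (kappa Us Vs * β))
  linarith

/-- Since `α ≤ L₂` and `κ ≥ 1`, `α + κ ≤ (1 + L₂)κ`. This cancels one of the two powers of `κ` in
the condition, and the factor `√(rκ)` absorbs `τ*/√σ_min`. -/
theorem initial_error_le_of_init2 (h : NoiselessBalanced f Us Vs) (hα : 0 < α) (hβ : 0 < β)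
    (hαL : α ≤ L₂) (hc₀ : 0 ≤ c₀) (hφ0 : 0 ≤ φ)
    (hφ : φ ≤ c₀ * (α * (α + kappa Us Vs) /
      (β * kappa Us Vs ^ 2 * √((r : ℝ) * kappa Us Vs)))) :
    1 / 2 * φ * tauStar Us Vs * (kappa Us Vs * β) ≤
      c₀ * (1 + L₂) * (α * √(sigmaMin Us Vs)) := by
  have hκ := h.one_le_kappa
  have hκ0 : 0 < kappa Us Vs := by linarith
  have hr : (0 : ℝ) < r := by exact_mod_cast h.one_le
  have hs : 0 < √((r : ℝ) * kappa Us Vs) := Real.sqrt_pos.2 (by positivity)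
  rw [← mul_div_assoc, le_div_iff₀ (by positivity)] at hφ
  have h1 : φ * (β * kappa Us Vs * √((r : ℝ) * kappa Us Vs)) ≤ c₀ * (1 + L₂) * α := by
    refine le_of_mul_le_mul_right ?_ hκ0
    have h2 := mul_le_mul_of_nonneg_left hκ (hα.le.trans hαL)
    have h3 := mul_le_mul_of_nonneg_left (by linarith : α + kappa Us Vs ≤ (1 + L₂) * kappa Us Vs)
      (mul_nonneg hc₀ hα.le)
    linarith
  have h2 := initial_error_le h hβ hφ0
  have h3 := mul_le_mul_of_nonneg_right h1 (Real.sqrt_nonneg (sigmaMin Us Vs))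
  have h4 : 0 ≤ c₀ * (1 + L₂) * (α * √(sigmaMin Us Vs)) :=
    mul_nonneg (mul_nonneg hc₀ (by linarith)) (by positivity)
  linarith

/-- As `κ^(3/2) √r = κ √(rκ)`, the ratio condition is the same estimate for `φ` with `ψα` on the
right-hand side. -/
theorem initial_error_le_of_initInf (h : NoiselessBalanced f Us Vs) (hα : 0 < α) (hβ : 0 < β)
    (hψ : 0 < ψ) (hφ0 : 0 ≤ φ) (hc₀ : c₀ ≤ 1 / 1000)
    (hφ : β / α * kappa Us Vs ^ (3 / 2 : ℝ) * √(r : ℝ) * (φ / ψ) ≤ c₀) :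
    1 / 2 * φ * tauStar Us Vs * (kappa Us Vs * β) ≤
      1 / 1000 * ψ * (α * √(sigmaMin Us Vs)) := by
  have hκ := h.one_le_kappa
  have hκ0 : 0 < kappa Us Vs := by linarith
  have e1 : kappa Us Vs ^ (3 / 2 : ℝ) = kappa Us Vs * √(kappa Us Vs) := by
    rw [Real.sqrt_eq_rpow, ← Real.rpow_one_add' hκ0.le (by norm_num)]
    norm_num
  have e2 : β / α * kappa Us Vs ^ (3 / 2 : ℝ) * √(r : ℝ) * (φ / ψ) =
      φ * (β * kappa Us Vs * √((r : ℝ) * kappa Us Vs)) / (ψ * α) := by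
    rw [e1, Real.sqrt_mul (Nat.cast_nonneg r)]
    field_simp
  rw [e2, div_le_iff₀ (by positivity)] at hφ
  have h2 := initial_error_le h hβ hφ0
  have h3 := mul_le_mul_of_nonneg_right hφ (Real.sqrt_nonneg (sigmaMin Us Vs))
  have h4 : 0 ≤ ψ * (α * √(sigmaMin Us Vs)) := by positivity
  have h5 := mul_le_mul_of_nonneg_right hc₀ h4
  linarith

/-- The constant in the initialization conditions. -/
noncomputable def initConst (b x y : ℝ) : ℝ := b / (1000 * (1 + b)) / (1 + |x| + |y|) ^ 2

theorem initConst_pos {b : ℝ} (hb : 0 < b) (x y : ℝ) : 0 < initConst b x y := by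
  unfold initConst
  positivity

/-- The effective smallness parameter is `σ = c₀(1 + L₂)`. It must be small by itself and also after
multiplication by either Lipschitz constant relative to `β`; the lower bound `b` stands in for `β`.
-/
theorem initConst_bounds {b : ℝ} (hb : 0 < b) (x y : ℝ) :
    initConst b x y * (1 + |x|) ≤ 1 / 1000 ∧ initConst b x y * (1 + |x|) * |x| ≤ b / 1000 ∧
      initConst b x y * (1 + |x|) * |y| ≤ b / 1000 := by
  have hx := abs_nonneg x
  have hy := abs_nonneg y
  set N := 1 + |x| + |y| with hN
  have hN1 : 1 ≤ N := by linarith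
  have hc := initConst_pos hb x y
  have h1 : initConst b x y * N ^ 2 = b / (1000 * (1 + b)) := by
    rw [initConst, ← hN]
    exact div_mul_cancel₀ _ (by positivity)
  have h2 : b / (1000 * (1 + b)) ≤ 1 / 1000 := by
    rw [div_le_div_iff₀ (by positivity) (by norm_num)]
    linarith
  have h3 : b / (1000 * (1 + b)) ≤ b / 1000 :=
    div_le_div_of_nonneg_left hb.le (by norm_num) (by linarith)
  have key : ∀ z, 0 ≤ z → z ≤ N →
      initConst b x y * (1 + |x|) * z ≤ b / (1000 * (1 + b)) := fun z hz0 hz => by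
    rw [← h1, sq, ← mul_assoc]
    exact mul_le_mul (mul_le_mul_of_nonneg_left (by linarith) hc.le) hz hz0 (by positivity)
  have h4 := key 1 zero_le_one hN1
  rw [mul_one] at h4
  exact ⟨h4.trans h2, (key _ hx (by linarith)).trans h3, (key _ hy (by linarith)).trans h3⟩

end Constants

end LowRank

open LowRank in
theorem theorem3 (L₂ b : ℝ) (hb : 0 < b) :
    (∃ c₀ : ℝ, 0 < c₀ ∧
      ∀ (n q r : ℕ) (f : Matrix (Fin n) (Fin q) ℝ → ℝ)
        (Us : Matrix (Fin n) (Fin r) ℝ) (Vs : Matrix (Fin q) (Fin r) ℝ)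
        (U : ℕ → Matrix (Fin n) (Fin r) ℝ) (V : ℕ → Matrix (Fin q) (Fin r) ℝ)
        (R₀ : Matrix (Fin r) (Fin r) ℝ) (α β ε φ : ℝ),
        NoiselessBalanced f Us Vs →
        0 < α → α ≤ β → b ≤ β → 0 < ε →
        LocalRIP f (region2 Us Vs ε) α β →
        ScoreLipOp f (region2 Us Vs ε) L₂ →
        IsGradientDescent f (stepSize α β Us Vs) U V →
        R₀ ∈ Matrix.orthogonalGroup (Fin r) ℝ →
        Init2 c₀ α β ε φ Us Vs (U 0) (V 0) R₀ →
        ∀ t : ℕ,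
          (∃ G, IsOptAlign (U t) (V t) Us Vs G) ∧
          Dist2LE (U t) (V t) Us Vs (rate α β Us Vs ^ t * φ * tauStar Us Vs)) ∧
    (∀ Linf : ℝ, ∃ c₀ : ℝ, 0 < c₀ ∧
      ∀ (n q r : ℕ) (f : Matrix (Fin n) (Fin q) ℝ → ℝ)
        (Us : Matrix (Fin n) (Fin r) ℝ) (Vs : Matrix (Fin q) (Fin r) ℝ)
        (U : ℕ → Matrix (Fin n) (Fin r) ℝ) (V : ℕ → Matrix (Fin q) (Fin r) ℝ)
        (R₀ : Matrix (Fin r) (Fin r) ℝ) (α β ε φ ψ : ℝ),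
        NoiselessBalanced f Us Vs →
        0 < α → α ≤ β → b ≤ β → 0 < ε → 0 < ψ →
        LocalRIP f (regionInf Us Vs ε) α β →
        ScoreLipOp f (regionInf Us Vs ε) L₂ →
        RowCrossCurvature f (regionInf Us Vs ε) β →
        ScoreLipRow f (regionInf Us Vs ε) Linf →
        IsGradientDescent f (stepSize α β Us Vs) U V →
        R₀ ∈ Matrix.orthogonalGroup (Fin r) ℝ →
        Init2 c₀ α β ε φ Us Vs (U 0) (V 0) R₀ →
        InitInf c₀ α β ε φ ψ Us Vs (U 0) (V 0) R₀ →
        ∀ t : ℕ,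
          (∃ G, IsOptAlign (U t) (V t) Us Vs G) ∧
          Dist2LE (U t) (V t) Us Vs (rate α β Us Vs ^ t * φ * tauStar Us Vs) ∧
          DistInfLE (U t) (V t) Us Vs (rate α β Us Vs ^ t * ψ * omegaStar Us Vs)) := by
  constructor
  · refine ⟨initConst b L₂ 0, initConst_pos hb _ _, ?_⟩
    intro n q r f Us Vs U V R₀ α β ε φ h hα hαβ hbβ hε hRIP hLip hgd hR hinit t
    obtain ⟨hd, hφ⟩ := hinit
    obtain ⟨b1, b2, -⟩ := initConst_bounds hb L₂ 0
    have hβ : 0 < β := hα.trans_le hαβ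
    have hτ := h.tauStar_pos
    have ha : 0 < √(sigmaMin Us Vs) := Real.sqrt_pos.2 h.sigmaMin_pos
    have hmem0 : (Us, Vs) ∈ region2 Us Vs ε :=
      mem_region2_of_le h (G := 1) (d := 0) (by simp [errU_one, errV_one, pairNorm2]) ha
        (mul_pos hε hτ).le
    -- This also shows that `L₂` is positive; nothing was assumed about its sign.
    have hαL := alpha_le_of_scoreLip h hε regionInf_subset hmem0 hRIP hLip
    have hL0 : 0 ≤ L₂ := hα.le.trans hαL
    rw [abs_of_nonneg hL0] at b1 b2
    have hφ0 : 0 ≤ φ := by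
      have h1 := (pairNorm2_nonneg _ _).trans hd
      exact le_of_mul_le_mul_right (by linarith) hτ
    obtain ⟨hr0, hr1⟩ := rate_bounds h hα hαβ
    have hS := initial_error_le_of_init2 h hα hβ hαL (initConst_pos hb L₂ 0).le hφ0
      (hφ.trans (min_le_right _ _))
    have hdε : 1 / 2 * φ * tauStar Us Vs ≤ ε * tauStar Us Vs :=
      mul_le_mul_of_nonneg_right (by linarith [hφ.trans (min_le_left _ _)]) hτ.le
    obtain ⟨G, hG, h1, -⟩ := l2_contraction h hα hαβ hL0 hRIP hLip hgd hR hd hdε hS b1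
      (by linarith) t
    -- All optimal alignments share one error value, so the bound for `G` suffices; the `1/2` in the
    -- initialization is left over as slack.
    refine ⟨⟨G, hG⟩, ⟨G, hG⟩, fun G' hG' => (isOptAlign_iff.1 hG' G).trans (h1.trans ?_)⟩
    have h2 : 0 ≤ rate α β Us Vs ^ t * (φ * tauStar Us Vs) := by positivity
    linarith
  · intro Linf
    refine ⟨initConst b L₂ Linf, initConst_pos hb _ _, ?_⟩
    intro n q r f Us Vs U V R₀ α β ε φ ψ h hα hαβ hbβ hε hψ hRIP hLip hrow hLipRow hgd hR hinit
      hinitInf t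
    obtain ⟨hd, hφ⟩ := hinit
    obtain ⟨hrow0, hψε, hφψ⟩ := hinitInf
    obtain ⟨b1, b2, b3⟩ := initConst_bounds hb L₂ Linf
    have hβ : 0 < β := hα.trans_le hαβ
    have hτ := h.tauStar_pos
    have hω := h.omegaStar_pos
    have ha : 0 < √(sigmaMin Us Vs) := Real.sqrt_pos.2 h.sigmaMin_pos
    have hmem0 : (Us, Vs) ∈ regionInf Us Vs ε := by
      have h0 : ∀ {p : ℕ}, rowNorm (0 : Matrix (Fin p) (Fin r) ℝ) ≤ 0 := fun {p} =>
        rowNorm_le le_rfl fun i => vecNorm_zero.le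
      refine mem_regionInf_of_le h (G := 1) (d := 0) (e := 0)
        (by simp [errU_one, errV_one, pairNorm2]) (by linarith) (mul_pos hε hτ).le ?_ ?_
      · rw [errU_one, errV_one, sub_self, sub_self]
        exact max_le h0 h0
      · rw [zero_div]
        linarith [mul_pos hε hω]
    have hαL := alpha_le_of_scoreLip h hε subset_rfl hmem0 hRIP hLip
    have hL0 : 0 ≤ L₂ := hα.le.trans hαL
    rw [abs_of_nonneg hL0] at b1 b2 b3
    have hφ0 : 0 ≤ φ := by
      have h1 := (pairNorm2_nonneg _ _).trans hd
      exact le_of_mul_le_mul_right (by linarith) hτ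
    obtain ⟨hr0, hr1⟩ := rate_bounds h hα hαβ
    have hc₀ := (initConst_pos hb L₂ Linf).le
    have hS := initial_error_le_of_init2 h hα hβ hαL hc₀ hφ0 (hφ.trans (min_le_right _ _))
    have hS' := initial_error_le_of_initInf h hα hβ hψ hφ0
      (by linarith [mul_nonneg hc₀ hL0]) hφψ
    have hdε : 1 / 2 * φ * tauStar Us Vs ≤ ε * tauStar Us Vs :=
      mul_le_mul_of_nonneg_right (by linarith [hφ.trans (min_le_left _ _)]) hτ.le
    have hd0 := (pairNorm2_nonneg _ _).trans hd
    obtain ⟨G, hG, h1, -, g1, g2, hres⟩ := linf_contraction h hα hαβ hL0 hRIP hLip hrow hLipRow hgd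
      hR hd hdε hS b1 (by linarith) (by linarith) hψ hψε hS' hrow0 t
    have hp0 : 0 ≤ rate α β Us Vs ^ t := pow_nonneg hr0 t
    refine ⟨⟨G, hG⟩, ⟨⟨G, hG⟩, fun G' hG' => (isOptAlign_iff.1 hG' G).trans (h1.trans ?_)⟩,
      ⟨G, hG⟩, fun G' hG' => ?_⟩
    · have h2 : 0 ≤ rate α β Us Vs ^ t * (φ * tauStar Us Vs) := by positivity
      linarith
    · have hκ := h.one_le_kappa
      have k1 := le_of_mul_kappa_le hκ hβ ha hαβ (by norm_num) hd0
        (hS.trans (mul_le_mul_of_nonneg_right b1 (by positivity)))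
      have k2 := le_of_mul_kappa_le hκ hβ ha hαβ (by positivity) hd0 hS'
      have hp1 : rate α β Us Vs ^ t ≤ 1 := pow_le_one₀ hr0 hr1
      have k3 := mul_le_mul_of_nonneg_right hp1 hd0
      -- Row errors, unlike the Frobenius error, may differ between optimal alignments. The factor
      -- `0.8 * 1.02` leaves room to pass from the constructed `G` to an arbitrary `G'`.
      have h2 := pairNormInf_realign h h1 ((isOptAlign_iff.1 hG' G).trans h1) (by linarith)
        (pairNormInf_err_le g1 g2 hres)
      have k4 : rate α β Us Vs ^ t * (1 / 2 * φ * tauStar Us Vs) / √(sigmaMin Us Vs) ≤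
          1 / 1000 := (div_le_iff₀ ha).2 (by linarith)
      have k5 : rate α β Us Vs ^ t * (1 / 2 * φ * tauStar Us Vs) / √(sigmaMin Us Vs) ≤
          1 / 1000 * (rate α β Us Vs ^ t * ψ) :=
        (div_le_iff₀ ha).2 (by linarith [mul_le_mul_of_nonneg_left k2 hp0])
      have hE : 0 ≤ rate α β Us Vs ^ t * ψ * omegaStar Us Vs := by positivity
      have k6 := mul_le_mul_of_nonneg_left k4 hE
      have k7 := mul_le_mul_of_nonneg_right k5 hω.le
      linarith
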